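/- Let $m\ge 2$ and $r\ge 1$ be integers such that $m^{1/p}$ is not an integer for any prime $p$ dividing $r$, and let $b=m^{1/r}$. For $n\ge 1$ let $\xi_n$ be the fractional part of $\log_b n$, and let $\xi_{1,N}\le\dots\le\xi_{N,N}$ be $\xi_1,\dots,\xi_N$ in increasing order (with multiplicity), $\xi_{N+1,N}:=\xi_{1,N}+1$. For fixed $N$ let $\eta_n$ $(1\le n\le N)$ be the fractional part of $\log_b(n/N)$, ordered in the same way as $\eta_{1,N}\le\dots\le\eta_{N,N}$, $\eta_{N+1,N}:=\eta_{1,N}+1$, and put $\tilde\eta_{n,N}=\frac{b^{\eta_{n,N}}-1}{b-1}$ for $1\le n\le N+1$. Define the finite $q$-Pochhammer symbol $(a;q)_k=\prod_{n=0}^{k-1}(1-aq^n)$, the function $F_r(a)=a\frac{\partial}{\partial a}(a;b^{-1})_r-(a;b^{-1})_r$, and the generalized density on $a>0$ $$R_r(a,b)=(b^{-1};b^{-1})_{r-1}\,\delta(a-1)+\begin{cases}\frac{\partial^2}{\partial a^2}(a;b^{-1})_r&(0<a<1)\\ 0&(a>1).\end{cases}$$ (1) For every bounded continuous $f:\mathbb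 R_{\ge0}\to\mathbb R$, $$\lim_{N\to\infty}\frac1N\sum_{n=1}^N f\big(N(\xi_{n+1,N}-\xi_{n,N})\big)=\int_{[0,\infty)}f(s)\,P(s)\,ds,$$ $$P(s)=b^{-r}\delta(s)+\begin{cases}\frac{1}{\log b}s^{-2}\big(F_r(s\log b)-F_r(sb^{-1}\log b)\big)&(0<s<\frac1{\log b})\\ -\frac1{\log b}s^{-2}F_r(sb^{-1}\log b)&(\frac1{\log b}<s<\frac b{\log b})\\ 0&(s>\frac b{\log b}).\end{cases}$$ (2) For every bounded continuous $f:[0,1]\times\mathbb R_{\ge0}\to\mathbb R$, $$\lim_{N\to\infty}\frac1N\sum_{n=1}^N f\big(\eta_{n,N},N(\eta_{n+1,N}-\eta_{n,N})\big)=\int_0^1\int_{[0,\infty)}f(x,s)\,P(x,s)\,ds\,dx,$$ $$P(x,s)=\frac{\log b}{b-1}\,b^{x-r}\,\delta(s)+(b^{x-1}\log b)^2\,R_r(s\,b^{x-1}\log b,\,b).$$ (3) For every bounded continuous $f:[0,1]\times\mathbb R_{\ge0}\to\mathbb R$, $$\lim_{N\to\infty}\frac1N\sum_{n=1}^N f\big(\tilde\eta_{n,N},N(\tilde\eta_{n+1,N}-\tilde\eta_{n,N})\big)=\int_0^1\int_{[0,\infty)}f(x,s)\,\tilde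 P(s)\,ds\,dx,$$ $$\tilde P(s)=b^{-r}\,\delta(s)+(1-b^{-1})^2\,R_r\big((1-b^{-1})s,\,b\big).$$ Here $\delta(s)$ is the unit point mass at $s=0$, counted fully in the integrals over $[0,\infty)$, and for $c>0$ the term $\delta(cs-1)$ coming from $R_r(cs,b)$ is $c^{-1}$ times the unit point mass at $s=1/c$. -/

import Mathlib

open MeasureTheory Filter Topology Set
open scoped ENNReal

noncomputable section

namespace LogGaps

/-! ### The empirical point sets and their gap measures -/

/-- `xi b n`: the fractional part of `log_b n`. -/
def xi (b : ℝ) (n : ℕ) : ℝ := Int.fract (Real.logb b n)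

/-- `eta b N n`: the fractional part of `log_b (n / N)`. -/
def eta (b : ℝ) (N n : ℕ) : ℝ := Int.fract (Real.logb b ((n : ℝ) / N))

/-- The values `v 1, …, v N` as an `N`-tuple. -/
def firstValues (v : ℕ → ℝ) (N : ℕ) : Fin N → ℝ := fun j => v (j + 1)

/-- The numbers `v 1, …, v N` listed in increasing order, with multiplicity. Indices start at `0`:
`ordered v N 0 ≤ … ≤ ordered v N (N - 1)`, and the next entry is
`ordered v N N = ordered v N 0 + 1`, so that the last gap is the one across the end of the
circle `ℝ / ℤ`. -/
def ordered (v : ℕ → ℝ) (N i : ℕ) : ℝ :=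
  if h : i < N then firstValues v N (Tuple.sort (firstValues v N) ⟨i, h⟩)
  else if h0 : 0 < N then firstValues v N (Tuple.sort (firstValues v N) ⟨0, h0⟩) + 1
  else 0

/-- The map `x ↦ (b ^ x - 1) / (b - 1)`, which makes the points `eta` uniformly distributed. -/
def unif (b x : ℝ) : ℝ := (b ^ x - 1) / (b - 1)

/-- `(1 / N) ∑ δ(s - N (u (i + 1) - u i))`, for an ordered list `u 0, …, u N`. -/
def gapMeasure (u : ℕ → ℝ) (N : ℕ) : Measure ℝ :=
  ∑ i ∈ Finset.range N, (N : ℝ≥0∞)⁻¹ • Measure.dirac ((N : ℝ) * (u (i + 1) - u i))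

/-- `(1 / N) ∑ δ(x - u i) δ(s - N (u (i + 1) - u i))`, for an ordered list `u 0, …, u N`. -/
def jointGapMeasure (u : ℕ → ℝ) (N : ℕ) : Measure (ℝ × ℝ) :=
  ∑ i ∈ Finset.range N, (N : ℝ≥0∞)⁻¹ • Measure.dirac (u i, (N : ℝ) * (u (i + 1) - u i))

/-- The gap measure `P_N(s) ds` of the fractional parts of `log_b n`, `n = 1, …, N`. -/
def PN (b : ℝ) (N : ℕ) : Measure ℝ := gapMeasure (ordered (xi b) N) N

/-- The joint measure `P_N(x, s) ds dx` of the points `eta` and their subsequent gaps. -/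
def PNjoint (b : ℝ) (N : ℕ) : Measure (ℝ × ℝ) := jointGapMeasure (ordered (eta b N) N) N

/-- The joint measure of the rescaled points `(b ^ eta - 1) / (b - 1)` and their gaps. The entry
following the last one is `unif b (ordered (eta b N) N 0 + 1)`; since the smallest of the `eta` is
`0` (attained at `n = N`), this is also the smallest rescaled point plus one. -/
def PNtilde (b : ℝ) (N : ℕ) : Measure (ℝ × ℝ) :=
  jointGapMeasure (fun i => unif b (ordered (eta b N) N i)) N

/-! ### The finite q-Pochhammer symbol and the limit laws -/

/-- The finite q-Pochhammer symbol `(a; q)_r = ∏_{n < r} (1 - a q ^ n)`. -/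
def qPoch (a q : ℝ) (r : ℕ) : ℝ := ∏ n ∈ Finset.range r, (1 - a * q ^ n)

/-- `F_r(a) = a ∂/∂a (a; b⁻¹)_r - (a; b⁻¹)_r`. -/
def F (b : ℝ) (r : ℕ) (a : ℝ) : ℝ :=
  a * deriv (fun t => qPoch t b⁻¹ r) a - qPoch a b⁻¹ r

/-- The absolutely continuous part of the limiting gap density, as a function of `s > 0`. -/
def gapDensity (b : ℝ) (r : ℕ) (s : ℝ) : ℝ :=
  if s < 1 / Real.log b then
    1 / Real.log b * (s ^ 2)⁻¹ * (F b r (s * Real.log b) - F b r (s * b⁻¹ * Real.log b))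
  else if s < b / Real.log b then
    -(1 / Real.log b * (s ^ 2)⁻¹ * F b r (s * b⁻¹ * Real.log b))
  else 0

/-- The limiting gap law: an atom of mass `b ^ (-r)` at zero plus the density `gapDensity b r` on
`(0, ∞)`. The density is nonnegative (`gapDensity_nonneg`). -/
def gapLaw (b : ℝ) (r : ℕ) : Measure ℝ :=
  ENNReal.ofReal (b ^ (-(r : ℝ))) • Measure.dirac 0 +
    (volume.restrict (Ioi 0)).withDensity (fun s => ENNReal.ofReal (gapDensity b r s))

/-- The measure `R_r(a, b) da`: an atom of mass `(b⁻¹; b⁻¹)_{r-1}` at `a = 1` plus the density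
`∂²/∂a² (a; b⁻¹)_r` on `(0, 1)`. The density is nonnegative (`qPoch_deriv2_nonneg`). -/
def R (b : ℝ) (r : ℕ) : Measure ℝ :=
  ENNReal.ofReal (qPoch b⁻¹ b⁻¹ (r - 1)) • Measure.dirac 1 +
    (volume.restrict (Ioo 0 1)).withDensity
      (fun a => ENNReal.ofReal (iteratedDeriv 2 (fun t => qPoch t b⁻¹ r) a))

/-- For a measure with generalized density `g(a) da` and `c > 0`, the measure with generalized
density `g(c s) ds`; for instance `δ(a - 1)` becomes `δ(c s - 1) = c⁻¹ δ(s - 1 / c)`. -/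
def dilate (c : ℝ) (μ : Measure ℝ) : Measure ℝ :=
  ENNReal.ofReal c⁻¹ • μ.map (fun a => a / c)

/-- The measure `P(x, s) ds`, for fixed `x`:
`(log b / (b - 1)) b ^ (x - r) δ(s) + (b ^ (x - 1) log b) ^ 2 R_r(s b ^ (x - 1) log b, b)`. -/
def jointGapLaw (b : ℝ) (r : ℕ) (x : ℝ) : Measure ℝ :=
  ENNReal.ofReal (Real.log b / (b - 1) * b ^ (x - (r : ℝ))) • Measure.dirac 0 +
    ENNReal.ofReal ((b ^ (x - 1) * Real.log b) ^ 2) • dilate (b ^ (x - 1) * Real.log b) (R b r)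

/-- The rescaled limit law `b ^ (-r) δ(s) + (1 - b⁻¹) ^ 2 R_r((1 - b⁻¹) s, b)`. -/
def rescaledGapLaw (b : ℝ) (r : ℕ) : Measure ℝ :=
  ENNReal.ofReal (b ^ (-(r : ℝ))) • Measure.dirac 0 +
    ENNReal.ofReal ((1 - b⁻¹) ^ 2) • dilate (1 - b⁻¹) (R b r)

/-! ### The densities above are nonnegative, so `ENNReal.ofReal` truncates nothing -/

theorem qPoch_signs {q : ℝ} (hq0 : 0 ≤ q) (hq1 : q ≤ 1) (r : ℕ) :
    ∃ p1 p2 : ℝ → ℝ, (∀ a, HasDerivAt (fun t => qPoch t q r) (p1 a) a) ∧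
      (∀ a, HasDerivAt p1 (p2 a) a) ∧
      ∀ a ∈ Icc (0 : ℝ) 1, 0 ≤ qPoch a q r ∧ p1 a ≤ 0 ∧ 0 ≤ p2 a := by
  induction r with
  | zero =>
    refine ⟨fun _ => 0, fun _ => 0, fun a => ?_, fun a => hasDerivAt_const a 0, fun a _ => ?_⟩
    · simpa [qPoch] using hasDerivAt_const a (1 : ℝ)
    · simp [qPoch]
  | succ r ih =>
    obtain ⟨p1, p2, h1, h2, hs⟩ := ih
    have hl : ∀ a : ℝ, HasDerivAt (fun t : ℝ => 1 - t * q ^ r) (-(q ^ r)) a := fun a => by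
      simpa using ((hasDerivAt_id a).mul_const (q ^ r)).const_sub 1
    refine ⟨fun a => p1 a * (1 - a * q ^ r) + qPoch a q r * -(q ^ r),
      fun a => (p2 a * (1 - a * q ^ r) + p1 a * -(q ^ r)) + p1 a * -(q ^ r),
      fun a => ?_, fun a => ?_, fun a ha => ?_⟩
    · have h := (h1 a).mul (hl a)
      have e : (fun t => qPoch t q (r + 1)) = (fun t => qPoch t q r) * fun t => 1 - t * q ^ r := by
        funext t; simp [qPoch, Finset.prod_range_succ]
      rw [e]; exact h
    · exact ((h2 a).mul (hl a)).add ((h1 a).mul_const _)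
    · obtain ⟨s0, s1, s2⟩ := hs a ha
      have hqr0 : 0 ≤ q ^ r := pow_nonneg hq0 r
      have hqr1 : q ^ r ≤ 1 := pow_le_one₀ hq0 hq1
      have hf : 0 ≤ 1 - a * q ^ r := by nlinarith [ha.1, ha.2]
      refine ⟨?_, ?_, ?_⟩
      · have : qPoch a q (r + 1) = qPoch a q r * (1 - a * q ^ r) := by
          simp [qPoch, Finset.prod_range_succ]
        rw [this]; exact mul_nonneg s0 hf
      · have := mul_nonneg s0 hqr0
        have := mul_nonneg (neg_nonneg.2 s1) hf
        dsimp only; linarith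
      · have := mul_nonneg s2 hf
        have := mul_nonneg (neg_nonneg.2 s1) hqr0
        dsimp only; linarith

theorem qPoch_deriv2_nonneg {b : ℝ} (hb : 1 < b) (r : ℕ) {a : ℝ} (ha : a ∈ Icc (0 : ℝ) 1) :
    0 ≤ iteratedDeriv 2 (fun t => qPoch t b⁻¹ r) a := by
  obtain ⟨p1, p2, h1, h2, hs⟩ :=
    qPoch_signs (q := b⁻¹) (by positivity) (inv_le_one_of_one_le₀ hb.le) r
  have e1 : deriv (fun t => qPoch t b⁻¹ r) = p1 := funext fun t => (h1 t).deriv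
  rw [iteratedDeriv_succ, iteratedDeriv_one, e1, (h2 a).deriv]
  exact (hs a ha).2.2

theorem gapDensity_nonneg {b : ℝ} (hb : 1 < b) (r : ℕ) {s : ℝ} (hs0 : 0 < s) :
    0 ≤ gapDensity b r s := by
  obtain ⟨p1, p2, h1, h2, hs⟩ :=
    qPoch_signs (q := b⁻¹) (by positivity) (inv_le_one_of_one_le₀ hb.le) r
  have hl : 0 < Real.log b := Real.log_pos hb
  have hb0 : 0 < b := by linarith
  have eF : F b r = fun a => a * p1 a - qPoch a b⁻¹ r := by
    funext a; simp only [F, (h1 a).deriv]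
  have hF : ∀ a, HasDerivAt (F b r) (a * p2 a) a := fun a => by
    rw [eF]
    have h := ((hasDerivAt_id a).mul (h2 a)).sub (h1 a)
    have e : a * p2 a = 1 * p1 a + id a * p2 a - p1 a := by simp
    rw [e]; exact h
  have hmono : MonotoneOn (F b r) (Icc 0 1) := by
    refine monotoneOn_of_deriv_nonneg (convex_Icc 0 1)
      (fun a _ => (hF a).continuousAt.continuousWithinAt)
      (fun a _ => (hF a).differentiableAt.differentiableWithinAt) fun a ha => ?_
    rw [(hF a).deriv]
    have ha' : a ∈ Icc (0 : ℝ) 1 := interior_subset ha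
    exact mul_nonneg ha'.1 (hs a ha').2.2
  have hpos : 0 ≤ s * b⁻¹ * Real.log b := by positivity
  have hle : s * b⁻¹ * Real.log b ≤ s * Real.log b := by
    have : b⁻¹ ≤ 1 := inv_le_one_of_one_le₀ hb.le
    have h3 := mul_le_mul_of_nonneg_left this (mul_pos hs0 hl).le
    nlinarith
  have hk : 0 ≤ 1 / Real.log b * (s ^ 2)⁻¹ := by positivity
  unfold gapDensity
  split_ifs with c1 c2
  · have : s * Real.log b < 1 := (lt_div_iff₀ hl).1 c1
    exact mul_nonneg hk (sub_nonneg.2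
      (hmono ⟨hpos, by linarith⟩ ⟨by positivity, this.le⟩ hle))
  · have h4 : s * Real.log b < b := (lt_div_iff₀ hl).1 c2
    have h5 : s * b⁻¹ * Real.log b ≤ 1 := by
      have : s * b⁻¹ * Real.log b = s * Real.log b / b := by field_simp
      rw [this, div_le_one hb0]; exact h4.le
    obtain ⟨t0, t1, _⟩ := hs _ ⟨hpos, h5⟩
    have h6 : F b r (s * b⁻¹ * Real.log b) ≤ 0 := by
      rw [eF]; dsimp only
      have := mul_nonneg hpos (neg_nonneg.2 t1)
      linarith
    have := mul_nonneg hk (neg_nonneg.2 h6)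
    linarith
  · exact le_rfl

end LogGaps

end

/-!
The gap statistics of `log_b n mod 1`, `n ≤ N`, for `b = m ^ (1 / r)`.

In the coordinate `y = b ^ eta ∈ [1, b)` the points are `b ^ k n / N` with `k ≥ 0`. Since
`b ^ r = m` is an integer, the lattice `b ^ (k + r) ℤ` lies in `b ^ k ℤ`. Up to multiplicity the
point set is therefore a superposition of only `r` lattices `b ^ j ℤ / N`, `1 ≤ j ≤ r`, together
with the point `y = 1` (`exists_latticePoint_eq`, `abs_sum_image_eta_sub_le`). Repeated points have
gap zero and account for the atom of mass `b ^ (-r)`.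

The root condition on `m` makes `1, b, …, b ^ (r - 1)` linearly independent over `ℚ`
(`int_relation_eq_zero`): all conjugates of `b` have absolute value `b`, so if `b` has degree `d`
then `b ^ d`, and hence `b ^ gcd d r`, is rational. As a consequence distinct lattices do not meet
away from the origin, and by Weyl's criterion the positions of a point of one lattice relative to
the `r - 1` others equidistribute on a torus, jointly with the place of the point in `[1, b)`
(`tendsto_rowAverage_mFourier_torusPoint`, `tendsto_average_cube`). The gap is a function of these
positions that is continuous off a null set, so it converges in law: from a point of lattice `i`,
the gap exceeds `a < b` with probability `∏_{j ≠ i} (1 - a b ^ (-j))`. Weighting the lattices by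
their densities `b ^ (-i)` and summing over `i` produces the derivative of
`∏_j (1 - a b ^ (-j)) = (a / b; b⁻¹)_r`, which is how the measure `R` arises (`sum_latticeGapLaw`).

This gives the law of the rescaled points. The law of the pairs `(eta, gap)` follows by linearizing
the logarithm, a gap `s` at `y` becoming `s / (y log b)` up to `O(1 / N)` (`tendsto_average_log`).
The points `xi` are a rotation of the points `eta` (`sum_ordered_rotate`), and averaging over
`y ∈ [1, b]` turns `R` into the density `gapDensity`, by comparison of the tails
(`gapDensity_eq_map`).
-/

noncomputable section

namespace LogGaps

/-! ### Rational independence of the powers of `b` -/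

/-- All complex conjugates of `b` have absolute value `b`, so the constant term of its minimal
polynomial is `± b ^ d`. -/
theorem exists_rat_eq_pow_natDegree_minpoly {b : ℝ} (hb : 0 < b) {m r : ℕ} (hr : 0 < r)
    (hbr : b ^ r = m) : ∃ q : ℚ, b ^ (minpoly ℚ b).natDegree = q := by
  have hint : IsIntegral ℚ b := by
    refine ⟨Polynomial.X ^ r - Polynomial.C (m : ℚ),
      Polynomial.monic_X_pow_sub_C _ hr.ne', ?_⟩
    simp [hbr]
  set P := (minpoly ℚ b).map (algebraMap ℚ ℂ) with hP
  have hmon : P.Monic := (minpoly.monic hint).map _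
  have hroots : ∀ z ∈ P.roots, ‖z‖ = b := by
    intro z hz
    have hz' : P.eval z = 0 := (Polynomial.mem_roots'.1 hz).2
    have hdvd : minpoly ℚ b ∣ Polynomial.X ^ r - Polynomial.C (m : ℚ) :=
      minpoly.dvd _ _ (by simp [hbr])
    obtain ⟨Q, hQ⟩ := hdvd
    have hz2 : z ^ r - m = 0 := by
      have h := congrArg (fun p => (Polynomial.map (algebraMap ℚ ℂ) p).eval z) hQ
      simp only [Polynomial.map_mul, Polynomial.eval_mul] at h
      rw [hz', zero_mul] at h
      simpa using h
    have hz3 : ‖z‖ ^ r = b ^ r := by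
      rw [← norm_pow, sub_eq_zero.1 hz2, hbr]; simp
    exact (pow_left_inj₀ (norm_nonneg z) hb.le hr.ne').1 hz3
  have hcard : P.roots.card = (minpoly ℚ b).natDegree := by
    rw [← (IsAlgClosed.splits P).natDegree_eq_card_roots, Polynomial.natDegree_map]
  have hprod : ‖P.roots.prod‖ = b ^ (minpoly ℚ b).natDegree := by
    rw [← hcard]
    have : ∀ s : Multiset ℂ, (∀ z ∈ s, ‖z‖ = b) → ‖s.prod‖ = b ^ s.card := by
      intro s
      induction s using Multiset.induction_on with
      | empty => simp
      | cons a s ih =>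
        intro h
        rw [Multiset.prod_cons, norm_mul, h a (Multiset.mem_cons_self a s),
          ih fun z hz => h z (Multiset.mem_cons_of_mem hz), Multiset.card_cons, pow_succ']
    exact this _ hroots
  refine ⟨|(minpoly ℚ b).coeff 0|, ?_⟩
  have h0 := (IsAlgClosed.splits P).coeff_zero_eq_prod_roots_of_monic hmon
  have h1 := congrArg norm h0
  rw [norm_mul, norm_pow, norm_neg, norm_one, one_pow, one_mul, hprod, hP,
    Polynomial.coeff_map] at h1
  rw [← h1]
  simp

/-- Under the root condition on `m`, the number `b = m ^ (1 / r)` has degree at least `r`. -/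
theorem le_natDegree_minpoly {b : ℝ} (hb : 0 < b) {m r : ℕ} (hr : 0 < r) (hbr : b ^ r = m)
    (hroot : ∀ p : ℕ, p.Prime → p ∣ r → ¬ ∃ k : ℤ, (m : ℝ) ^ ((1 : ℝ) / p) = k) :
    r ≤ (minpoly ℚ b).natDegree := by
  obtain ⟨q, hq⟩ := exists_rat_eq_pow_natDegree_minpoly hb hr hbr
  have hint : IsIntegral ℚ b := by
    refine ⟨Polynomial.X ^ r - Polynomial.C (m : ℚ),
      Polynomial.monic_X_pow_sub_C _ hr.ne', ?_⟩
    simp [hbr]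
  set d := (minpoly ℚ b).natDegree with hd
  have hdpos : 0 < d := minpoly.natDegree_pos hint
  set g := Nat.gcd d r with hg
  have hgr : ∃ q' : ℚ, b ^ g = q' := by
    refine ⟨q ^ (Nat.gcdA d r) * (m : ℚ) ^ (Nat.gcdB d r), ?_⟩
    have h := Nat.gcd_eq_gcd_ab d r
    rw [← zpow_natCast b g, hg, h, zpow_add₀ hb.ne', zpow_mul, zpow_mul, zpow_natCast,
      zpow_natCast, hq, hbr]
    push_cast
    rfl
  obtain ⟨q', hq'⟩ := hgr
  have hgdvd : g ∣ r := Nat.gcd_dvd_right d r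
  obtain ⟨e, he⟩ := hgdvd
  by_cases he1 : e = 1
  · rw [he1, mul_one] at he
    rw [he]
    exact Nat.le_of_dvd hdpos (Nat.gcd_dvd_left d r)
  · exfalso
    obtain ⟨p, hp, t, ht⟩ := Nat.exists_prime_and_dvd he1
    have hpr : p ∣ r := by rw [he, ht]; exact ⟨g * t, by ring⟩
    have hxp : (b ^ (g * t)) ^ p = ((m : ℤ) : ℝ) := by
      rw [← pow_mul, Int.cast_natCast, ← hbr, he, ht]; congr 1; ring
    have hpow : (m : ℝ) ^ ((1 : ℝ) / p) = b ^ (g * t) := by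
      rw [Int.cast_natCast] at hxp
      rw [← hxp, one_div, Real.pow_rpow_inv_natCast (by positivity) hp.ne_zero]
    have hirr : Irrational (b ^ (g * t)) := by
      refine irrational_nrt_of_notint_nrt p m hxp ?_ hp.pos
      rintro ⟨k, hk⟩
      exact hroot p hp hpr ⟨k, by rw [hpow, hk]⟩
    refine hirr ⟨q' ^ t, ?_⟩
    rw [pow_mul, hq']
    push_cast
    rfl

/-- The powers `b ^ 0, …, b ^ (r - 1)` satisfy no nontrivial linear relation over `ℤ`. -/
theorem int_relation_eq_zero {b : ℝ} (hb : 0 < b) {m r : ℕ} (hr : 0 < r) (hbr : b ^ r = m)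
    (hroot : ∀ p : ℕ, p.Prime → p ∣ r → ¬ ∃ k : ℤ, (m : ℝ) ^ ((1 : ℝ) / p) = k)
    (l : Fin r → ℤ) (hl : ∑ j, (l j : ℝ) * b ^ (j : ℕ) = 0) : l = 0 := by
  have hle := le_natDegree_minpoly hb hr hbr hroot
  have hli := (linearIndependent_pow (K := ℚ) b).comp (Fin.castLE hle) (Fin.castLE_injective hle)
  rw [Fintype.linearIndependent_iff] at hli
  funext j
  have := hli (fun j => (l j : ℚ)) (by simpa [Algebra.smul_def] using hl) j
  simpa using this

/-! ### Equidistribution on tori -/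

instance : NullSingletonClass (volume : Measure UnitAddCircle) :=
  ⟨fun x => by
    have h := AddCircle.volume_closedBall (T := 1) (x := x) 0
    simpa using h⟩

instance : IsProbabilityMeasure (volume : Measure UnitAddCircle) := ⟨by simp⟩

theorem integral_mFourier_eq_zero {d : ℕ} {k : Fin d → ℤ} (hk : k ≠ 0) :
    ∫ z : UnitAddTorus (Fin d), UnitAddTorus.mFourier k z = 0 := by
  obtain ⟨j, hj⟩ := Function.ne_iff.1 hk
  have h := integral_fintype_prod_volume_eq_prod (𝕜 := ℂ) (ι := Fin d)
    (E := fun _ => UnitAddCircle) (fun j z => fourier (k j) z)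
  have e : (fun z : UnitAddTorus (Fin d) => UnitAddTorus.mFourier k z) =
    fun z => ∏ j, fourier (k j) (z j) := rfl
  rw [e]
  refine h.trans (Finset.prod_eq_zero (Finset.mem_univ j) ?_)
  exact integral_eq_zero_of_add_right_eq_neg
    (fourier_add_half_inv_index (by simpa using hj) one_pos)

/-- The average of `Ψ` over the first `N` points of the `N`-th row of a triangular array. -/
def rowAverage {X E : Type*} [AddCommGroup E] [Module ℝ E] (z : ℕ → ℕ → X) (Ψ : X → E) (N : ℕ) :
    E := (N : ℝ)⁻¹ • ∑ n ∈ Finset.Icc 1 N, Ψ (z N n)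

theorem norm_rowAverage_le {X E : Type*} [SeminormedAddCommGroup E] [NormedSpace ℝ E]
    (z : ℕ → ℕ → X) {Ψ : X → E} {C : ℝ} (hC : 0 ≤ C) (h : ∀ x, ‖Ψ x‖ ≤ C) (N : ℕ) :
    ‖rowAverage z Ψ N‖ ≤ C := by
  unfold rowAverage
  rw [norm_smul, norm_inv, Real.norm_natCast]
  rcases Nat.eq_zero_or_pos N with rfl | hN
  · simpa using hC
  have h1 : ‖∑ n ∈ Finset.Icc 1 N, Ψ (z N n)‖ ≤ N * C := by
    refine (norm_sum_le_of_le _ fun n _ => h (z N n)).trans ?_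
    simp
  rw [inv_mul_le_iff₀ (by exact_mod_cast hN)]
  exact h1

theorem rowAverage_add {X E : Type*} [AddCommGroup E] [Module ℝ E] (z : ℕ → ℕ → X)
    (f g : X → E) (N : ℕ) : rowAverage z (f + g) N = rowAverage z f N + rowAverage z g N := by
  simp [rowAverage, Finset.sum_add_distrib]

theorem rowAverage_sub {X E : Type*} [AddCommGroup E] [Module ℝ E] (z : ℕ → ℕ → X)
    (f g : X → E) (N : ℕ) : rowAverage z (f - g) N = rowAverage z f N - rowAverage z g N := by
  simp [rowAverage, smul_sub]

/-- Weyl's criterion for a triangular array of points on a torus. -/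
theorem tendsto_rowAverage_of_mFourier {d : ℕ} (z : ℕ → ℕ → UnitAddTorus (Fin d))
    (hz : ∀ k : Fin d → ℤ, k ≠ 0 →
      Tendsto (rowAverage z (UnitAddTorus.mFourier k)) atTop (𝓝 0))
    (Ψ : C(UnitAddTorus (Fin d), ℂ)) :
    Tendsto (rowAverage z Ψ) atTop (𝓝 (∫ x, Ψ x)) := by
  have hint : ∀ P : C(UnitAddTorus (Fin d), ℂ), Integrable P (volume : Measure _) := fun P =>
    P.continuous.integrable_of_hasCompactSupport (HasCompactSupport.of_compactSpace P)
  have hspan : ∀ P ∈ Submodule.span ℂ (range (UnitAddTorus.mFourier (d := Fin d))),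
      Tendsto (rowAverage z P) atTop (𝓝 (∫ x, P x)) := by
    intro P hP
    induction hP using Submodule.span_induction with
    | mem P h =>
      obtain ⟨k, rfl⟩ := h
      by_cases hk : k = 0
      · subst hk
        rw [UnitAddTorus.mFourier_zero]
        refine tendsto_const_nhds.congr' ?_
        filter_upwards [eventually_gt_atTop 0] with N hN
        have : (N : ℂ) ≠ 0 := by exact_mod_cast hN.ne'
        simp [rowAverage, this]
      · rw [integral_mFourier_eq_zero hk]
        exact hz k hk
    | zero => simpa using tendsto_const_nhds.congr fun N => by simp [rowAverage]
    | add P Q _ _ hP hQ =>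
      have e : ∫ x, (P + Q) x = (∫ x, P x) + ∫ x, Q x := integral_add (hint P) (hint Q)
      rw [e]
      refine (hP.add hQ).congr fun N => ?_
      rw [ContinuousMap.coe_add, rowAverage_add]
    | smul a P _ hP =>
      have e : ∫ x, (a • P) x = a • ∫ x, P x := integral_smul a P
      rw [e]
      refine (hP.const_smul a).congr fun N => ?_
      simp only [rowAverage, ContinuousMap.coe_smul, Pi.smul_apply, ← Finset.smul_sum]
      rw [smul_comm]
  rw [Metric.tendsto_atTop]
  intro ε hε
  have hmem : Ψ ∈ (Submodule.span ℂ
      (range (UnitAddTorus.mFourier (d := Fin d)))).topologicalClosure := by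
    rw [UnitAddTorus.span_mFourier_closure_eq_top]; trivial
  obtain ⟨P, hP, hPΨ⟩ := Metric.mem_closure_iff.1 hmem (ε / 3) (by positivity)
  obtain ⟨N₀, hN₀⟩ := Metric.tendsto_atTop.1 (hspan P hP) (ε / 3) (by positivity)
  refine ⟨N₀, fun N hN => ?_⟩
  have hb : ∀ x, ‖(⇑Ψ - ⇑P) x‖ ≤ dist Ψ P := fun x => by
    rw [Pi.sub_apply, ← dist_eq_norm]; exact ContinuousMap.dist_apply_le_dist x
  have h1 : dist (rowAverage z Ψ N) (rowAverage z P N) ≤ dist Ψ P := by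
    rw [dist_eq_norm, ← rowAverage_sub]
    exact norm_rowAverage_le z dist_nonneg hb N
  have h2 : dist (∫ x, P x) (∫ x, Ψ x) ≤ dist Ψ P := by
    rw [dist_comm, dist_eq_norm, ← integral_sub (hint Ψ) (hint P)]
    refine (norm_integral_le_of_norm_le_const (.of_forall hb)).trans ?_
    simp
  calc dist (rowAverage z Ψ N) (∫ x, Ψ x)
      ≤ dist (rowAverage z Ψ N) (rowAverage z P N) + dist (rowAverage z P N) (∫ x, P x)
        + dist (∫ x, P x) (∫ x, Ψ x) := dist_triangle4 _ _ _ _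
    _ < ε := by linarith [hN₀ N hN]

theorem tendsto_rowAverage_real_of_mFourier {d : ℕ} (z : ℕ → ℕ → UnitAddTorus (Fin d))
    (hz : ∀ k : Fin d → ℤ, k ≠ 0 →
      Tendsto (rowAverage z (UnitAddTorus.mFourier k)) atTop (𝓝 0))
    {Ψ : UnitAddTorus (Fin d) → ℝ} (hΨ : Continuous Ψ) :
    Tendsto (rowAverage z Ψ) atTop (𝓝 (∫ x, Ψ x)) := by
  have h := tendsto_rowAverage_of_mFourier z hz ⟨fun x => (Ψ x : ℂ), by fun_prop⟩
  have h2 := (Complex.continuous_re.tendsto _).comp h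
  have e : (∫ x, ((Ψ x : ℝ) : ℂ)) = ((∫ x, Ψ x : ℝ) : ℂ) := integral_ofReal
  simp only [ContinuousMap.coe_mk, e, Complex.ofReal_re] at h2
  refine h2.congr fun N => ?_
  simp [rowAverage, ← Complex.ofReal_sum]

/-- Convergence of row averages extends from continuous functions to bounded functions that are
continuous off a closed null set. -/
theorem tendsto_rowAverage_of_continuousOn_compl {X : Type*} [PseudoMetricSpace X] [CompactSpace X]
    [MeasurableSpace X] [BorelSpace X] {μ : Measure X} [IsFiniteMeasure μ] {z : ℕ → ℕ → X}
    (hz : ∀ Ψ : X → ℝ, Continuous Ψ → Tendsto (rowAverage z Ψ) atTop (𝓝 (∫ x, Ψ x ∂μ)))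
    {K : Set X} (hK : IsClosed K) (hK0 : μ K = 0) {Ψ : X → ℝ} (hΨ : ContinuousOn Ψ Kᶜ)
    {C : ℝ} (hC : ∀ x, |Ψ x| ≤ C) :
    Tendsto (rowAverage z Ψ) atTop (𝓝 (∫ x, Ψ x ∂μ)) := by
  rcases K.eq_empty_or_nonempty with rfl | hne
  · exact hz Ψ (by simpa using hΨ)
  -- cutoffs that vanish on `K` and increase to `1` off `K`
  let χ : ℕ → X → ℝ := fun j x => min 1 (j * Metric.infDist x K)
  have hχc : ∀ j, Continuous (χ j) := fun j =>
    continuous_const.min (continuous_const.mul (Metric.continuous_infDist_pt K))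
  have hχ0 : ∀ j x, 0 ≤ χ j x := fun j x =>
    le_min zero_le_one (mul_nonneg (Nat.cast_nonneg _) Metric.infDist_nonneg)
  have hχ1 : ∀ j x, χ j x ≤ 1 := fun j x => min_le_left _ _
  have hcompact : ∀ g : X → ℝ, Continuous g → Integrable g μ := fun g hg =>
    hg.integrable_of_hasCompactSupport (HasCompactSupport.of_compactSpace g)
  have hΨχ : ∀ j, Continuous fun x => Ψ x * χ j x := by
    intro j
    rw [continuous_iff_continuousAt]
    intro x
    by_cases hx : x ∈ K
    · have hx0 : χ j x = 0 := by simp [χ, Metric.infDist_zero_of_mem hx]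
      have hlim : Tendsto (fun y => C * χ j y) (𝓝 x) (𝓝 0) := by
        have := ((hχc j).const_mul C).tendsto x
        simpa [hx0] using this
      rw [ContinuousAt, hx0, mul_zero]
      refine squeeze_zero_norm (fun y => ?_) hlim
      rw [norm_mul, Real.norm_eq_abs, Real.norm_eq_abs, abs_of_nonneg (hχ0 j y)]
      exact mul_le_mul_of_nonneg_right (hC y) (hχ0 j y)
    · exact ((hΨ x hx).continuousAt (hK.isOpen_compl.mem_nhds hx)).mul (hχc j).continuousAt
  have hmeas : AEStronglyMeasurable Ψ μ := by
    have h1 : AEStronglyMeasurable Ψ (μ.restrict Kᶜ) :=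
      hΨ.aestronglyMeasurable hK.measurableSet.compl
    rwa [Measure.restrict_eq_self_of_ae_mem] at h1
    exact compl_mem_ae_iff.2 hK0
  have hΨint : Integrable Ψ μ :=
    Integrable.of_bound hmeas C (.of_forall fun x => by simpa using hC x)
  have hχint : Tendsto (fun j => ∫ x, (1 - χ j x) ∂μ) atTop (𝓝 0) := by
    have e : (0 : ℝ) = ∫ _ : X, (0 : ℝ) ∂μ := by simp
    rw [e]
    refine tendsto_integral_of_dominated_convergence (fun _ => 1)
      (fun j => ((continuous_const.sub (hχc j)).aestronglyMeasurable)) (integrable_const 1)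
      (fun j => .of_forall fun x => ?_) ?_
    · rw [Real.norm_eq_abs, abs_le]; constructor <;> linarith [hχ0 j x, hχ1 j x]
    · filter_upwards [compl_mem_ae_iff.2 hK0] with x hx
      have hpos : 0 < Metric.infDist x K := (hK.notMem_iff_infDist_pos hne).1 hx
      refine tendsto_const_nhds.congr' ?_
      obtain ⟨j₀, hj₀⟩ := exists_nat_gt (Metric.infDist x K)⁻¹
      filter_upwards [eventually_ge_atTop j₀] with j hj
      have : (1 : ℝ) ≤ j * Metric.infDist x K := by
        rw [← inv_mul_le_iff₀' hpos, mul_one]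
        exact hj₀.le.trans (by exact_mod_cast hj)
      simp [χ, min_eq_left this]
  rw [Metric.tendsto_atTop]
  intro ε hε
  obtain ⟨j, hj⟩ := ((tendsto_order.1 (hχint.const_mul C)).2 (ε / 4)
    (by rw [mul_zero]; positivity)).exists
  have hbound : ∀ x, |(Ψ - fun x => Ψ x * χ j x) x| ≤ C * (1 - χ j x) := fun x => by
    have : Ψ x - Ψ x * χ j x = Ψ x * (1 - χ j x) := by ring
    rw [Pi.sub_apply, this, abs_mul, abs_of_nonneg (a := 1 - χ j x) (by linarith [hχ1 j x])]
    exact mul_le_mul_of_nonneg_right (hC x) (by linarith [hχ1 j x])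
  obtain ⟨N₁, hN₁⟩ := Metric.tendsto_atTop.1 (hz _ (hΨχ j)) (ε / 4) (by positivity)
  obtain ⟨N₂, hN₂⟩ := Metric.tendsto_atTop.1 (hz (fun x => C * (1 - χ j x))
    (continuous_const.mul (continuous_const.sub (hχc j)))) (ε / 4) (by positivity)
  refine ⟨max N₁ N₂, fun N hN => ?_⟩
  have a1 := hN₁ N ((le_max_left _ _).trans hN)
  have a2 := hN₂ N ((le_max_right _ _).trans hN)
  have a3 : |rowAverage z Ψ N - rowAverage z (fun x => Ψ x * χ j x) N| ≤
      rowAverage z (fun x => C * (1 - χ j x)) N := by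
    rw [← rowAverage_sub, rowAverage, smul_eq_mul, abs_mul, abs_of_nonneg (by positivity),
      rowAverage, smul_eq_mul]
    refine mul_le_mul_of_nonneg_left ?_ (by positivity)
    exact (Finset.abs_sum_le_sum_abs _ _).trans (Finset.sum_le_sum fun n _ => hbound _)
  have a4 : |(∫ x, Ψ x ∂μ) - ∫ x, Ψ x * χ j x ∂μ| ≤ ∫ x, C * (1 - χ j x) ∂μ := by
    rw [← integral_sub hΨint (hcompact _ (hΨχ j)), ← Real.norm_eq_abs]
    exact norm_integral_le_of_norm_le (hcompact _
      (continuous_const.mul (continuous_const.sub (hχc j)))) (.of_forall hbound)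
  have a5 : ∫ x, C * (1 - χ j x) ∂μ < ε / 4 := by rw [integral_const_mul]; exact hj
  rw [Real.dist_eq, abs_lt] at *
  rw [abs_le] at a3 a4
  constructor <;> linarith [a1.1, a1.2, a2.1, a2.2, a3.1, a3.2, a4.1, a4.2]

theorem geom_sum_Icc {w : ℂ} (hw : w ≠ 1) (N : ℕ) :
    ∑ n ∈ Finset.Icc 1 N, w ^ n = w * ((w ^ N - 1) / (w - 1)) := by
  rw [← geom_sum_eq hw, Finset.mul_sum, ← Finset.Ico_add_one_right_eq_Icc,
    Finset.sum_Ico_eq_sum_range]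
  simp [pow_add]

/-- The average of the powers `w N ^ n` tends to `0` if `w N` stays away from `1`. -/
theorem tendsto_average_pow {w : ℕ → ℂ} {w₀ : ℂ} (hw : ∀ N, ‖w N‖ = 1)
    (hlim : Tendsto w atTop (𝓝 w₀)) (hw₀ : w₀ ≠ 1) :
    Tendsto (fun N : ℕ => (N : ℝ)⁻¹ • ∑ n ∈ Finset.Icc 1 N, w N ^ n) atTop (𝓝 0) := by
  have h1 : Tendsto (fun N : ℕ => (N : ℝ)⁻¹ * (2 / ‖w N - 1‖)) atTop (𝓝 0) := by
    have := (tendsto_inv_atTop_nhds_zero_nat (𝕜 := ℝ)).mul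
      (tendsto_const_nhds (x := (2 : ℝ)).div (hlim.sub_const 1).norm
        (norm_ne_zero_iff.2 (sub_ne_zero.2 hw₀)))
    simpa using this
  refine squeeze_zero_norm' ?_ h1
  filter_upwards [hlim.eventually_ne hw₀] with N hN
  rw [geom_sum_Icc hN, norm_smul, norm_inv, Real.norm_natCast, norm_mul, hw, one_mul, norm_div]
  refine mul_le_mul_of_nonneg_left ?_ (by positivity)
  gcongr
  calc ‖w N ^ N - 1‖ ≤ ‖w N ^ N‖ + ‖(1 : ℂ)‖ := norm_sub_le _ _
    _ = 2 := by rw [norm_pow, hw]; norm_num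

/-- The rotation vector seen from the lattice with index `i`: its coordinate `j ≠ i` is the ratio
of the two lattice spacings, and coordinate `i` records the position `n / N`. -/
def rotation (b : ℝ) {r : ℕ} (i : Fin r) (N : ℕ) (j : Fin r) : ℝ :=
  if j = i then (N : ℝ)⁻¹ else b ^ (i : ℕ) / b ^ (j : ℕ)

/-- The point with coordinates `n / N` (at place `i`) and `n b ^ (i - j)` (at `j ≠ i`) mod `1`. -/
def torusPoint (b : ℝ) {r : ℕ} (i : Fin r) (N n : ℕ) : UnitAddTorus (Fin r) :=
  fun j => ((n * rotation b i N j : ℝ) : UnitAddCircle)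

theorem mFourier_torusPoint (b : ℝ) {r : ℕ} (i : Fin r) (k : Fin r → ℤ) (N n : ℕ) :
    UnitAddTorus.mFourier k (torusPoint b i N n) =
      Complex.exp (2 * Real.pi * Complex.I * (∑ j, (k j : ℝ) * rotation b i N j : ℝ)) ^ n := by
  have e : UnitAddTorus.mFourier k (torusPoint b i N n) =
    ∏ j, fourier (k j) (((n * rotation b i N j : ℝ) : UnitAddCircle)) := rfl
  rw [e, ← Complex.exp_nat_mul]
  simp_rw [fourier_coe_apply]
  rw [← Complex.exp_sum]
  congr 1
  push_cast
  rw [Finset.mul_sum, Finset.mul_sum]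
  refine Finset.sum_congr rfl fun j _ => ?_
  ring

theorem exp_two_pi_mul_ne_one {x : ℝ} (hx : ∀ a : ℤ, x ≠ a) :
    Complex.exp (2 * Real.pi * Complex.I * (x : ℝ)) ≠ 1 := by
  intro h
  obtain ⟨a, ha⟩ := Complex.exp_eq_one_iff.1 h
  refine hx a ?_
  have h2 : (2 * Real.pi * Complex.I : ℂ) ≠ 0 := Complex.two_pi_I_ne_zero
  rw [mul_comm (a : ℂ)] at ha
  exact_mod_cast mul_left_cancel₀ h2 ha

/-- The Weyl sum of a nontrivial character tends to `0`. The frequency of the resulting geometric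
sum converges to a number that is not an integer, by the linear independence of
`1, b, …, b ^ (r - 1)` over `ℚ`; if only the coordinate `i` is involved, the frequency is `k i / N`
and the sum over a full period vanishes. -/
theorem tendsto_rowAverage_mFourier_torusPoint {b : ℝ} (hb : 0 < b) {r : ℕ}
    (hrel : ∀ l : Fin r → ℤ, ∑ j, (l j : ℝ) * b ^ (j : ℕ) = 0 → l = 0) (i : Fin r)
    {k : Fin r → ℤ} (hk : k ≠ 0) :
    Tendsto (rowAverage (torusPoint b i) (UnitAddTorus.mFourier k)) atTop (𝓝 0) := by
  have hsplit : ∀ N : ℕ, ∑ j, (k j : ℝ) * rotation b i N j =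
      k i * (N : ℝ)⁻¹ + ∑ j ∈ Finset.univ.erase i, (k j : ℝ) * (b ^ (i : ℕ) / b ^ (j : ℕ)) := by
    intro N
    rw [← Finset.add_sum_erase _ _ (Finset.mem_univ i)]
    congr 1
    · simp [rotation]
    · refine Finset.sum_congr rfl fun j hj => ?_
      rw [rotation, if_neg (Finset.ne_of_mem_erase hj)]
  set β : ℝ := ∑ j ∈ Finset.univ.erase i, (k j : ℝ) * (b ^ (i : ℕ) / b ^ (j : ℕ)) with hβ
  by_cases hki : ∀ j, j ≠ i → k j = 0
  · have hβ0 : β = 0 := Finset.sum_eq_zero fun j hj => by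
      simp [hki j (Finset.ne_of_mem_erase hj)]
    have hi : k i ≠ 0 := fun h0 => hk (funext fun j => by
      by_cases hj : j = i
      · rw [hj, h0]; rfl
      · exact hki j hj)
    refine tendsto_const_nhds.congr' ?_
    filter_upwards [eventually_gt_atTop (k i).natAbs] with N hN
    have hN0 : (N : ℝ) ≠ 0 := by
      have : 0 < N := by omega
      exact_mod_cast this.ne'
    simp only [rowAverage, mFourier_torusPoint, hsplit, hβ0, add_zero]
    set w := Complex.exp (2 * Real.pi * Complex.I * ((k i * (N : ℝ)⁻¹ : ℝ) : ℂ)) with hw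
    have hwN : w ^ N = 1 := by
      rw [hw, ← Complex.exp_nat_mul, Complex.exp_eq_one_iff]
      refine ⟨k i, ?_⟩
      have : (N : ℂ) ≠ 0 := by exact_mod_cast hN0
      push_cast
      field_simp
    have hw1 : w ≠ 1 := by
      refine exp_two_pi_mul_ne_one fun a ha => ?_
      have h1 : (k i : ℝ) = a * N := by rw [← ha]; field_simp
      have h2 : k i = a * N := by exact_mod_cast h1
      have h3 : (N : ℤ) ∣ k i := ⟨a, by rw [h2]; ring⟩
      have h4 := Nat.le_of_dvd (Int.natAbs_pos.2 hi) (Int.natAbs_dvd_natAbs.2 h3)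
      rw [Int.natAbs_natCast] at h4
      omega
    rw [geom_sum_Icc hw1, hwN]
    simp
  · push Not at hki
    obtain ⟨j₀, hj₀, hkj₀⟩ := hki
    have hβint : ∀ a : ℤ, β ≠ a := by
      intro a ha
      -- clear denominators: multiply the relation by `b ^ (r - 1 - i)`
      let l : Fin r → ℤ := fun j => if j.rev = i then -a else k j.rev
      have hl : ∑ j, (l j : ℝ) * b ^ (j : ℕ) = 0 := by
        have h1 : ∑ j, (l j : ℝ) * b ^ (j : ℕ) =
            ∑ j : Fin r, ((if j = i then -a else k j : ℤ) : ℝ) * b ^ (j.rev : ℕ) := by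
          rw [← Equiv.sum_comp Fin.revPerm]
          refine Finset.sum_congr rfl fun j _ => ?_
          simp [l]
        rw [h1]
        have hpow : ∀ j : Fin r, b ^ (j.rev : ℕ) = b ^ (r - 1) / b ^ (j : ℕ) := fun j => by
          rw [eq_div_iff (pow_pos hb _).ne', ← pow_add]
          congr 1
          rw [Fin.val_rev]; omega
        rw [← Finset.add_sum_erase _ _ (Finset.mem_univ i)]
        have h2 : ∑ j ∈ Finset.univ.erase i,
            ((if j = i then -a else k j : ℤ) : ℝ) * b ^ (j.rev : ℕ) =
            b ^ (r - 1) / b ^ (i : ℕ) * β := by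
          rw [hβ, Finset.mul_sum]
          refine Finset.sum_congr rfl fun j hj => ?_
          rw [if_neg (Finset.ne_of_mem_erase hj), hpow]
          have := (pow_pos hb (i : ℕ)).ne'
          field_simp
        rw [h2, ha, hpow]
        simp
        ring
      have h0 := congrFun (hrel l hl) j₀.rev
      simp only [l, Fin.rev_rev, if_neg hj₀, Pi.zero_apply] at h0
      exact hkj₀ h0
    have hlim : Tendsto (fun N : ℕ => Complex.exp (2 * Real.pi * Complex.I *
        ((∑ j, (k j : ℝ) * rotation b i N j : ℝ) : ℂ))) atTop
        (𝓝 (Complex.exp (2 * Real.pi * Complex.I * (β : ℝ)))) := by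
      have h1 : Tendsto (fun N : ℕ => ∑ j, (k j : ℝ) * rotation b i N j) atTop (𝓝 β) := by
        simp_rw [hsplit]
        have := ((tendsto_inv_atTop_nhds_zero_nat (𝕜 := ℝ)).const_mul (k i : ℝ)).add_const β
        simpa using this
      have hc : Continuous fun x : ℝ => Complex.exp (2 * Real.pi * Complex.I * (x : ℂ)) := by
        fun_prop
      exact (hc.tendsto β).comp h1
    refine (tendsto_average_pow (fun N => ?_) hlim (exp_two_pi_mul_ne_one hβint)).congr
      fun N => ?_
    · have : (2 * Real.pi * Complex.I * ((∑ j, (k j : ℝ) * rotation b i N j : ℝ) : ℂ)) =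
        ((2 * Real.pi * ∑ j, (k j : ℝ) * rotation b i N j : ℝ) : ℂ) * Complex.I := by
        push_cast; ring
      rw [this, Complex.norm_exp_ofReal_mul_I]
    · simp only [rowAverage, mFourier_torusPoint]

/-- Coordinates in `[0, 1)` of a point of the torus. -/
def torusFract {r : ℕ} (z : UnitAddTorus (Fin r)) (j : Fin r) : ℝ := AddCircle.equivIco 1 0 (z j)

/-- Lebesgue measure on the cube `[0, 1) ^ r`. -/
def cubeMeasure (r : ℕ) : Measure (Fin r → ℝ) := Measure.pi fun _ => volume.restrict (Ico 0 1)

instance : IsProbabilityMeasure (volume.restrict (Ico (0 : ℝ) 1)) := ⟨by simp⟩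

instance (r : ℕ) : IsProbabilityMeasure (cubeMeasure r) := by
  unfold cubeMeasure; infer_instance

theorem coe_equivIco_coe (x : ℝ) :
    (AddCircle.equivIco (1 : ℝ) 0 (x : UnitAddCircle) : ℝ) = Int.fract x := by
  simp [AddCircle.coe_equivIco_mk_apply (1 : ℝ) x]

theorem measurable_equivIco : Measurable fun x : UnitAddCircle =>
    (AddCircle.equivIco (1 : ℝ) 0 x : ℝ) :=
  measurable_subtype_coe.comp (AddCircle.measurableEquivIco 1 0).measurable

theorem measurePreserving_coe_equivIco :
    MeasurePreserving (fun x : UnitAddCircle => (AddCircle.equivIco (1 : ℝ) 0 x : ℝ)) volume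
      (volume.restrict (Ico 0 1)) := by
  refine ⟨measurable_equivIco, ?_⟩
  have h1 : Ioc (0 : ℝ) (0 + 1) = Ioc 0 1 := by rw [zero_add]
  rw [← (AddCircle.measurePreserving_mk 1 0).map_eq,
    Measure.map_map measurable_equivIco AddCircle.measurable_mk', h1,
    ← Measure.restrict_congr_set (Ico_ae_eq_Ioc (a := (0 : ℝ)) (b := 1))]
  conv_rhs => rw [← Measure.map_id (μ := volume.restrict (Ico (0 : ℝ) 1))]
  refine Measure.map_congr ?_
  filter_upwards [ae_restrict_mem measurableSet_Ico] with x hx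
  simp only [Function.comp_apply, id]
  rw [coe_equivIco_coe, Int.fract_eq_self.2 ⟨hx.1, hx.2⟩]

theorem measurePreserving_torusFract (r : ℕ) :
    MeasurePreserving (torusFract (r := r)) volume (cubeMeasure r) :=
  measurePreserving_pi (fun _ => volume) _ fun _ => measurePreserving_coe_equivIco

/-- Equidistribution of the points `(n · rotation b i N) mod 1` in the cube, for bounded functions
that are continuous at every interior point whose `i`-th coordinate avoids a finite set. -/
theorem tendsto_average_cube {b : ℝ} (hb : 0 < b) {r : ℕ}
    (hrel : ∀ l : Fin r → ℤ, ∑ j, (l j : ℝ) * b ^ (j : ℕ) = 0 → l = 0) (i : Fin r)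
    (S : Finset ℝ) {Φ : (Fin r → ℝ) → ℝ}
    (hΦ : ∀ t : Fin r → ℝ, (∀ j, t j ∈ Ioo (0 : ℝ) 1) → t i ∉ S → ContinuousAt Φ t)
    (hmeas : Measurable Φ) {C : ℝ} (hC : ∀ t, |Φ t| ≤ C) :
    Tendsto (fun N : ℕ => (N : ℝ)⁻¹ * ∑ n ∈ Finset.Icc 1 N,
      Φ (fun j => Int.fract (n * rotation b i N j))) atTop (𝓝 (∫ t, Φ t ∂cubeMeasure r)) := by
  let K : Set (UnitAddTorus (Fin r)) := (⋃ j, (fun z => z j) ⁻¹' {0}) ∪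
    ⋃ s ∈ S, (fun z => z i) ⁻¹' {(s : UnitAddCircle)}
  have hnull : ∀ (j : Fin r) (c : UnitAddCircle),
      (volume : Measure (UnitAddTorus (Fin r))) ((fun z => z j) ⁻¹' {c}) = 0 := fun j c =>
    (measurePreserving_eval (fun _ : Fin r => (volume : Measure UnitAddCircle))
      j).quasiMeasurePreserving.preimage_null (measure_singleton c)
  have hKc : IsClosed K := by
    refine IsClosed.union (isClosed_iUnion_of_finite fun j => ?_)
      (isClosed_biUnion_finset fun s _ => ?_)
    · exact isClosed_singleton.preimage (continuous_apply j)
    · exact isClosed_singleton.preimage (continuous_apply i)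
  have hK0 : (volume : Measure (UnitAddTorus (Fin r))) K = 0 :=
    measure_union_null (measure_iUnion_null fun j => hnull j 0)
      ((measure_biUnion_null_iff S.countable_toSet).2 fun s _ => hnull i _)
  have hcont : ContinuousOn (fun z => Φ (torusFract z)) Kᶜ := by
    intro z hz
    have hz0 : ∀ j, z j ≠ 0 := fun j h => hz (Or.inl (mem_iUnion.2 ⟨j, h⟩))
    refine ContinuousAt.continuousWithinAt ?_
    refine ContinuousAt.comp (f := torusFract) (hΦ _ (fun j => ?_) fun hs => ?_) ?_
    · have h := (AddCircle.equivIco (1 : ℝ) 0 (z j)).2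
      refine ⟨lt_of_le_of_ne h.1 fun h0 => hz0 j ?_, h.2.trans_eq (zero_add 1)⟩
      have h1 := (AddCircle.equivIco (1 : ℝ) 0).symm_apply_apply (z j)
      rw [← h1]
      have h2 : (((AddCircle.equivIco (1 : ℝ) 0 (z j)) : ℝ) : UnitAddCircle) = 0 :=
        (congrArg (fun x : ℝ => (x : UnitAddCircle)) h0).symm.trans (by simp)
      exact h2
    · refine hz (Or.inr (mem_iUnion₂.2 ⟨_, hs, ?_⟩))
      exact ((AddCircle.equivIco (1 : ℝ) 0).symm_apply_apply (z i)).symm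
    · refine continuousAt_pi.2 fun j => ?_
      have h1 := AddCircle.continuousAt_equivIco (1 : ℝ) 0 (x := z j) (by simpa using hz0 j)
      exact ContinuousAt.comp (f := fun z : UnitAddTorus (Fin r) => z j)
        (continuous_subtype_val.continuousAt.comp h1) (continuous_apply j).continuousAt
  have h := tendsto_rowAverage_of_continuousOn_compl (z := torusPoint b i)
    (fun Ψ hΨ => tendsto_rowAverage_real_of_mFourier _
      (fun k hk => tendsto_rowAverage_mFourier_torusPoint hb hrel i hk) hΨ) hKc hK0 hcont
    (fun z => hC _)
  have hint : ∫ z : UnitAddTorus (Fin r), Φ (torusFract z) = ∫ t, Φ t ∂cubeMeasure r := by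
    rw [← (measurePreserving_torusFract r).map_eq,
      integral_map (measurePreserving_torusFract r).measurable.aemeasurable
        hmeas.aestronglyMeasurable]
  rw [hint] at h
  refine h.congr fun N => ?_
  rw [rowAverage, smul_eq_mul]
  congr 1
  refine Finset.sum_congr rfl fun n _ => ?_
  congr 1
  funext j
  exact coe_equivIco_coe _

/-! ### The limiting gap of a superposition of lattices -/

/-- If a point of `b ^ (i + 1) ℤ` has position `t j` modulo the lattice `b ^ (j + 1) ℤ` (in units
of its spacing) for each `j ≠ i`, this is the distance to the next point of the union of the
lattices; `t i` is ignored. -/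
def gapFun (b : ℝ) {r : ℕ} (i : Fin r) (t : Fin r → ℝ) : ℝ :=
  Finset.univ.inf' (Finset.univ_nonempty_iff.2 ⟨i⟩)
    fun j => b ^ ((j : ℕ) + 1) * (1 - if j = i then 0 else t j)

theorem continuous_gapFun (b : ℝ) {r : ℕ} (i : Fin r) : Continuous (gapFun b i) := by
  unfold gapFun
  refine Continuous.finset_inf'_apply _ fun j _ => ?_
  split_ifs <;> fun_prop

theorem lt_gapFun_iff {b : ℝ} {r : ℕ} {i : Fin r} {t : Fin r → ℝ} {a : ℝ} :
    a < gapFun b i t ↔ ∀ j : Fin r, a < b ^ ((j : ℕ) + 1) * (1 - if j = i then 0 else t j) := by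
  rw [gapFun, Finset.lt_inf'_iff]
  simp

theorem gapFun_pos {b : ℝ} (hb : 0 < b) {r : ℕ} {i : Fin r} {t : Fin r → ℝ} (ht : ∀ j, t j < 1) :
    0 < gapFun b i t := by
  rw [lt_gapFun_iff]
  intro j
  have := ht j
  refine mul_pos (pow_pos hb _) ?_
  split_ifs <;> linarith

theorem gapFun_le {b : ℝ} (hb : 0 < b) {r : ℕ} (i : Fin r) {t : Fin r → ℝ} (ht : ∀ j, 0 ≤ t j) :
    gapFun b i t ≤ b := by
  have hr : 0 < r := i.pos
  refine (Finset.inf'_le _ (Finset.mem_univ ⟨0, hr⟩)).trans ?_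
  have := ht ⟨0, hr⟩
  simp only [zero_add, pow_one]
  split_ifs <;> nlinarith

theorem ae_mem_cube (r : ℕ) : ∀ᵐ t ∂cubeMeasure r, ∀ j, t j ∈ Ico (0 : ℝ) 1 := by
  rw [ae_all_iff]
  intro j
  have h := (measurePreserving_eval (fun _ : Fin r => volume.restrict (Ico (0 : ℝ) 1))
    j).quasiMeasurePreserving.ae (ae_restrict_mem measurableSet_Ico)
  exact h

/-- The law of the gap following a point of the lattice with index `i`. -/
def latticeGapLaw (b : ℝ) {r : ℕ} (i : Fin r) : Measure ℝ := (cubeMeasure r).map (gapFun b i)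

instance (b : ℝ) {r : ℕ} (i : Fin r) : IsProbabilityMeasure (latticeGapLaw b i) :=
  Measure.isProbabilityMeasure_map (continuous_gapFun b i).aemeasurable

theorem volume_restrict_Ico_Iio {c : ℝ} (hc : c ≤ 1) :
    volume.restrict (Ico (0 : ℝ) 1) (Iio c) = ENNReal.ofReal c := by
  rw [Measure.restrict_apply measurableSet_Iio, inter_comm, Ico_inter_Iio, min_eq_right hc,
    Real.volume_Ico, sub_zero]

/-- If `a < b ^ (i + 1)`, the gap exceeds `a` exactly when every coordinate `j ≠ i` stays below
`1 - a / b ^ (j + 1)`, so the set is a box; otherwise it is empty. -/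
theorem cubeMeasure_inter_gapFun {b : ℝ} (hb : 0 < b) {r : ℕ} (i : Fin r) (A : Set ℝ) {a : ℝ}
    (ha : 0 ≤ a) :
    cubeMeasure r {t | t i ∈ A ∧ a < gapFun b i t} = volume.restrict (Ico (0 : ℝ) 1) A *
      if a < b ^ ((i : ℕ) + 1) then
        ∏ j ∈ Finset.univ.erase i, ENNReal.ofReal (1 - a / b ^ ((j : ℕ) + 1)) else 0 := by
  split_ifs with hai
  · have hset : {t : Fin r → ℝ | t i ∈ A ∧ a < gapFun b i t} = Set.pi univ
        (fun j => if j = i then A else Iio (1 - a / b ^ ((j : ℕ) + 1))) := by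
      ext t
      simp only [mem_ofPred_eq, lt_gapFun_iff, mem_univ_pi]
      have key : ∀ j : Fin r,
          a < b ^ ((j : ℕ) + 1) * (1 - t j) ↔ t j < 1 - a / b ^ ((j : ℕ) + 1) := by
        intro j
        rw [lt_sub_comm, div_lt_iff₀' (pow_pos hb _)]
      constructor
      · rintro ⟨h1, h2⟩ j
        by_cases hj : j = i
        · subst hj; simpa using h1
        · have := h2 j
          rw [if_neg hj, key] at this
          simpa [hj] using this
      · intro h
        refine ⟨by simpa using h i, fun j => ?_⟩
        by_cases hj : j = i
        · subst hj; simpa using hai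
        · rw [if_neg hj, key]
          simpa [hj] using h j
    rw [hset, cubeMeasure, Measure.pi_pi, ← Finset.mul_prod_erase _ _ (Finset.mem_univ i),
      if_pos rfl]
    congr 1
    refine Finset.prod_congr rfl fun j hj => ?_
    rw [if_neg (Finset.ne_of_mem_erase hj), volume_restrict_Ico_Iio]
    have : 0 ≤ a / b ^ ((j : ℕ) + 1) := by positivity
    linarith
  · rw [mul_zero, ← measure_empty (μ := cubeMeasure r)]
    congr 1
    refine eq_empty_of_forall_notMem fun t ht => hai ?_
    simpa using lt_gapFun_iff.1 ht.2 i

theorem latticeGapLaw_Ioi {b : ℝ} (hb : 0 < b) {r : ℕ} (i : Fin r) {a : ℝ} (ha : 0 ≤ a) :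
    latticeGapLaw b i (Ioi a) = if a < b ^ ((i : ℕ) + 1) then
        ∏ j ∈ Finset.univ.erase i, ENNReal.ofReal (1 - a / b ^ ((j : ℕ) + 1)) else 0 := by
  rw [latticeGapLaw, Measure.map_apply (continuous_gapFun b i).measurable measurableSet_Ioi]
  have := cubeMeasure_inter_gapFun hb i univ ha
  rw [measure_univ, one_mul] at this
  rw [← this]
  congr 1
  ext t
  simp

theorem latticeGapLaw_Iic_zero {b : ℝ} (hb : 0 < b) {r : ℕ} (i : Fin r) :
    latticeGapLaw b i (Iic 0) = 0 := by
  rw [latticeGapLaw, Measure.map_apply (continuous_gapFun b i).measurable measurableSet_Iic]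
  have h : ∀ᵐ t ∂cubeMeasure r, ¬ gapFun b i t ≤ 0 := by
    filter_upwards [ae_mem_cube r] with t ht
    exact not_le.2 (gapFun_pos hb fun j => (ht j).2)
  simpa [preimage, Iic] using ae_iff.1 h

/-- Finite measures on `(0, ∞)` are determined by their tails. -/
theorem ext_of_Ioi_of_pos {μ ν : Measure ℝ} [IsFiniteMeasure μ] (hμ : μ (Iic 0) = 0)
    (hν : ν (Iic 0) = 0) (h : ∀ a, 0 < a → μ (Ioi a) = ν (Ioi a)) : μ = ν := by
  have hU : (Ioi (0 : ℝ)) = ⋃ n : ℕ, Ioi (1 / ((n : ℝ) + 1)) := by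
    ext x
    simp only [mem_Ioi, mem_iUnion]
    exact ⟨fun hx => exists_nat_one_div_lt hx,
      fun ⟨n, hn⟩ => lt_trans (by positivity) hn⟩
  have hmono : Monotone fun n : ℕ => Ioi (1 / ((n : ℝ) + 1)) := fun m n hmn =>
    Ioi_subset_Ioi (one_div_le_one_div_of_le (by positivity) (by gcongr))
  have h0 : μ (Ioi 0) = ν (Ioi 0) := by
    rw [hU, hmono.measure_iUnion, hmono.measure_iUnion]
    exact iSup_congr fun n => h _ (by positivity)
  have hall : ∀ a, μ (Ioi a) = ν (Ioi a) := by
    intro a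
    rcases lt_or_ge 0 a with ha | ha
    · exact h a ha
    · have key : ∀ κ : Measure ℝ, κ (Iic 0) = 0 → κ (Ioi a) = κ (Ioi 0) := fun κ hκ => by
        refine le_antisymm ?_ (measure_mono (Ioi_subset_Ioi ha))
        calc κ (Ioi a) ≤ κ (Iic 0 ∪ Ioi 0) := measure_mono fun x _ => by simp
          _ ≤ κ (Iic 0) + κ (Ioi 0) := measure_union_le _ _
          _ = κ (Ioi 0) := by rw [hκ, zero_add]
      rw [key μ hμ, key ν hν, h0]
  have huniv : μ univ = ν univ := by
    rw [← Iic_union_Ioi (a := (0 : ℝ)), measure_union (Iic_disjoint_Ioi le_rfl) measurableSet_Ioi,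
      measure_union (Iic_disjoint_Ioi le_rfl) measurableSet_Ioi, hμ, hν, h0]
  have : IsFiniteMeasure ν := ⟨by rw [← huniv]; exact measure_lt_top μ univ⟩
  refine Measure.ext_of_Iic μ ν fun a => ?_
  rw [← compl_Ioi, measure_compl measurableSet_Ioi (measure_ne_top _ _),
    measure_compl measurableSet_Ioi (measure_ne_top _ _), huniv, hall]

/-- The position and the gap become independent in the limit. -/
theorem map_position_gapFun {b : ℝ} (hb : 0 < b) {r : ℕ} (i : Fin r) :
    (cubeMeasure r).map (fun t => (t i, gapFun b i t)) =
      (volume.restrict (Ico (0 : ℝ) 1)).prod (latticeGapLaw b i) := by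
  have hm : Measurable fun t : Fin r → ℝ => (t i, gapFun b i t) :=
    (measurable_pi_apply i).prodMk (continuous_gapFun b i).measurable
  have := Measure.isProbabilityMeasure_map (μ := cubeMeasure r) hm.aemeasurable
  symm
  refine Measure.prod_eq fun A B hA hB => ?_
  rw [Measure.map_apply hm (hA.prod hB)]
  -- for fixed `A` both sides are finite measures in `B`, so it suffices to take `B` a half line
  let κ : Measure ℝ := ((cubeMeasure r).restrict {t | t i ∈ A}).map (gapFun b i)
  have hκ : ∀ B : Set ℝ, MeasurableSet B →
      κ B = cubeMeasure r {t | t i ∈ A ∧ gapFun b i t ∈ B} := fun B hB => by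
    rw [Measure.map_apply (continuous_gapFun b i).measurable hB,
      Measure.restrict_apply ((continuous_gapFun b i).measurable hB)]
    congr 1
    ext t
    simp [and_comm]
  have hκeq : κ = (volume.restrict (Ico (0 : ℝ) 1) A) • latticeGapLaw b i := by
    refine ext_of_Ioi_of_pos ?_ ?_ fun a ha => ?_
    · refine le_antisymm ?_ zero_le
      rw [hκ _ measurableSet_Iic, ← latticeGapLaw_Iic_zero hb i, latticeGapLaw,
        Measure.map_apply (continuous_gapFun b i).measurable measurableSet_Iic]
      exact measure_mono fun t ht => ht.2
    · simp [latticeGapLaw_Iic_zero hb i]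
    · rw [hκ _ measurableSet_Ioi, Measure.smul_apply, latticeGapLaw_Ioi hb i ha.le, smul_eq_mul,
        ← cubeMeasure_inter_gapFun hb i A ha.le]
      rfl
  have h := hκ B hB
  rw [hκeq, Measure.smul_apply, smul_eq_mul] at h
  rw [h]
  rfl

theorem lintegral_ofReal_deriv {g g' : ℝ → ℝ} {u v : ℝ} (huv : u ≤ v)
    (hd : ∀ x ∈ Icc u v, HasDerivAt g (g' x) x) (hc : ContinuousOn g' (Icc u v))
    (h0 : ∀ x ∈ Ioo u v, 0 ≤ g' x) :
    ∫⁻ x in Ioo u v, ENNReal.ofReal (g' x) = ENNReal.ofReal (g v - g u) := by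
  have hint : IntegrableOn g' (Ioo u v) := (hc.integrableOn_Icc).mono_set Ioo_subset_Icc_self
  rw [← ofReal_integral_eq_lintegral_ofReal hint
    ((ae_restrict_iff' measurableSet_Ioo).2 (.of_forall h0)), ← integral_Ioc_eq_integral_Ioo,
    ← intervalIntegral.integral_of_le huv, intervalIntegral.integral_eq_sub_of_hasDerivAt
      (fun x hx => hd x (by rwa [uIcc_of_le huv] at hx))
      ((hc.mono (by rw [uIcc_of_le huv])).intervalIntegrable)]

/-! ### The tails of `R` and of the gap law -/

theorem contDiff_qPoch (q : ℝ) (r : ℕ) : ContDiff ℝ ⊤ fun t => qPoch t q r := by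
  unfold qPoch
  exact contDiff_prod fun i _ => by fun_prop

theorem hasDerivAt_qPoch (q : ℝ) (r : ℕ) (t : ℝ) : HasDerivAt (fun t => qPoch t q r)
    (∑ i : Fin r, (∏ j ∈ Finset.univ.erase i, (1 - t * q ^ (j : ℕ))) * -(q ^ (i : ℕ))) t := by
  have e : (fun t => qPoch t q r) = fun t => ∏ i : Fin r, (1 - t * q ^ (i : ℕ)) := by
    funext t; rw [qPoch, Finset.prod_range]
  rw [e]
  have h := HasDerivAt.fun_finsetProd (u := Finset.univ)
    (f := fun (i : Fin r) (t : ℝ) => 1 - t * q ^ (i : ℕ)) (f' := fun i => -(q ^ (i : ℕ))) (x := t)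
    (fun i _ => by simpa using ((hasDerivAt_id t).mul_const (q ^ (i : ℕ))).const_sub 1)
  simpa using h

theorem hasDerivAt_deriv_qPoch (q : ℝ) (r : ℕ) (t : ℝ) : HasDerivAt (deriv fun t => qPoch t q r)
    (iteratedDeriv 2 (fun t => qPoch t q r) t) t := by
  have h : ContDiff ℝ 1 (deriv fun t => qPoch t q r) :=
    ((contDiff_succ_iff_deriv (n := 1)).1 ((contDiff_qPoch q r).of_le le_top)).2.2
  rw [iteratedDeriv_succ, iteratedDeriv_one]
  exact (h.differentiable one_ne_zero t).hasDerivAt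

theorem continuous_iteratedDeriv_two_qPoch (q : ℝ) (r : ℕ) :
    Continuous (iteratedDeriv 2 fun t => qPoch t q r) :=
  (contDiff_qPoch q r).continuous_iteratedDeriv 2 le_top

theorem continuous_deriv_qPoch (q : ℝ) (r : ℕ) : Continuous (deriv fun t => qPoch t q r) :=
  (contDiff_qPoch q r).continuous_deriv le_top

theorem qPoch_one {r : ℕ} (hr : 0 < r) (q : ℝ) : qPoch 1 q r = 0 :=
  Finset.prod_eq_zero (Finset.mem_range.2 hr) (by simp)

theorem deriv_qPoch_one {r : ℕ} (hr : 0 < r) (q : ℝ) :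
    deriv (fun t => qPoch t q r) 1 = -qPoch q q (r - 1) := by
  obtain ⟨n, rfl⟩ := Nat.exists_eq_add_of_lt hr
  have e : (fun t => qPoch t q (0 + n + 1)) = fun t => (1 - t) * qPoch (t * q) q n := by
    funext t
    simp only [qPoch, zero_add]
    rw [Finset.prod_range_succ', mul_comm]
    simp [pow_succ', mul_assoc]
  have h1 : HasDerivAt (fun t : ℝ => 1 - t) (-1) 1 := by
    simpa using (hasDerivAt_id (1 : ℝ)).const_sub 1
  have h2 : DifferentiableAt ℝ (fun t => qPoch (t * q) q n) 1 := by
    have := (contDiff_qPoch q n).differentiable (by simp)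
    fun_prop
  rw [e, (h1.fun_mul h2.hasDerivAt).deriv]
  simp

theorem deriv_qPoch_nonpos {b : ℝ} (hb : 1 < b) (r : ℕ) {a : ℝ} (ha : a ∈ Icc (0 : ℝ) 1) :
    deriv (fun t => qPoch t b⁻¹ r) a ≤ 0 := by
  obtain ⟨p1, p2, h1, h2, hs⟩ :=
    qPoch_signs (q := b⁻¹) (by positivity) (inv_le_one_of_one_le₀ hb.le) r
  rw [(h1 a).deriv]
  exact (hs a ha).2.1

/-- The tail of `R` on `[0, 1)` is minus the derivative of the `q`-Pochhammer symbol: the point mass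
at `1` accounts for the value of that derivative at `1`. -/
theorem R_Ioi {b : ℝ} (hb : 1 < b) {r : ℕ} (hr : 0 < r) {t : ℝ} (ht : 0 ≤ t) :
    R b r (Ioi t) =
      if t < 1 then ENNReal.ofReal (-deriv (fun t => qPoch t b⁻¹ r) t) else 0 := by
  have hpos : 0 ≤ qPoch b⁻¹ b⁻¹ (r - 1) := by
    have h := deriv_qPoch_nonpos hb r (a := 1) (by simp)
    rw [deriv_qPoch_one hr] at h
    linarith
  rw [R, Measure.add_apply, Measure.smul_apply, withDensity_apply _ measurableSet_Ioi,
    Measure.restrict_restrict measurableSet_Ioi, Measure.dirac_apply' _ measurableSet_Ioi]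
  split_ifs with h1
  · have hset : Ioi t ∩ Ioo 0 1 = Ioo t 1 := by
      ext x; simp only [mem_inter_iff, mem_Ioi, mem_Ioo]
      exact ⟨fun h => ⟨h.1, h.2.2⟩, fun h => ⟨h.1, ht.trans_lt h.1, h.2⟩⟩
    rw [hset, lintegral_ofReal_deriv h1.le (fun x _ => hasDerivAt_deriv_qPoch b⁻¹ r x)
      (continuous_iteratedDeriv_two_qPoch b⁻¹ r).continuousOn
      (fun x hx => qPoch_deriv2_nonneg hb r ⟨ht.trans hx.1.le, hx.2.le⟩)]
    rw [indicator_of_mem (by exact h1), Pi.one_apply, smul_eq_mul, mul_one, deriv_qPoch_one hr]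
    have hmono : deriv (fun t => qPoch t b⁻¹ r) t ≤ deriv (fun t => qPoch t b⁻¹ r) 1 := by
      refine monotoneOn_of_deriv_nonneg (convex_Icc (0 : ℝ) 1)
        (continuous_deriv_qPoch b⁻¹ r).continuousOn
        (fun x _ => (hasDerivAt_deriv_qPoch b⁻¹ r x).differentiableAt.differentiableWithinAt)
        (fun x hx => ?_) ⟨ht, h1.le⟩ (by simp) h1.le
      rw [(hasDerivAt_deriv_qPoch b⁻¹ r x).deriv]
      exact qPoch_deriv2_nonneg hb r (interior_subset hx)
    rw [deriv_qPoch_one hr] at hmono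
    rw [← ENNReal.ofReal_add hpos (by linarith)]
    congr 1
    ring
  · have hset : Ioi t ∩ Ioo 0 1 = ∅ := by
      refine eq_empty_of_forall_notMem fun x hx => h1 ?_
      exact (show t < x from hx.1).trans hx.2.2
    rw [hset, indicator_of_notMem (by simpa using h1)]
    simp

theorem R_Iic_zero (b : ℝ) (r : ℕ) : R b r (Iic 0) = 0 := by
  have hset : Iic (0 : ℝ) ∩ Ioo 0 1 = ∅ := by
    refine eq_empty_of_forall_notMem fun x hx => ?_
    exact absurd hx.2.1 (not_lt.2 hx.1)
  rw [R, Measure.add_apply, Measure.smul_apply, withDensity_apply _ measurableSet_Iic,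
    Measure.restrict_restrict measurableSet_Iic, Measure.dirac_apply' _ measurableSet_Iic, hset]
  simp

theorem R_univ {b : ℝ} (hb : 1 < b) {r : ℕ} (hr : 0 < r) :
    R b r univ = ENNReal.ofReal (-deriv (fun t => qPoch t b⁻¹ r) 0) := by
  rw [← Iic_union_Ioi (a := (0 : ℝ)), measure_union (Iic_disjoint_Ioi le_rfl) measurableSet_Ioi,
    R_Iic_zero, R_Ioi hb hr le_rfl, zero_add, if_pos one_pos]

theorem isFiniteMeasure_R {b : ℝ} (hb : 1 < b) {r : ℕ} (hr : 0 < r) : IsFiniteMeasure (R b r) :=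
  ⟨by rw [R_univ hb hr]; exact ENNReal.ofReal_lt_top⟩

theorem ae_mem_R {b : ℝ} (hb : 1 < b) {r : ℕ} (hr : 0 < r) : ∀ᵐ t ∂(R b r), t ∈ Icc (0 : ℝ) 1 := by
  have h1 : ∀ᵐ t ∂(R b r), t ∉ Iic (0 : ℝ) := measure_eq_zero_iff_ae_notMem.1 (R_Iic_zero b r)
  have h2 : ∀ᵐ t ∂(R b r), t ∉ Ioi (1 : ℝ) := measure_eq_zero_iff_ae_notMem.1
    (by rw [R_Ioi hb hr zero_le_one, if_neg (lt_irrefl _)])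
  filter_upwards [h1, h2] with t ht1 ht2
  exact ⟨(not_le.1 ht1).le, not_lt.1 ht2⟩

/-- The mixture of the gap laws of the `r` lattices, weighted by their densities, is `R` up to
scaling: differentiating the product `(a / b; b⁻¹)_r` omits one lattice at a time. -/
theorem sum_latticeGapLaw {b : ℝ} (hb : 1 < b) {r : ℕ} (hr : 0 < r) :
    ∑ i : Fin r, ENNReal.ofReal (b ^ ((i : ℕ) + 1))⁻¹ • latticeGapLaw b i =
      ENNReal.ofReal b⁻¹ • (R b r).map (fun t => b * t) := by
  have hb0 : 0 < b := by linarith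
  have hm : Measurable fun t : ℝ => b * t := measurable_const_mul b
  have := isFiniteMeasure_R hb hr
  symm
  have hfin : IsFiniteMeasure (ENNReal.ofReal b⁻¹ • (R b r).map (fun t => b * t)) :=
    Measure.smul_finite _ ENNReal.ofReal_ne_top
  refine ext_of_Ioi_of_pos ?_ ?_ fun a ha => ?_
  · rw [Measure.smul_apply, Measure.map_apply hm measurableSet_Iic]
    have : (fun t : ℝ => b * t) ⁻¹' Iic 0 = Iic 0 := by
      ext t; simp [hb0]
    rw [this, R_Iic_zero, smul_zero]
  · simp [Measure.finsetSum_apply, latticeGapLaw_Iic_zero hb0]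
  · rw [Measure.smul_apply, Measure.map_apply hm measurableSet_Ioi, Measure.finsetSum_apply]
    have : (fun t : ℝ => b * t) ⁻¹' Ioi a = Ioi (a / b) := by
      ext t; simp [div_lt_iff₀' hb0]
    rw [this, R_Ioi hb hr (by positivity)]
    simp only [Measure.smul_apply, latticeGapLaw_Ioi hb0 _ ha.le, smul_eq_mul]
    have hpow : ∀ j : ℕ, b ≤ b ^ (j + 1) := fun j => le_self_pow₀ hb.le (by omega)
    have hdiv : ∀ j : ℕ, a / b * b⁻¹ ^ j = a / b ^ (j + 1) := fun j => by
      rw [inv_pow, pow_succ]; field_simp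
    split_ifs with h1
    · have hab : a < b := (div_lt_one hb0).1 h1
      have hnn : ∀ j : ℕ, 0 ≤ 1 - a / b ^ (j + 1) := fun j => by
        rw [sub_nonneg, div_le_one (by positivity)]
        exact hab.le.trans (hpow j)
      rw [← ENNReal.ofReal_mul (by positivity), (hasDerivAt_qPoch b⁻¹ r (a / b)).deriv,
        ← Finset.sum_neg_distrib, Finset.mul_sum, ENNReal.ofReal_sum_of_nonneg]
      · refine Finset.sum_congr rfl fun i _ => ?_
        rw [if_pos (hab.trans_le (hpow i)), ← ENNReal.ofReal_prod_of_nonneg fun j _ => hnn _,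
          ← ENNReal.ofReal_mul (by positivity)]
        congr 1
        simp_rw [hdiv, inv_pow]
        rw [pow_succ, mul_inv]
        ring
      · intro i _
        simp_rw [hdiv]
        have : 0 ≤ ∏ j ∈ Finset.univ.erase i, (1 - a / b ^ ((j : ℕ) + 1)) :=
          Finset.prod_nonneg fun j _ => hnn j
        simp only [mul_neg, neg_neg]
        positivity
    · have hab : b ≤ a := by
        rw [div_lt_one hb0, not_lt] at h1; exact h1
      rw [mul_zero]
      symm
      refine Finset.sum_eq_zero fun i _ => ?_
      split_ifs with h2
      · have hi : (⟨0, hr⟩ : Fin r) ≠ i := by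
          rintro rfl
          simp only [zero_add, pow_one] at h2
          linarith
        rw [Finset.prod_eq_zero (Finset.mem_erase.2 ⟨hi, Finset.mem_univ _⟩), mul_zero]
        rw [ENNReal.ofReal_eq_zero]
        simp only [zero_add, pow_one, sub_nonpos]
        rwa [one_le_div hb0]
      · rw [mul_zero]

theorem hasDerivAt_F_term {b : ℝ} (r : ℕ) {k s : ℝ} (hs : s ≠ 0) :
    HasDerivAt (fun s => qPoch (s * k) b⁻¹ r / s) ((s ^ 2)⁻¹ * F b r (s * k)) s := by
  have h1 : HasDerivAt (fun t => qPoch t b⁻¹ r) (deriv (fun t => qPoch t b⁻¹ r) (s * k)) (s * k) :=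
    ((contDiff_qPoch b⁻¹ r).differentiable (by simp) _).hasDerivAt
  have h2 : HasDerivAt (fun s : ℝ => s * k) k s := by simpa using (hasDerivAt_id s).mul_const k
  have h3 : HasDerivAt (fun s => qPoch (s * k) b⁻¹ r)
      (deriv (fun t => qPoch t b⁻¹ r) (s * k) * k) s := by
    simpa [Function.comp_def] using HasDerivAt.comp s h1 h2
  refine (h3.fun_div (hasDerivAt_id' s) hs).congr_deriv ?_
  simp only [F]
  field_simp

theorem continuous_F (b : ℝ) (r : ℕ) : Continuous (F b r) := by
  unfold F
  exact (continuous_id.mul (continuous_deriv_qPoch b⁻¹ r)).sub (contDiff_qPoch b⁻¹ r).continuous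

/-- The tails of the density of the gap law. They are explicit because `F_r(a) / a ^ 2` is the
derivative of `(a; b⁻¹)_r / a`. -/
theorem lintegral_gapDensity_Ioi {b : ℝ} (hb : 1 < b) {r : ℕ} (hr : 0 < r) {a : ℝ} (ha : 0 < a) :
    ∫⁻ s in Ioi a, ENNReal.ofReal (gapDensity b r s) =
      if a * Real.log b < b then
        ENNReal.ofReal ((qPoch (a * Real.log b / b) b⁻¹ r - qPoch (min (a * Real.log b) 1) b⁻¹ r) /
          (a * Real.log b)) else 0 := by
  have hL : 0 < Real.log b := Real.log_pos hb
  set L := Real.log b with hLdef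
  have hlt : 1 / L < b / L := by gcongr
  -- the primitives of the density on its two intervals
  have hfac : ∀ s : ℝ, F b r (s * (b⁻¹ * L)) = F b r (s * b⁻¹ * L) := fun s => by rw [mul_assoc]
  let G₁ : ℝ → ℝ := fun s => 1 / L * (qPoch (s * L) b⁻¹ r / s - qPoch (s * (b⁻¹ * L)) b⁻¹ r / s)
  let G₂ : ℝ → ℝ := fun s => -(1 / L * (qPoch (s * (b⁻¹ * L)) b⁻¹ r / s))
  let d₁ : ℝ → ℝ := fun s => 1 / L * (s ^ 2)⁻¹ * (F b r (s * L) - F b r (s * b⁻¹ * L))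
  let d₂ : ℝ → ℝ := fun s => -(1 / L * (s ^ 2)⁻¹ * F b r (s * b⁻¹ * L))
  have hG₁ : ∀ s, 0 < s → HasDerivAt G₁ (d₁ s) s := fun s hs => by
    refine (((hasDerivAt_F_term (b := b) r (k := L) hs.ne').fun_sub
      (hasDerivAt_F_term (b := b) r (k := b⁻¹ * L) hs.ne')).const_mul (1 / L)).congr_deriv ?_
    simp only [d₁, hfac]; ring
  have hG₂ : ∀ s, 0 < s → HasDerivAt G₂ (d₂ s) s := fun s hs => by
    refine (((hasDerivAt_F_term (b := b) r (k := b⁻¹ * L) hs.ne').const_mul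
      (1 / L)).fun_neg).congr_deriv ?_
    simp only [d₂, hfac]; ring
  have hFc := continuous_F b r
  have hinv : ∀ u v : ℝ, 0 < u → ContinuousOn (fun s : ℝ => (s ^ 2)⁻¹) (Icc u v) := fun u v hu =>
    (continuousOn_pow 2).inv₀ fun s hs => (pow_pos (hu.trans_le hs.1) 2).ne'
  have hd₁ : ∀ u v, 0 < u → ContinuousOn d₁ (Icc u v) := fun u v hu =>
    (continuousOn_const.mul (hinv u v hu)).mul
      (Continuous.continuousOn (by fun_prop))
  have hd₂ : ∀ u v, 0 < u → ContinuousOn d₂ (Icc u v) := fun u v hu =>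
    ((continuousOn_const.mul (hinv u v hu)).mul (Continuous.continuousOn (by fun_prop))).neg
  have e₁ : ∀ s, s < 1 / L → gapDensity b r s = d₁ s := fun s hs => by
    rw [gapDensity, if_pos hs]
  have e₂ : ∀ s, 1 / L ≤ s → s < b / L → gapDensity b r s = d₂ s := fun s hs hs2 => by
    rw [gapDensity, if_neg hs.not_gt, if_pos hs2]
  have e₃ : ∀ s, b / L ≤ s → gapDensity b r s = 0 := fun s hs => by
    rw [gapDensity, if_neg (hlt.le.trans hs).not_gt, if_neg hs.not_gt]
  have I₁ : ∀ u, 0 < u → u ≤ 1 / L →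
      ∫⁻ s in Ioo u (1 / L), ENNReal.ofReal (gapDensity b r s) =
        ENNReal.ofReal (G₁ (1 / L) - G₁ u) := fun u hu hu1 => by
    rw [← lintegral_ofReal_deriv hu1 (fun s hs => hG₁ s (hu.trans_le hs.1)) (hd₁ _ _ hu)
      (fun s hs => by rw [← e₁ s hs.2]; exact gapDensity_nonneg hb r (hu.trans hs.1))]
    exact setLIntegral_congr_fun measurableSet_Ioo fun s hs => by rw [e₁ s hs.2]
  have I₂ : ∀ u, 1 / L ≤ u → u ≤ b / L →
      ∫⁻ s in Ioo u (b / L), ENNReal.ofReal (gapDensity b r s) =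
        ENNReal.ofReal (G₂ (b / L) - G₂ u) := fun u hu1 hu2 => by
    have hu : 0 < u := (by positivity : 0 < 1 / L).trans_le hu1
    rw [← lintegral_ofReal_deriv hu2 (fun s hs => hG₂ s (hu.trans_le hs.1)) (hd₂ _ _ hu)
      (fun s hs => by
        rw [← e₂ s (hu1.trans hs.1.le) hs.2]; exact gapDensity_nonneg hb r (hu.trans hs.1))]
    exact setLIntegral_congr_fun measurableSet_Ioo fun s hs => by
      rw [e₂ s (hu1.trans hs.1.le) hs.2]
  have I₃ : ∀ u, b / L ≤ u → ∫⁻ s in Ioi u, ENNReal.ofReal (gapDensity b r s) = 0 := fun u hu => by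
    rw [setLIntegral_congr_fun (g := fun _ => 0) measurableSet_Ioi fun s hs => by
      rw [e₃ s (hu.trans (le_of_lt hs)), ENNReal.ofReal_zero]]
    simp
  have split : ∀ u v, u ≤ v → ∫⁻ s in Ioi u, ENNReal.ofReal (gapDensity b r s) =
      (∫⁻ s in Ioo u v, ENNReal.ofReal (gapDensity b r s)) +
        ∫⁻ s in Ioi v, ENNReal.ofReal (gapDensity b r s) := fun u v huv => by
    rw [← Ioc_union_Ioi_eq_Ioi huv, lintegral_union measurableSet_Ioi
      (Ioc_disjoint_Ioi le_rfl), Measure.restrict_congr_set Ioo_ae_eq_Ioc]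
  have hG₂b : G₂ (b / L) = 0 := by
    have : b / L * (b⁻¹ * L) = 1 := by field_simp
    simp only [G₂, this, qPoch_one hr]; simp
  have hG₁₂ : G₁ (1 / L) = G₂ (1 / L) := by
    have : 1 / L * L = 1 := by field_simp
    simp only [G₁, G₂, this, qPoch_one hr]; simp
  split_ifs with h1
  · have hab : a < b / L := by rwa [lt_div_iff₀ hL]
    have hdiv : a * (b⁻¹ * L) = a * L / b := by field_simp
    rcases lt_or_ge a (1 / L) with h2 | h2
    · have h3 : a * L < 1 := by rwa [lt_div_iff₀ hL] at h2
      have n1 : 0 ≤ G₁ (1 / L) - G₁ a := by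
        have hm : MonotoneOn G₁ (Icc a (1 / L)) :=
          monotoneOn_of_deriv_nonneg (convex_Icc _ _)
            (fun s hs => (hG₁ s (ha.trans_le hs.1)).continuousAt.continuousWithinAt)
            (fun s hs =>
              (hG₁ s (ha.trans_le (interior_subset hs).1)).differentiableAt.differentiableWithinAt)
            (fun s hs => by
              rw [interior_Icc] at hs
              rw [(hG₁ s (ha.trans hs.1)).deriv, ← e₁ s hs.2]
              exact gapDensity_nonneg hb r (ha.trans hs.1))
        exact sub_nonneg.2 (hm ⟨le_rfl, h2.le⟩ ⟨h2.le, le_rfl⟩ h2.le)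
      have n2 : 0 ≤ G₂ (b / L) - G₂ (1 / L) := by
        rw [hG₂b, zero_sub]
        simp only [G₂, neg_neg]
        have : 1 / L * (b⁻¹ * L) = b⁻¹ := by field_simp
        rw [this]
        obtain ⟨p1, p2, _, _, hs⟩ :=
          qPoch_signs (q := b⁻¹) (by positivity) (inv_le_one_of_one_le₀ hb.le) r
        have := (hs b⁻¹ ⟨by positivity, inv_le_one_of_one_le₀ hb.le⟩).1
        positivity
      rw [split a (1 / L) h2.le, split (1 / L) (b / L) hlt.le, I₁ a ha h2.le, I₂ _ le_rfl hlt.le,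
        I₃ _ le_rfl, add_zero, ← ENNReal.ofReal_add n1 n2, hG₁₂, hG₂b, min_eq_left h3.le]
      congr 1
      simp only [G₁, hdiv]
      field_simp
      ring
    · have h3 : 1 ≤ a * L := by rwa [div_le_iff₀ hL] at h2
      rw [split a (b / L) hab.le, I₂ a h2 hab.le, I₃ _ le_rfl, add_zero, hG₂b, min_eq_right h3,
        qPoch_one hr]
      congr 1
      simp only [G₂, hdiv]
      field_simp
      ring
  · refine I₃ a ?_
    rw [div_le_iff₀ hL]
    exact not_lt.1 h1

/-- The absolutely continuous part of the limiting gap law is the average over `y ∈ [1, b]` of the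
laws of the gaps at `y`, measured on the logarithmic scale. -/
theorem gapDensity_eq_map {b : ℝ} (hb : 1 < b) {r : ℕ} (hr : 0 < r) :
    (volume.restrict (Ioi 0)).withDensity (fun s => ENNReal.ofReal (gapDensity b r s)) =
      ENNReal.ofReal b⁻¹ • ((volume.restrict (Ioo 1 b)).prod (R b r)).map
        (fun p : ℝ × ℝ => b * p.2 / (p.1 * Real.log b)) := by
  have hb0 : 0 < b := by linarith
  have hL : 0 < Real.log b := Real.log_pos hb
  set L := Real.log b with hLdef
  have := isFiniteMeasure_R hb hr
  have hm : Measurable fun p : ℝ × ℝ => b * p.2 / (p.1 * L) := by fun_prop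
  have hfin : IsFiniteMeasure (ENNReal.ofReal b⁻¹ •
      ((volume.restrict (Ioo 1 b)).prod (R b r)).map (fun p : ℝ × ℝ => b * p.2 / (p.1 * L))) :=
    Measure.smul_finite _ ENNReal.ofReal_ne_top
  symm
  refine ext_of_Ioi_of_pos ?_ ?_ fun a ha => ?_
  · rw [Measure.smul_apply, Measure.map_apply hm measurableSet_Iic,
      Measure.prod_apply (hm measurableSet_Iic),
      setLIntegral_congr_fun (g := fun _ => 0) measurableSet_Ioo]
    · simp
    · intro y hy
      have hy0 : 0 < y := by linarith [hy.1]
      have : Prod.mk y ⁻¹' ((fun p : ℝ × ℝ => b * p.2 / (p.1 * L)) ⁻¹' Iic 0) ⊆ Iic 0 := by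
        intro t ht
        by_contra hc
        have ht' : b * t / (y * L) ≤ 0 := ht
        have : 0 < b * t / (y * L) := by
          have : 0 < t := not_le.1 hc
          positivity
        linarith
      exact measure_mono_null this (R_Iic_zero b r)
  · rw [withDensity_apply _ measurableSet_Iic, Measure.restrict_restrict measurableSet_Iic,
      Iic_inter_Ioi, Ioc_self]
    simp
  · rw [Measure.smul_apply, Measure.map_apply hm measurableSet_Ioi,
      Measure.prod_apply (hm measurableSet_Ioi), withDensity_apply _ measurableSet_Ioi,
      Measure.restrict_restrict measurableSet_Ioi, Ioi_inter_Ioi, max_eq_left ha.le,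
      lintegral_gapDensity_Ioi hb hr ha]
    set c := a * L with hc
    have hc0 : 0 < c := by positivity
    have hsec : ∀ y ∈ Ioo 1 b,
        R b r (Prod.mk y ⁻¹' ((fun p : ℝ × ℝ => b * p.2 / (p.1 * L)) ⁻¹' Ioi a)) =
        if y < b / c then ENNReal.ofReal (-deriv (fun t => qPoch t b⁻¹ r) (y * (c / b)))
          else 0 := by
      intro y hy
      have hy0 : 0 < y := by linarith [hy.1]
      have : Prod.mk y ⁻¹' ((fun p : ℝ × ℝ => b * p.2 / (p.1 * L)) ⁻¹' Ioi a) =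
          Ioi (y * (c / b)) := by
        ext t
        simp only [mem_preimage, mem_Ioi, hc]
        rw [lt_div_iff₀ (by positivity), ← mul_div_assoc, div_lt_iff₀' hb0]
        ring_nf
      rw [this, R_Ioi hb hr (by positivity)]
      have : y * (c / b) < 1 ↔ y < b / c := by
        rw [lt_div_iff₀ hc0, ← mul_div_assoc, div_lt_one hb0]
      simp only [this]
    rw [setLIntegral_congr_fun measurableSet_Ioo hsec]
    split_ifs with h1
    · set M := min b (b / c) with hM
      have h1M : 1 < M := lt_min hb (by rwa [one_lt_div hc0])
      have hres : ∫⁻ y in Ioo 1 b, (if y < b / c then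
            ENNReal.ofReal (-deriv (fun t => qPoch t b⁻¹ r) (y * (c / b))) else 0) =
          ∫⁻ y in Ioo 1 M, ENNReal.ofReal (-deriv (fun t => qPoch t b⁻¹ r) (y * (c / b))) := by
        rw [← lintegral_indicator measurableSet_Ioo, ← lintegral_indicator measurableSet_Ioo]
        refine lintegral_congr fun y => ?_
        simp only [indicator, mem_Ioo, hM, lt_min_iff]
        by_cases p1 : 1 < y <;> by_cases p2 : y < b <;> by_cases p3 : y < b / c <;>
          simp [p1, p2, p3]
      have hMc : M * (c / b) ≤ 1 := by
        calc M * (c / b) ≤ b / c * (c / b) := by gcongr; exact min_le_right _ _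
          _ = 1 := by field_simp
      have hMc' : M * (c / b) = min c 1 := by
        rw [hM, min_mul_of_nonneg _ _ (by positivity)]
        congr 1 <;> field_simp
      rw [hres, lintegral_ofReal_deriv (g := fun y => -(b / c * qPoch (y * (c / b)) b⁻¹ r)) h1M.le]
      · rw [smul_eq_mul, ← ENNReal.ofReal_mul (by positivity), hMc']
        congr 1
        rw [one_mul]
        field_simp
        ring
      · intro y _
        have hd1 : HasDerivAt (fun t => qPoch t b⁻¹ r)
            (deriv (fun t => qPoch t b⁻¹ r) (y * (c / b))) (y * (c / b)) :=
          ((contDiff_qPoch b⁻¹ r).differentiable (by simp) _).hasDerivAt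
        have hd2 : HasDerivAt (fun y : ℝ => y * (c / b)) (c / b) y := by
          simpa using (hasDerivAt_id y).mul_const (c / b)
        have hd3 : HasDerivAt (fun y => qPoch (y * (c / b)) b⁻¹ r)
            (deriv (fun t => qPoch t b⁻¹ r) (y * (c / b)) * (c / b)) y := by
          simpa [Function.comp_def] using HasDerivAt.comp y hd1 hd2
        refine ((hd3.const_mul (b / c)).fun_neg).congr_deriv ?_
        field_simp
      · have := continuous_deriv_qPoch b⁻¹ r
        exact Continuous.continuousOn (by fun_prop)
      · intro y hy
        have hy0 : 0 < y := by linarith [hy.1]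
        rw [neg_nonneg]
        refine deriv_qPoch_nonpos hb r ⟨by positivity, ?_⟩
        refine le_trans ?_ hMc
        gcongr
        exact hy.2.le
    · rw [setLIntegral_congr_fun (g := fun _ => 0) measurableSet_Ioo]
      · simp
      · intro y hy
        have : ¬ y < b / c := by
          have : b / c ≤ 1 := by rw [div_le_one hc0]; exact not_lt.1 h1
          linarith [hy.1]
        simp [this]

/-! ### Sums over the ordered points of a circle -/

/-- The distance from `w` to the next point of `{v 1, …, v N} + ℤ` strictly to its right. -/
def circGap (v : ℕ → ℝ) (N : ℕ) (w : ℝ) : ℝ :=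
  sInf {t | 0 < t ∧ ∃ n ∈ Finset.Icc 1 N, ∃ k : ℤ, w + t = v n + k}

theorem ordered_of_lt {v : ℕ → ℝ} {N i : ℕ} (h : i < N) :
    ordered v N i = firstValues v N (Tuple.sort (firstValues v N) ⟨i, h⟩) := dif_pos h

theorem ordered_self {v : ℕ → ℝ} {N : ℕ} (hN : 0 < N) :
    ordered v N N = ordered v N 0 + 1 := by
  rw [ordered_of_lt hN, ordered, dif_neg (lt_irrefl N), dif_pos hN]

theorem exists_ordered_eq {v : ℕ → ℝ} {N i : ℕ} (h : i < N) :
    ∃ n ∈ Finset.Icc 1 N, ordered v N i = v n := by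
  rw [ordered_of_lt h]
  refine ⟨_, ?_, rfl⟩
  rw [Finset.mem_Icc]
  have := (Tuple.sort (firstValues v N) ⟨i, h⟩).2
  omega

theorem exists_eq_ordered {v : ℕ → ℝ} {N n : ℕ} (h : n ∈ Finset.Icc 1 N) :
    ∃ i < N, ordered v N i = v n := by
  rw [Finset.mem_Icc] at h
  have hlt : n - 1 < N := by omega
  refine ⟨((Tuple.sort (firstValues v N)).symm ⟨n - 1, hlt⟩ : Fin N), Fin.is_lt _, ?_⟩
  rw [ordered_of_lt (Fin.is_lt _), Fin.eta, Equiv.apply_symm_apply, firstValues]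
  congr 1
  simp only
  omega

theorem ordered_mono {v : ℕ → ℝ} {N : ℕ} (hv : ∀ n, v n ∈ Ico (0 : ℝ) 1) {i j : ℕ} (hij : i ≤ j)
    (hj : j ≤ N) (hN : 0 < N) : ordered v N i ≤ ordered v N j := by
  have key : ∀ i j, i ≤ j → j < N → ordered v N i ≤ ordered v N j := fun i j hij hj => by
    rw [ordered_of_lt (hij.trans_lt hj), ordered_of_lt hj]
    exact Tuple.monotone_sort (firstValues v N) (show (⟨i, _⟩ : Fin N) ≤ ⟨j, _⟩ from hij)
  rcases hj.lt_or_eq with hj | rfl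
  · exact key i j hij hj
  · rcases hij.lt_or_eq with hi | rfl
    · obtain ⟨n, -, hn⟩ := exists_ordered_eq (v := v) hi
      obtain ⟨n', -, hn'⟩ := exists_ordered_eq (v := v) hN
      rw [ordered_self hN, hn, hn']
      linarith [(hv n).2, (hv n').1]
    · exact le_rfl

theorem circGap_ordered {v : ℕ → ℝ} {N : ℕ} (hv : ∀ n, v n ∈ Ico (0 : ℝ) 1) {i : ℕ} (hi : i < N)
    (hlt : ordered v N i < ordered v N (i + 1)) :
    circGap v N (ordered v N i) = ordered v N (i + 1) - ordered v N i := by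
  have hN : 0 < N := by omega
  refine IsLeast.csInf_eq ⟨⟨sub_pos.2 hlt, ?_⟩, ?_⟩
  · rcases Nat.lt_or_ge (i + 1) N with h | h
    · obtain ⟨n, hn, e⟩ := exists_ordered_eq (v := v) h
      exact ⟨n, hn, 0, by rw [e]; simp⟩
    · have hiN : i + 1 = N := by omega
      obtain ⟨n, hn, e⟩ := exists_ordered_eq (v := v) hN
      exact ⟨n, hn, 1, by rw [hiN, ordered_self hN, e]; simp⟩
  · rintro t ⟨ht, n, hn, k, e⟩
    obtain ⟨j, hj, ej⟩ := exists_eq_ordered (v := v) hn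
    obtain ⟨n', -, e'⟩ := exists_ordered_eq (v := v) hi
    rcases lt_trichotomy k 0 with hk | hk | hk
    · have : (k : ℝ) ≤ -1 := by exact_mod_cast (by omega : k ≤ -1)
      linarith [(hv n).2, (hv n').1]
    · subst hk
      have hij : i < j := by
        by_contra h
        have := ordered_mono hv (not_lt.1 h) hi.le hN
        simp only [Int.cast_zero] at e
        linarith
      have := ordered_mono hv (Nat.succ_le_of_lt hij) hj.le hN
      simp only [Int.cast_zero, Nat.succ_eq_add_one] at e this
      linarith
    · have h1 : (1 : ℝ) ≤ k := by exact_mod_cast hk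
      have h2 := ordered_mono hv (Nat.succ_le_of_lt hi) le_rfl hN
      have h3 := ordered_mono hv (Nat.zero_le j) hj.le hN
      rw [ordered_self hN] at h2
      simp only [Nat.succ_eq_add_one] at h2
      linarith

/-- A sum over consecutive pairs of the ordered list: repeated points have gap `0`, and each
distinct point contributes its gap on the circle once. -/
theorem sum_ordered {v : ℕ → ℝ} {N : ℕ} (hN : 0 < N) (hv : ∀ n, v n ∈ Ico (0 : ℝ) 1)
    (φ : ℝ → ℝ → ℝ) :
    ∑ i ∈ Finset.range N, φ (ordered v N i) (ordered v N (i + 1) - ordered v N i) =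
      ∑ n ∈ Finset.Icc 1 N, φ (v n) 0 +
        ∑ w ∈ (Finset.Icc 1 N).image v, (φ w (circGap v N w) - φ w 0) := by
  have h1 : ∑ i ∈ Finset.range N, φ (ordered v N i) 0 = ∑ n ∈ Finset.Icc 1 N, φ (v n) 0 := by
    rw [Finset.sum_range fun i => φ (ordered v N i) 0]
    have e : ∀ i : Fin N, φ (ordered v N i) 0 =
        (fun j : Fin N => φ (v (j + 1)) 0) (Tuple.sort (firstValues v N) i) := fun i => by
      rw [ordered_of_lt i.2]; rfl
    rw [Finset.sum_congr rfl fun i _ => e i, Equiv.sum_comp (Tuple.sort (firstValues v N))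
        (fun j : Fin N => φ (v (j + 1)) 0),
      ← Finset.sum_range fun j => φ (v (j + 1)) 0, Finset.range_eq_Ico,
      Finset.sum_Ico_add' (fun j => φ (v j) 0), zero_add, Finset.Ico_add_one_right_eq_Icc]
  set J := (Finset.range N).filter fun i => ordered v N i < ordered v N (i + 1) with hJ
  have himage : J.image (ordered v N) = (Finset.Icc 1 N).image v := by
    ext w
    simp only [Finset.mem_image]
    constructor
    · rintro ⟨i, hi, rfl⟩
      obtain ⟨n, hn, e⟩ := exists_ordered_eq (v := v) (N := N)
        (Finset.mem_range.1 (Finset.mem_filter.1 hi).1)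
      exact ⟨n, hn, e.symm⟩
    · rintro ⟨n, hn, rfl⟩
      -- the last index at which the value occurs is followed by a strict increase
      obtain ⟨i, hi, e⟩ := exists_eq_ordered (v := v) hn
      let T := (Finset.range N).filter fun i => ordered v N i = v n
      have hT : T.Nonempty := ⟨i, by simp [T, hi, e]⟩
      have hmax : T.max' hT < N ∧ ordered v N (T.max' hT) = v n := by
        have := T.max'_mem hT
        rwa [Finset.mem_filter, Finset.mem_range] at this
      refine ⟨T.max' hT, ?_, hmax.2⟩
      rw [hJ, Finset.mem_filter, Finset.mem_range]
      refine ⟨hmax.1, lt_of_le_of_ne (ordered_mono hv (Nat.le_succ _) hmax.1 hN) fun h => ?_⟩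
      rcases Nat.lt_or_ge (T.max' hT + 1) N with h2 | h2
      · have : T.max' hT + 1 ∈ T := by
          rw [Finset.mem_filter, Finset.mem_range]
          exact ⟨h2, h ▸ hmax.2⟩
        have := T.le_max' _ this
        omega
      · have h3 : T.max' hT + 1 = N := by have := hmax.1; omega
        obtain ⟨n', -, e'⟩ := exists_ordered_eq (v := v) hN
        have h4 : ordered v N (T.max' hT + 1) = ordered v N 0 + 1 := by rw [h3, ordered_self hN]
        linarith [(hv n).2, (hv n').1]
  have hinj : Set.InjOn (ordered v N) J := by
    have key : ∀ i ∈ J, ∀ j ∈ J, i < j → ordered v N i ≠ ordered v N j := fun i hi j hj hij e => by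
      have h2 := (Finset.mem_filter.1 hi).2
      have h3 := ordered_mono hv (Nat.succ_le_of_lt hij)
        (Finset.mem_range.1 (Finset.mem_filter.1 hj).1).le hN
      simp only [Nat.succ_eq_add_one] at h3
      linarith
    intro i hi j hj e
    rcases lt_trichotomy i j with h | h | h
    · exact absurd e (key i hi j hj h)
    · exact h
    · exact absurd e.symm (key j hj i hi h)
  have h2 : ∑ i ∈ Finset.range N,
      (φ (ordered v N i) (ordered v N (i + 1) - ordered v N i) - φ (ordered v N i) 0) =
      ∑ w ∈ (Finset.Icc 1 N).image v, (φ w (circGap v N w) - φ w 0) := by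
    rw [← himage, Finset.sum_image hinj, hJ, Finset.sum_filter]
    refine Finset.sum_congr rfl fun i hi => ?_
    have hi' := Finset.mem_range.1 hi
    split_ifs with h
    · rw [circGap_ordered hv hi' h]
    · have : ordered v N (i + 1) = ordered v N i :=
        le_antisymm (not_lt.1 h) (ordered_mono hv (Nat.le_succ i) hi' hN)
      rw [this, sub_self, sub_self]
  rw [← h1, ← h2, ← Finset.sum_add_distrib]
  exact Finset.sum_congr rfl fun i _ => by ring

/-- Gap sums are invariant under a rotation of the circle. -/
theorem sum_ordered_rotate {v v' : ℕ → ℝ} {N : ℕ} (hN : 0 < N) (hv : ∀ n, v n ∈ Ico (0 : ℝ) 1)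
    (c : ℝ) (hv' : ∀ n ∈ Finset.Icc 1 N, v' n = Int.fract (v n - c))
    (hv1 : ∀ n, v' n ∈ Ico (0 : ℝ) 1) (g : ℝ → ℝ) :
    ∑ i ∈ Finset.range N, g (ordered v N (i + 1) - ordered v N i) =
      ∑ i ∈ Finset.range N, g (ordered v' N (i + 1) - ordered v' N i) := by
  rw [sum_ordered hN hv fun _ s => g s, sum_ordered hN hv1 fun _ s => g s]
  congr 1
  have himage : (Finset.Icc 1 N).image v' =
      ((Finset.Icc 1 N).image v).image fun w => Int.fract (w - c) := by
    rw [Finset.image_image]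
    exact Finset.image_congr fun n hn => hv' n hn
  have hinj : Set.InjOn (fun w => Int.fract (w - c))
      (((Finset.Icc 1 N).image v : Finset ℝ) : Set ℝ) := by
    intro w hw w' hw' e
    rw [Finset.mem_coe, Finset.mem_image] at hw hw'
    obtain ⟨n, -, rfl⟩ := hw
    obtain ⟨n', -, rfl⟩ := hw'
    obtain ⟨k, hk⟩ := Int.fract_eq_fract.1 e
    have h1 : v n - v n' = k := by linarith
    have h2 : k = 0 := by
      have a1 : (k : ℝ) < 1 := by linarith [(hv n).2, (hv n').1]
      have a2 : (-1 : ℝ) < k := by linarith [(hv n').2, (hv n).1]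
      have a3 : k < 1 := by exact_mod_cast a1
      have a4 : -1 < k := by exact_mod_cast a2
      omega
    rw [h2] at h1
    simp only [Int.cast_zero] at h1
    linarith
  rw [himage, Finset.sum_image hinj]
  · refine Finset.sum_congr rfl fun w _ => ?_
    congr 2
    unfold circGap
    congr 1
    ext t
    refine and_congr_right fun _ => exists_congr fun n => and_congr_right fun hn => ?_
    rw [hv' n hn]
    have e1 := Int.floor_add_fract (w - c)
    have e2 := Int.floor_add_fract (v n - c)
    constructor
    · rintro ⟨k, hk⟩
      refine ⟨k + ⌊v n - c⌋ - ⌊w - c⌋, ?_⟩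
      push_cast
      linarith
    · rintro ⟨k, hk⟩
      refine ⟨k - ⌊v n - c⌋ + ⌊w - c⌋, ?_⟩
      push_cast
      linarith

/-! ### The points `b ^ eta` as a union of lattices -/

theorem eta_mem (b : ℝ) (N n : ℕ) : eta b N n ∈ Ico (0 : ℝ) 1 :=
  ⟨Int.fract_nonneg _, Int.fract_lt_one _⟩

theorem xi_mem (b : ℝ) (n : ℕ) : xi b n ∈ Ico (0 : ℝ) 1 :=
  ⟨Int.fract_nonneg _, Int.fract_lt_one _⟩

theorem eta_self {b : ℝ} {N : ℕ} (hN : 0 < N) : eta b N N = 0 := by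
  have : (N : ℝ) ≠ 0 := by exact_mod_cast hN.ne'
  simp [eta, div_self this]

/-- The indices `n` for which the lattice point `b ^ (i + 1) n / N` lies in `[1, b)`. -/
def latticeWindow (b : ℝ) (i N : ℕ) : Finset ℕ :=
  (Finset.Icc 1 N).filter fun n => (N : ℝ) ≤ b ^ (i + 1) * n ∧ b ^ (i + 1) * n < b * N

/-- The lattice point `b ^ (i + 1) n / N`. -/
def latticePoint (b : ℝ) (i N n : ℕ) : ℝ := b ^ (i + 1) * n / N

theorem latticePoint_mem {b : ℝ} {i N n : ℕ} (h : n ∈ latticeWindow b i N) :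
    latticePoint b i N n ∈ Ico 1 b := by
  obtain ⟨h1, h2, h3⟩ := Finset.mem_filter.1 h
  rw [Finset.mem_Icc] at h1
  have hN : (0 : ℝ) < N := by exact_mod_cast (by omega : 0 < N)
  exact ⟨(one_le_div hN).2 h2, (div_lt_iff₀ hN).2 h3⟩

theorem mem_latticeWindow {b : ℝ} (hb : 1 < b) {i N n : ℕ} (hN : 0 < N)
    (h : latticePoint b i N n ∈ Ico 1 b) : n ∈ latticeWindow b i N := by
  have hN' : (0 : ℝ) < N := by exact_mod_cast hN
  have h1 : (N : ℝ) ≤ b ^ (i + 1) * n := (one_le_div hN').1 h.1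
  have h2 : b ^ (i + 1) * n < b * N := (div_lt_iff₀ hN').1 h.2
  have hn : 0 < n := Nat.pos_of_ne_zero fun h0 => by
    rw [h0] at h1; simp at h1; omega
  have hn' : (0 : ℝ) < n := by exact_mod_cast hn
  have h3 : b * n ≤ b ^ (i + 1) * n :=
    mul_le_mul_of_nonneg_right (le_self_pow₀ hb.le (by omega)) hn'.le
  have h4 : (n : ℝ) < N := lt_of_mul_lt_mul_left (h3.trans_lt h2) (by linarith)
  exact Finset.mem_filter.2 ⟨Finset.mem_Icc.2 ⟨hn, by exact_mod_cast h4.le⟩, h1, h2⟩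

theorem eta_eq_logb_latticePoint {b : ℝ} (hb : 1 < b) {i N n : ℕ}
    (h : n ∈ latticeWindow b i N) : eta b N n = Real.logb b (latticePoint b i N n) := by
  obtain ⟨h1, -⟩ := Finset.mem_filter.1 h
  rw [Finset.mem_Icc] at h1
  have hN : (0 : ℝ) < N := by exact_mod_cast (by omega : 0 < N)
  have hn : (0 : ℝ) < n := by exact_mod_cast (by omega : 0 < n)
  have hy := latticePoint_mem h
  have e : Real.logb b (latticePoint b i N n) = Real.logb b (n / N) + ((i + 1 : ℕ) : ℤ) := by
    rw [latticePoint, mul_div_assoc, Real.logb_mul (by positivity) (by positivity),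
      Real.logb_pow, Real.logb_self_eq_one hb]
    push_cast; ring
  rw [eta, ← Int.fract_add_intCast _ ((i + 1 : ℕ) : ℤ), ← e, Int.fract_eq_self]
  exact ⟨Real.logb_nonneg hb hy.1,
    by rw [Real.logb_lt_iff_lt_rpow hb (by linarith [hy.1]), Real.rpow_one]; exact hy.2⟩

/-- Every nonzero `eta` comes from one of the lattices with index `i < r`, since
`b ^ (i + 1 + r q) n = b ^ (i + 1) (m ^ q n)`. -/
theorem exists_latticePoint_eq {b : ℝ} (hb : 1 < b) {m r : ℕ} (hr : 0 < r) (hbr : b ^ r = m)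
    {N n : ℕ} (hn : n ∈ Finset.Icc 1 N) (h0 : eta b N n ≠ 0) :
    ∃ i : Fin r, ∃ n' ∈ latticeWindow b i N, eta b N n = Real.logb b (latticePoint b i N n') := by
  rw [Finset.mem_Icc] at hn
  have hN : (0 : ℝ) < N := by exact_mod_cast (by omega : 0 < N)
  have hn0 : (0 : ℝ) < n := by exact_mod_cast (by omega : 0 < n)
  have hnN : n < N := lt_of_le_of_ne hn.2 fun h => h0 (by rw [h, eta_self (by omega)])
  have hlog : Real.logb b (n / N) < 0 := by
    refine Real.logb_neg hb (by positivity) ((div_lt_one hN).2 (by exact_mod_cast hnN))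
  have hfl : ⌊Real.logb b (n / N)⌋ < 0 := Int.floor_lt.2 (by simpa using hlog)
  obtain ⟨k, hk⟩ : ∃ k : ℕ, ⌊Real.logb b (n / N)⌋ = -((k + 1 : ℕ) : ℤ) :=
    ⟨(-⌊Real.logb b (n / N)⌋ - 1).toNat, by omega⟩
  have heta : eta b N n = Real.logb b (n / N) + ((k + 1 : ℕ) : ℝ) := by
    rw [eta, Int.fract, hk]; push_cast; ring
  have hpow : b ^ (k + 1) = b ^ (k % r + 1) * (m : ℝ) ^ (k / r) := by
    rw [← hbr, ← pow_mul, ← pow_add]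
    congr 1
    have := Nat.mod_add_div k r
    omega
  have hy : latticePoint b (k % r) N (m ^ (k / r) * n) = b ^ (k + 1) * (n / N) := by
    rw [latticePoint, hpow]; push_cast; ring
  have hlogy : eta b N n = Real.logb b (latticePoint b (k % r) N (m ^ (k / r) * n)) := by
    rw [hy, Real.logb_mul (by positivity) (by positivity), Real.logb_pow,
      Real.logb_self_eq_one hb, heta]
    ring
  refine ⟨⟨k % r, Nat.mod_lt _ hr⟩, m ^ (k / r) * n, mem_latticeWindow hb (by omega) ?_, hlogy⟩
  have hpos : 0 < latticePoint b (k % r) N (m ^ (k / r) * n) := by rw [hy]; positivity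
  have hm := eta_mem b N n
  rw [hlogy] at hm
  refine ⟨?_, ?_⟩
  · have := (Real.le_logb_iff_rpow_le hb hpos).1 hm.1
    simpa using this
  · have := (Real.logb_lt_iff_lt_rpow hb hpos).1 hm.2
    simpa using this

/-- Distinct lattices meet only at the origin. -/
theorem latticePoint_injective {b : ℝ} {r : ℕ}
    (hrel : ∀ l : Fin r → ℤ, ∑ j, (l j : ℝ) * b ^ (j : ℕ) = 0 → l = 0) (hb : 1 < b) {N : ℕ}
    (hN : 0 < N) {i j : Fin r} {n n' : ℕ} (hn : 0 < n)
    (h : latticePoint b i N n = latticePoint b j N n') : i = j ∧ n = n' := by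
  have hb0 : 0 < b := by linarith
  have hN' : (N : ℝ) ≠ 0 := by exact_mod_cast hN.ne'
  rw [latticePoint, latticePoint, div_left_inj' hN'] at h
  have h1 : b ^ (i : ℕ) * n = b ^ (j : ℕ) * n' := by
    have : b * (b ^ (i : ℕ) * n) = b * (b ^ (j : ℕ) * n') := by
      rw [← mul_assoc, ← mul_assoc, ← pow_succ', ← pow_succ', h]
    exact mul_left_cancel₀ hb0.ne' this
  have h2 := hrel (fun k =>
      (Pi.single i (n : ℤ) : Fin r → ℤ) k - (Pi.single j (n' : ℤ) : Fin r → ℤ) k) (by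
    simp only [Int.cast_sub, sub_mul, Finset.sum_sub_distrib]
    have : ∀ (i : Fin r) (n : ℕ), ∑ k, ((Pi.single i (n : ℤ) : Fin r → ℤ) k : ℝ) * b ^ (k : ℕ) =
        n * b ^ (i : ℕ) := fun i n => by
      rw [Finset.sum_eq_single i]
      · simp
      · intro k _ hk; simp [hk]
      · simp
    rw [this, this]
    linarith)
  have h3 := congrFun h2 i
  by_cases hij : i = j
  · subst hij
    simp at h3
    exact ⟨rfl, by omega⟩
  · simp [hij] at h3
    omega

/-- The distance, in units of `1 / N`, from the lattice point `b ^ (i + 1) n / N` to the next point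
of the union of the `r` lattices. -/
def latticeGap (b : ℝ) {r : ℕ} (i : Fin r) (N n : ℕ) : ℝ :=
  gapFun b i fun j => Int.fract (n * rotation b i N j)

/-- The fractional part measures the distance from `b ^ (i + 1) n / N` to the next point
`b ^ (j + 1) n' / N` of the `j`-th lattice, in units of `1 / N`. -/
theorem gap_to_lattice {b : ℝ} (hb : 0 < b) {r : ℕ} (i j : Fin r) (N n : ℕ) :
    b ^ ((j : ℕ) + 1) * (1 - if j = i then 0 else Int.fract (n * rotation b i N j)) =
      b ^ ((j : ℕ) + 1) * (⌊n * (b ^ (i : ℕ) / b ^ (j : ℕ))⌋ + 1) - b ^ ((i : ℕ) + 1) * n := by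
  have h : (if j = i then 0 else Int.fract (n * rotation b i N j)) =
      Int.fract (n * (b ^ (i : ℕ) / b ^ (j : ℕ))) := by
    split_ifs with hj
    · subst hj
      rw [div_self (pow_pos hb _).ne', mul_one, Int.fract_natCast]
    · rw [rotation, if_neg hj]
  rw [h, Int.fract]
  have : b ^ ((j : ℕ) + 1) * (n * (b ^ (i : ℕ) / b ^ (j : ℕ))) = b ^ ((i : ℕ) + 1) * n := by
    have := (pow_pos hb (j : ℕ)).ne'
    rw [pow_succ, pow_succ]
    field_simp
  linear_combination -this

theorem latticeGap_pos {b : ℝ} (hb : 0 < b) {r : ℕ} (i : Fin r) (N n : ℕ) :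
    0 < latticeGap b i N n := gapFun_pos hb fun _ => Int.fract_lt_one _

theorem latticeGap_le {b : ℝ} (hb : 0 < b) {r : ℕ} (i : Fin r) (N n : ℕ) :
    latticeGap b i N n ≤ b := gapFun_le hb i fun _ => Int.fract_nonneg _

/-- Within `[1, b]`, the point following the lattice point `y` is `y + latticeGap / N`, unless that
exceeds `b`, when it is the endpoint `b`. -/
theorem rpow_circGap {b : ℝ} (hb : 1 < b) {m r : ℕ} (hr : 0 < r) (hbr : b ^ r = m) {N : ℕ}
    {i : Fin r} {n : ℕ} (hn : n ∈ latticeWindow b i N) :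
    b ^ (Real.logb b (latticePoint b i N n) +
        circGap (eta b N) N (Real.logb b (latticePoint b i N n))) =
      min b (latticePoint b i N n + latticeGap b i N n / N) := by
  have hb0 : 0 < b := by linarith
  have hb1 : b ≠ 1 := hb.ne'
  obtain ⟨hn1, -⟩ := Finset.mem_filter.1 hn
  rw [Finset.mem_Icc] at hn1
  have hN : 0 < N := by omega
  have hN' : (0 : ℝ) < N := by exact_mod_cast hN
  set y := latticePoint b i N n with hy
  have hy1 : y ∈ Ico 1 b := latticePoint_mem hn
  set y' := y + latticeGap b i N n / N with hy'
  have hlt : y < y' := by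
    have := latticeGap_pos hb0 i N n
    have : 0 < latticeGap b i N n / N := by positivity
    linarith
  have hy0 : 0 < y := by linarith [hy1.1]
  have hmin : y < min b y' := lt_min hy1.2 hlt
  have hmin0 : 0 < min b y' := by linarith
  suffices h : circGap (eta b N) N (Real.logb b y) = Real.logb b (min b y') - Real.logb b y by
    rw [h, add_sub_cancel, Real.rpow_logb hb0 hb1 hmin0]
  have hG : ∀ j : Fin r, y' ≤ b ^ ((j : ℕ) + 1) * (⌊n * (b ^ (i : ℕ) / b ^ (j : ℕ))⌋ + 1) / N := by
    intro j
    have h1 : latticeGap b i N n ≤ _ := Finset.inf'_le _ (Finset.mem_univ j)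
    rw [gap_to_lattice hb0] at h1
    rw [hy', hy, latticePoint, ← add_div]
    gcongr
    linarith
  refine IsLeast.csInf_eq ⟨⟨sub_pos.2 (Real.logb_lt_logb hb hy0 hmin), ?_⟩, ?_⟩
  · rcases le_or_gt b y' with h | h
    · refine ⟨N, by simp; omega, 1, ?_⟩
      rw [min_eq_left h, eta_self hN, Real.logb_self_eq_one hb]
      simp
    · rw [min_eq_right h.le]
      obtain ⟨j, -, hj⟩ := Finset.exists_mem_eq_inf' (Finset.univ_nonempty_iff.2 ⟨i⟩)
        fun j : Fin r => b ^ ((j : ℕ) + 1) *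
          (1 - if j = i then 0 else Int.fract (n * rotation b i N j))
      have hj' : latticeGap b i N n = _ := hj
      rw [gap_to_lattice hb0] at hj'
      have hfl : 0 ≤ ⌊n * (b ^ (i : ℕ) / b ^ (j : ℕ))⌋ := Int.floor_nonneg.2 (by positivity)
      obtain ⟨k, hk⟩ := Int.eq_ofNat_of_zero_le hfl
      have e : y' = latticePoint b j N (k + 1) := by
        rw [hy', hy, latticePoint, latticePoint, ← add_div, hj', hk]
        push_cast
        ring
      have hmem : k + 1 ∈ latticeWindow b j N :=
        mem_latticeWindow hb hN (by rw [← e]; exact ⟨by linarith [hy1.1], h⟩)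
      refine ⟨k + 1, (Finset.mem_filter.1 hmem).1, 0, ?_⟩
      rw [eta_eq_logb_latticePoint hb hmem, ← e]
      simp
  · rintro t ⟨ht, n', hn', k, e⟩
    have hw0 : 0 ≤ Real.logb b y := Real.logb_nonneg hb hy1.1
    have hm := eta_mem b N n'
    have hT1 : Real.logb b (min b y') ≤ 1 := by
      rw [Real.logb_le_iff_le_rpow hb hmin0, Real.rpow_one]; exact min_le_left _ _
    rcases lt_trichotomy k 0 with hk | hk | hk
    · have : (k : ℝ) ≤ -1 := by exact_mod_cast (by omega : k ≤ -1)
      linarith [hm.2]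
    · subst hk
      simp only [Int.cast_zero, add_zero] at e
      obtain ⟨j, l, hl, e2⟩ := exists_latticePoint_eq hb hr hbr hn' (by linarith)
      have hz := latticePoint_mem hl
      have hyz : y < latticePoint b j N l := by
        rw [← Real.logb_lt_logb_iff hb hy0 (by linarith [hz.1])]
        linarith
      have hle : y' ≤ latticePoint b j N l := by
        refine (hG j).trans ?_
        rw [latticePoint]
        gcongr
        have h1 : b ^ ((i : ℕ) + 1) * n < b ^ ((j : ℕ) + 1) * l := by
          rw [hy, latticePoint, latticePoint] at hyz
          exact (div_lt_div_iff_of_pos_right hN').1 hyz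
        have h2 : n * (b ^ (i : ℕ) / b ^ (j : ℕ)) < l := by
          rw [← mul_div_assoc, div_lt_iff₀ (by positivity)]
          rw [pow_succ, pow_succ] at h1
          nlinarith
        have h3 : ⌊n * (b ^ (i : ℕ) / b ^ (j : ℕ))⌋ < (l : ℤ) :=
          Int.floor_lt.2 (by exact_mod_cast h2)
        exact_mod_cast Int.add_one_le_iff.2 h3
      have : Real.logb b (min b y') ≤ Real.logb b (latticePoint b j N l) :=
        Real.logb_le_logb_of_le hb hmin0 ((min_le_right _ _).trans hle)
      linarith
    · have h1 : (1 : ℝ) ≤ k := by exact_mod_cast hk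
      linarith [hm.1]

/-- Up to the single point `eta = 0`, a sum over the distinct values of `eta` is a sum over the
lattice points in `[1, b)`. -/
theorem abs_sum_image_eta_sub_le {b : ℝ} (hb : 1 < b) {m r : ℕ} (hr : 0 < r) (hbr : b ^ r = m)
    (hrel : ∀ l : Fin r → ℤ, ∑ j, (l j : ℝ) * b ^ (j : ℕ) = 0 → l = 0) {N : ℕ} (hN : 0 < N)
    (h : ℝ → ℝ) {C : ℝ} (hC : |h 0| ≤ C) :
    |∑ w ∈ (Finset.Icc 1 N).image (eta b N), h w -
      ∑ i : Fin r, ∑ n ∈ latticeWindow b i N, h (Real.logb b (latticePoint b i N n))| ≤ C := by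
  set D := (Finset.Icc 1 N).image (eta b N) with hD
  let T : Finset (Σ _ : Fin r, ℕ) := Finset.univ.sigma fun i => latticeWindow b i N
  let p : (Σ _ : Fin r, ℕ) → ℝ := fun x => Real.logb b (latticePoint b x.1 N x.2)
  have hsum : ∑ i : Fin r, ∑ n ∈ latticeWindow b i N, h (Real.logb b (latticePoint b i N n)) =
      ∑ w ∈ T.image p, h w := by
    rw [Finset.sum_image, Finset.sum_sigma]
    rintro ⟨i, n⟩ hx ⟨j, n'⟩ hx' e
    have hx1 : n ∈ latticeWindow b i N := (Finset.mem_sigma.1 hx).2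
    have hx2 : n' ∈ latticeWindow b j N := (Finset.mem_sigma.1 hx').2
    have e' : latticePoint b i N n = latticePoint b j N n' := Real.logb_injOn_pos hb
      (by have := (latticePoint_mem hx1).1; exact mem_Ioi.2 (by linarith))
      (by have := (latticePoint_mem hx2).1; exact mem_Ioi.2 (by linarith)) e
    obtain ⟨rfl, rfl⟩ := latticePoint_injective hrel hb hN
      (Finset.mem_Icc.1 (Finset.mem_filter.1 hx1).1).1 e'
    rfl
  have hsub : T.image p ⊆ D := by
    intro w hw
    obtain ⟨⟨i, n⟩, hx, rfl⟩ := Finset.mem_image.1 hw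
    have hx1 : n ∈ latticeWindow b i N := (Finset.mem_sigma.1 hx).2
    exact Finset.mem_image.2 ⟨n, (Finset.mem_filter.1 hx1).1, eta_eq_logb_latticePoint hb hx1⟩
  have hdiff : D \ T.image p ⊆ {0} := by
    intro w hw
    obtain ⟨h1, h2⟩ := Finset.mem_sdiff.1 hw
    obtain ⟨n, hn, rfl⟩ := Finset.mem_image.1 h1
    rw [Finset.mem_singleton]
    by_contra h0
    obtain ⟨i, n', hn', e⟩ := exists_latticePoint_eq hb hr hbr hn h0
    exact h2 (Finset.mem_image.2 ⟨⟨i, n'⟩, Finset.mem_sigma.2 ⟨Finset.mem_univ _, hn'⟩, e.symm⟩)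
  rw [hsum, ← Finset.sum_sdiff hsub, add_sub_cancel_right]
  rcases Finset.subset_singleton_iff.1 hdiff with h0 | h0 <;> rw [h0]
  · simpa using (abs_nonneg _).trans hC
  · simpa using hC

/-! ### The distribution of the points `b ^ eta` -/

/-- Right-endpoint Riemann sums converge for bounded, almost everywhere continuous functions: the
sum is the integral of `g (⌈t N⌉ / N)`, and dominated convergence applies. -/
theorem tendsto_riemannSum {g : ℝ → ℝ} (hg : Measurable g) {C : ℝ} (hC : ∀ t, |g t| ≤ C)
    (hcont : ∀ᵐ t, t ∈ Ioo (0 : ℝ) 1 → ContinuousAt g t) :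
    Tendsto (fun N : ℕ => (N : ℝ)⁻¹ * ∑ n ∈ Finset.Icc 1 N, g (n / N)) atTop
      (𝓝 (∫ t in (0 : ℝ)..1, g t)) := by
  have hstep : ∀ N : ℕ, 0 < N → (N : ℝ)⁻¹ * ∑ n ∈ Finset.Icc 1 N, g (n / N) =
      ∫ t in (0 : ℝ)..1, g (⌈t * N⌉₊ / N) := by
    intro N hN
    have hN' : (0 : ℝ) < N := by exact_mod_cast hN
    have hle : ∀ k : ℕ, (k : ℝ) / N ≤ ((k + 1 : ℕ) : ℝ) / N := fun k => by gcongr; simp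
    have hval : ∀ k : ℕ, ∀ t ∈ Ioc ((k : ℝ) / N) (((k + 1 : ℕ) : ℝ) / N),
        g (⌈t * N⌉₊ / N) = g (((k + 1 : ℕ) : ℝ) / N) := by
      intro k t ht
      have : ⌈t * N⌉₊ = k + 1 := by
        rw [Nat.ceil_eq_iff (by omega)]
        exact ⟨by simpa using (div_lt_iff₀ hN').1 ht.1, (le_div_iff₀ hN').1 ht.2⟩
      rw [this]
    have hint : ∀ k < N, IntervalIntegrable (fun t => g (⌈t * N⌉₊ / N)) volume
        ((k : ℝ) / N) (((k + 1 : ℕ) : ℝ) / N) := fun k _ => by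
      rw [intervalIntegrable_iff_integrableOn_Ioc_of_le (hle k)]
      exact (integrableOn_const (C := g (((k + 1 : ℕ) : ℝ) / N)) (by simp)).congr_fun
        (fun t ht => (hval k t ht).symm) measurableSet_Ioc
    have hsum := intervalIntegral.sum_integral_adjacent_intervals
      (a := fun k : ℕ => (k : ℝ) / N) hint
    simp only [Nat.cast_zero, zero_div, div_self hN'.ne'] at hsum
    rw [← hsum, Finset.mul_sum, ← Finset.Ico_add_one_right_eq_Icc, Finset.sum_Ico_eq_sum_range]
    refine Finset.sum_congr (by simp) fun k _ => ?_
    rw [intervalIntegral.integral_of_le (hle k), setIntegral_congr_fun measurableSet_Ioc (hval k),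
      ← intervalIntegral.integral_of_le (hle k), intervalIntegral.integral_const, smul_eq_mul,
      add_comm 1 k]
    congr 1
    push_cast
    field_simp
    ring
  have hlim : Tendsto (fun N : ℕ => ∫ t in (0 : ℝ)..1, g (⌈t * N⌉₊ / N)) atTop
      (𝓝 (∫ t in (0 : ℝ)..1, g t)) := by
    refine intervalIntegral.tendsto_integral_filter_of_dominated_convergence (fun _ => C)
      (.of_forall fun N => ?_) (.of_forall fun N => .of_forall fun t _ => hC _) (by simp) ?_
    · refine (hg.comp ?_).aestronglyMeasurable
      exact ((measurable_from_top (f := fun n : ℕ => (n : ℝ))).comp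
        (Nat.measurable_ceil.comp (measurable_id.mul_const _))).div_const _
    · have h1 : ∀ᵐ t : ℝ, t ≠ 1 := by simp [ae_iff]
      filter_upwards [hcont, h1] with t ht ht1 hmem
      rw [uIoc_of_le zero_le_one] at hmem
      have hc := ht ⟨hmem.1, lt_of_le_of_ne hmem.2 ht1⟩
      exact hc.tendsto.comp
        ((tendsto_nat_ceil_mul_div_atTop hmem.1.le).comp tendsto_natCast_atTop_atTop)
  refine hlim.congr' ?_
  filter_upwards [eventually_gt_atTop 0] with N hN
  exact (hstep N hN).symm

/-- The points `b ^ eta` become uniformly distributed on `[1, b]`. The sum is a Riemann sum of a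
function of `n / N` that is invariant under `t ↦ t / b`. -/
theorem tendsto_average_rpow_eta {b : ℝ} (hb : 1 < b) {f : ℝ → ℝ} (hf : Continuous f) {C : ℝ}
    (hC : ∀ y, |f y| ≤ C) :
    Tendsto (fun N : ℕ => (N : ℝ)⁻¹ * ∑ n ∈ Finset.Icc 1 N, f (b ^ eta b N n)) atTop
      (𝓝 ((b - 1)⁻¹ * ∫ y in (1 : ℝ)..b, f y)) := by
  have hb0 : 0 < b := by linarith
  let g : ℝ → ℝ := fun t => f (b ^ Int.fract (Real.logb b t))
  have hgm : Measurable g := by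
    refine hf.measurable.comp ((Real.continuous_const_rpow hb0.ne').measurable.comp ?_)
    exact measurable_fract.comp (Real.measurable_log.div_const _)
  have hgc : ∀ᵐ t, t ∈ Ioo (0 : ℝ) 1 → ContinuousAt g t := by
    have hcount : (range fun k : ℤ => b ^ (k : ℝ)).Countable := countable_range _
    have h0 := measure_eq_zero_iff_ae_notMem.1 (hcount.measure_zero volume)
    filter_upwards [h0] with t ht hmem
    have hfr : Real.logb b t ≠ ⌊Real.logb b t⌋ := fun h => by
      refine ht ⟨⌊Real.logb b t⌋, ?_⟩
      dsimp only
      rw [← h, Real.rpow_logb hb0 hb.ne' hmem.1]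
    have h1 : ContinuousAt (fun t => Int.fract (Real.logb b t)) t :=
      ContinuousAt.comp (f := Real.logb b) (continuousAt_fract hfr)
        ((Real.continuousAt_log hmem.1.ne').div_const _)
    exact hf.continuousAt.comp ((Real.continuous_const_rpow hb0.ne').continuousAt.comp h1)
  have hgi : ∀ u v : ℝ, IntervalIntegrable g volume u v := fun u v => by
    rw [intervalIntegrable_iff]
    have : IsFiniteMeasure (volume.restrict (uIoc u v)) := by unfold uIoc; infer_instance
    exact Integrable.of_bound hgm.aestronglyMeasurable C (.of_forall fun t => hC _)
  have hself : ∀ s ∈ Ioc (0 : ℝ) b, g (b⁻¹ * s) = g s := fun s hs => by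
    have : Real.logb b (b⁻¹ * s) = Real.logb b s - 1 := by
      rw [Real.logb_mul (by positivity) hs.1.ne', Real.logb_inv, Real.logb_self_eq_one hb]; ring
    simp only [g, this, Int.fract_sub_one]
  have hval : ∀ᵐ s, s ∈ uIoc 1 b → g s = f s := by
    have h1 : ∀ᵐ t : ℝ, t ≠ b := by simp [ae_iff]
    filter_upwards [h1] with s hsb hs
    rw [uIoc_of_le hb.le] at hs
    have hs0 : 0 < s := by linarith [hs.1]
    have : Int.fract (Real.logb b s) = Real.logb b s := Int.fract_eq_self.2
      ⟨Real.logb_nonneg hb hs.1.le, by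
        rw [Real.logb_lt_iff_lt_rpow hb hs0, Real.rpow_one]; exact lt_of_le_of_ne hs.2 hsb⟩
    simp only [g, this, Real.rpow_logb hb0 hb.ne' hs0]
  have hscale : ∫ t in (0 : ℝ)..1, g t = b⁻¹ * ∫ s in (0 : ℝ)..b, g s := by
    have h := intervalIntegral.integral_comp_mul_left (a := 0) (b := b) g (inv_ne_zero hb0.ne')
    rw [mul_zero, inv_mul_cancel₀ hb0.ne', inv_inv, smul_eq_mul] at h
    have h2 : ∫ s in (0 : ℝ)..b, g (b⁻¹ * s) = ∫ s in (0 : ℝ)..b, g s := by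
      rw [intervalIntegral.integral_of_le hb0.le, intervalIntegral.integral_of_le hb0.le]
      exact setIntegral_congr_fun measurableSet_Ioc hself
    rw [← h2, h]
    field_simp
  have hsplit := intervalIntegral.integral_add_adjacent_intervals (hgi 0 1) (hgi 1 b)
  rw [intervalIntegral.integral_congr_ae hval] at hsplit
  have hI : ∫ t in (0 : ℝ)..1, g t = (b - 1)⁻¹ * ∫ y in (1 : ℝ)..b, f y := by
    have hb1 : b - 1 ≠ 0 := by linarith
    rw [← hsplit] at hscale
    field_simp at hscale ⊢
    linarith
  rw [← hI]
  exact tendsto_riemannSum hgm (fun t => hC _) hgc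

/-! ### Joint equidistribution of points and gaps -/

theorem integral_cube_position_gapFun {b : ℝ} (hb : 1 < b) {r : ℕ} (i : Fin r) {H : ℝ × ℝ → ℝ}
    (hH : Continuous H) {C : ℝ} (hC : ∀ z, |H z| ≤ C) :
    ∫ t, (if b ^ ((i : ℕ) + 1) * t i ∈ Ico 1 b then
        H (b ^ ((i : ℕ) + 1) * t i, gapFun b i t) else 0) ∂cubeMeasure r =
      (b ^ ((i : ℕ) + 1))⁻¹ * ∫ y in (1 : ℝ)..b, ∫ s, H (y, s) ∂latticeGapLaw b i := by
  have hb0 : 0 < b := by linarith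
  set B := b ^ ((i : ℕ) + 1) with hB
  have hB0 : 0 < B := by positivity
  have hbB : b ≤ B := le_self_pow₀ hb.le (by omega)
  let Ψ : ℝ × ℝ → ℝ := fun p => if B * p.1 ∈ Ico 1 b then H (B * p.1, p.2) else 0
  have hset : MeasurableSet {p : ℝ × ℝ | B * p.1 ∈ Ico 1 b} :=
    (measurable_const.mul measurable_fst) measurableSet_Ico
  have hΨm : Measurable Ψ := Measurable.ite hset
    ((hH.comp (by fun_prop : Continuous fun p : ℝ × ℝ => (B * p.1, p.2))).measurable)
    measurable_const
  have hC0 : 0 ≤ C := (abs_nonneg _).trans (hC 0)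
  have hΨC : ∀ p, ‖Ψ p‖ ≤ C := fun p => by
    simp only [Ψ]; split_ifs
    · exact hC _
    · simpa using hC0
  have hm : Measurable fun t : Fin r → ℝ => (t i, gapFun b i t) :=
    (measurable_pi_apply i).prodMk (continuous_gapFun b i).measurable
  have h1 : ∫ t, Ψ (t i, gapFun b i t) ∂cubeMeasure r =
      ∫ x in Ico (0 : ℝ) 1, ∫ s, Ψ (x, s) ∂latticeGapLaw b i := by
    rw [← integral_map hm.aemeasurable hΨm.aestronglyMeasurable (f := Ψ),
      map_position_gapFun hb0 i]
    exact integral_prod Ψ (Integrable.of_bound hΨm.aestronglyMeasurable C (.of_forall hΨC))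
  refine h1.trans ?_
  have hsub : Ico (1 / B) (b / B) ⊆ Ico 0 1 :=
    Ico_subset_Ico (by positivity) ((div_le_one hB0).2 hbB)
  have h2 : ∀ x, ∫ s, Ψ (x, s) ∂latticeGapLaw b i = (Ico (1 / B) (b / B)).indicator
      (fun x => ∫ s, H (B * x, s) ∂latticeGapLaw b i) x := fun x => by
    have : B * x ∈ Ico 1 b ↔ x ∈ Ico (1 / B) (b / B) := by
      rw [mem_Ico, mem_Ico, div_le_iff₀' hB0, lt_div_iff₀' hB0]
    by_cases hx : B * x ∈ Ico 1 b
    · rw [indicator_of_mem (this.1 hx)]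
      simp only [Ψ, if_pos hx]
    · rw [indicator_of_notMem (fun h => hx (this.2 h))]
      simp only [Ψ, if_neg hx, integral_zero]
  simp_rw [h2]
  rw [setIntegral_indicator measurableSet_Ico, inter_eq_self_of_subset_right hsub,
    integral_Ico_eq_integral_Ioc, ← intervalIntegral.integral_of_le (by gcongr),
    intervalIntegral.integral_comp_mul_left (fun y => ∫ s, H (y, s) ∂latticeGapLaw b i) hB0.ne',
    smul_eq_mul]
  congr 2 <;> field_simp

/-- The points of one lattice together with their subsequent gaps. -/
theorem tendsto_average_latticeWindow {b : ℝ} (hb : 1 < b) {r : ℕ}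
    (hrel : ∀ l : Fin r → ℤ, ∑ j, (l j : ℝ) * b ^ (j : ℕ) = 0 → l = 0) (i : Fin r)
    {H : ℝ × ℝ → ℝ} (hH : Continuous H) {C : ℝ} (hC : ∀ z, |H z| ≤ C) :
    Tendsto (fun N : ℕ => (N : ℝ)⁻¹ *
        ∑ n ∈ latticeWindow b i N, H (latticePoint b i N n, latticeGap b i N n)) atTop
      (𝓝 ((b ^ ((i : ℕ) + 1))⁻¹ * ∫ y in (1 : ℝ)..b, ∫ s, H (y, s) ∂latticeGapLaw b i)) := by
  have hb0 : 0 < b := by linarith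
  rw [← integral_cube_position_gapFun hb i hH hC]
  set B := b ^ ((i : ℕ) + 1) with hB
  have hB0 : 0 < B := by positivity
  let Φ : (Fin r → ℝ) → ℝ := fun t => if B * t i ∈ Ico 1 b then H (B * t i, gapFun b i t) else 0
  have hHc : Continuous fun t : Fin r → ℝ => H (B * t i, gapFun b i t) :=
    hH.comp ((continuous_const.mul (continuous_apply i)).prodMk (continuous_gapFun b i))
  have hΦm : Measurable Φ := Measurable.ite
    ((measurable_const.mul (measurable_pi_apply i)) measurableSet_Ico) hHc.measurable
    measurable_const
  have hC0 : 0 ≤ C := (abs_nonneg _).trans (hC 0)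
  have hΦC : ∀ t, |Φ t| ≤ C := fun t => by
    simp only [Φ]; split_ifs
    · exact hC _
    · simpa using hC0
  have h := tendsto_average_cube hb0 hrel i {1 / B, b / B} (Φ := Φ) (fun t _ hS => by
    simp only [Finset.mem_insert, Finset.mem_singleton, not_or] at hS
    have hS1 : B * t i ≠ 1 := fun h => hS.1 (by rw [← h]; field_simp)
    have hS2 : B * t i ≠ b := fun h => hS.2 (by rw [← h]; field_simp)
    have hc : Continuous fun t : Fin r → ℝ => B * t i := continuous_const.mul (continuous_apply i)
    by_cases hmem : B * t i ∈ Ico 1 b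
    · refine hHc.continuousAt.congr ?_
      have hopen : B * t i ∈ Ioo 1 b := ⟨lt_of_le_of_ne hmem.1 hS1.symm, hmem.2⟩
      filter_upwards [hc.continuousAt.preimage_mem_nhds (isOpen_Ioo.mem_nhds hopen)] with t' ht'
      exact (if_pos ⟨(show 1 < B * t' i from ht'.1).le, ht'.2⟩).symm
    · refine continuousAt_const.congr (f := fun _ => (0 : ℝ)) ?_
      have hopen : B * t i ∈ (Icc 1 b)ᶜ := fun h =>
        hmem ⟨h.1, lt_of_le_of_ne h.2 hS2⟩
      filter_upwards [hc.continuousAt.preimage_mem_nhds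
        (isClosed_Icc.isOpen_compl.mem_nhds hopen)] with t' ht'
      exact (if_neg fun h' => ht' (Ico_subset_Icc_self h')).symm) hΦm hΦC
  refine h.congr' ?_
  filter_upwards [eventually_gt_atTop 0] with N hN
  have hN' : (0 : ℝ) < N := by exact_mod_cast hN
  congr 1
  rw [latticeWindow, Finset.sum_filter]
  refine Finset.sum_congr rfl fun n hn => ?_
  rw [Finset.mem_Icc] at hn
  have hpos : Int.fract ((n : ℝ) * rotation b i N i) = if n = N then 0 else (n : ℝ) / N := by
    rw [rotation, if_pos rfl, ← div_eq_mul_inv]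
    split_ifs with h
    · rw [h, div_self hN'.ne', Int.fract_one]
    · refine Int.fract_eq_self.2 ⟨by positivity, (div_lt_one hN').2 ?_⟩
      exact_mod_cast lt_of_le_of_ne hn.2 h
  simp only [Φ, hpos]
  by_cases h : n = N
  · -- the point `n = N` is never counted, as `b ≤ b ^ (i + 1)`
    have h1 : ¬ (B * 0 ∈ Ico 1 b) := by simp
    have h2 : ¬ ((N : ℝ) ≤ b ^ ((i : ℕ) + 1) * n ∧ b ^ ((i : ℕ) + 1) * n < b * N) := by
      rw [h]
      rintro ⟨-, h3⟩
      have : b * N ≤ b ^ ((i : ℕ) + 1) * N :=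
        mul_le_mul_of_nonneg_right (le_self_pow₀ hb.le (by omega)) hN'.le
      linarith
    rw [if_pos h, if_neg h1, if_neg h2]
  · have e : B * ((n : ℝ) / N) = latticePoint b i N n := by rw [latticePoint, mul_div_assoc]
    have hiff : latticePoint b i N n ∈ Ico 1 b ↔
        ((N : ℝ) ≤ b ^ ((i : ℕ) + 1) * n ∧ b ^ ((i : ℕ) + 1) * n < b * N) := by
      rw [latticePoint, mem_Ico, one_le_div hN', div_lt_iff₀ hN']
    simp only [if_neg h, e, hiff]
    rfl

/-- The total mass of `R`, from the fact that each lattice gap law is a probability measure. -/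
theorem R_univ_eq {b : ℝ} (hb : 1 < b) {r : ℕ} (hr : 0 < r) :
    b⁻¹ * (R b r).real univ = (1 - (b ^ r)⁻¹) / (b - 1) := by
  have hb1 : b - 1 ≠ 0 := by linarith
  have h := congrArg (fun μ : Measure ℝ => μ univ) (sum_latticeGapLaw hb hr)
  simp only [Measure.finsetSum_apply, Measure.smul_apply, measure_univ, smul_eq_mul, mul_one] at h
  rw [Measure.map_apply (measurable_const_mul b) MeasurableSet.univ, preimage_univ,
    ← ENNReal.ofReal_sum_of_nonneg fun i _ => by positivity] at h
  have h2 := congrArg ENNReal.toReal h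
  rw [ENNReal.toReal_ofReal (Finset.sum_nonneg fun i _ => by positivity), ENNReal.toReal_mul,
    ENNReal.toReal_ofReal (by positivity)] at h2
  rw [Measure.real, ← h2, Finset.sum_fin_eq_sum_range]
  have hgeom : ∀ r : ℕ, ∑ i ∈ Finset.range r, (b ^ (i + 1))⁻¹ = (1 - (b ^ r)⁻¹) / (b - 1) := by
    intro r
    induction r with
    | zero => simp
    | succ r ih =>
      rw [Finset.sum_range_succ, ih, pow_succ]
      field_simp
      ring
  rw [← hgeom]
  exact Finset.sum_congr rfl fun i hi => by rw [dif_pos (Finset.mem_range.1 hi)]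

theorem continuous_integral_of_bounded {μ : Measure ℝ} [IsFiniteMeasure μ] {H : ℝ × ℝ → ℝ}
    (hH : Continuous H) {C : ℝ} (hC : ∀ z, |H z| ≤ C) : Continuous fun y => ∫ s, H (y, s) ∂μ :=
  continuous_of_dominated (bound := fun _ => C)
    (fun _ => (hH.comp (by fun_prop)).aestronglyMeasurable) (fun _ => .of_forall fun _ => hC _)
    (integrable_const C) (.of_forall fun _ => hH.comp (by fun_prop))

theorem integrable_section {μ : Measure ℝ} [IsFiniteMeasure μ] {H : ℝ × ℝ → ℝ}
    (hH : Continuous H) {C : ℝ} (hC : ∀ z, |H z| ≤ C) (y : ℝ) : Integrable (fun s => H (y, s)) μ :=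
  Integrable.of_bound (hH.comp (by fun_prop)).aestronglyMeasurable C (.of_forall fun _ => hC _)

theorem sum_integral_latticeGapLaw {b : ℝ} (hb : 1 < b) {r : ℕ} (hr : 0 < r) {H : ℝ × ℝ → ℝ}
    (hH : Continuous H) {C : ℝ} (hC : ∀ z, |H z| ≤ C) :
    ∑ i : Fin r, (b ^ ((i : ℕ) + 1))⁻¹ * ∫ y in (1 : ℝ)..b, ∫ s, H (y, s) ∂latticeGapLaw b i =
      b⁻¹ * ∫ y in (1 : ℝ)..b, ∫ t, H (y, b * t) ∂(R b r) := by
  simp_rw [← intervalIntegral.integral_const_mul]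
  rw [← intervalIntegral.integral_finsetSum fun i _ =>
    ((continuous_integral_of_bounded hH hC).const_mul _).intervalIntegrable _ _]
  refine intervalIntegral.integral_congr fun y _ => ?_
  have hm : Measurable fun t : ℝ => b * t := measurable_const_mul b
  have h := congrArg (fun μ : Measure ℝ => ∫ s, H (y, s) ∂μ) (sum_latticeGapLaw hb hr)
  have hcont : Continuous fun s => H (y, s) := hH.comp (by fun_prop)
  simp only [integral_smul_measure] at h
  rw [integral_finsetSum_measure fun i _ => (integrable_section hH hC y).smul_measure
    ENNReal.ofReal_ne_top, integral_map hm.aemeasurable hcont.aestronglyMeasurable,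
    ENNReal.toReal_ofReal (by positivity)] at h
  simp only [integral_smul_measure] at h
  refine Eq.trans (Finset.sum_congr rfl fun i _ => ?_) h
  rw [ENNReal.toReal_ofReal (by positivity), smul_eq_mul]

/-- At most one point of each lattice lies so close to `b` that its successor is cut off there. -/
theorem card_latticeWindow_near_end {b : ℝ} (hb : 1 < b) (i N : ℕ) :
    ((latticeWindow b i N).filter fun n => N * (b - latticePoint b i N n) < b).card ≤ 1 := by
  have hb0 : 0 < b := by linarith
  have hp : 1 ≤ b ^ i := one_le_pow₀ hb.le
  have key : ∀ n ∈ (latticeWindow b i N).filter fun n => N * (b - latticePoint b i N n) < b,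
      (N : ℝ) - 1 < b ^ i * n ∧ b ^ i * n < N := by
    intro n hn
    obtain ⟨h1, h2⟩ := Finset.mem_filter.1 hn
    obtain ⟨h3, -, h4⟩ := Finset.mem_filter.1 h1
    rw [Finset.mem_Icc] at h3
    have hN : (0 : ℝ) < N := by exact_mod_cast (by omega : 0 < N)
    have h5 : N * (b - latticePoint b i N n) = b * (N - b ^ i * n) := by
      rw [latticePoint]; field_simp; ring
    rw [h5] at h2
    rw [pow_succ', mul_assoc] at h4
    have h6 := lt_of_mul_lt_mul_left h4 hb0.le
    have h7 : b * (N - b ^ i * n) < b * 1 := by rwa [mul_one]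
    have h8 := lt_of_mul_lt_mul_left h7 hb0.le
    exact ⟨by linarith, h6⟩
  rw [Finset.card_le_one]
  have aux : ∀ n n' : ℕ, (N : ℝ) - 1 < b ^ i * n → b ^ i * n' < N → ¬ n < n' := by
    intro n n' h1 h2 hlt
    have h3 : (n : ℝ) + 1 ≤ n' := by exact_mod_cast hlt
    nlinarith
  intro n hn n' hn'
  obtain ⟨a1, a2⟩ := key n hn
  obtain ⟨a3, a4⟩ := key n' hn'
  have := aux n n' a1 a4
  have := aux n' n a3 a2
  omega

theorem one_le_rpow_eta {b : ℝ} (hb : 1 < b) (N n : ℕ) : b ^ eta b N n ∈ Icc 1 b := by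
  have h := eta_mem b N n
  refine ⟨Real.one_le_rpow hb.le h.1, ?_⟩
  calc b ^ eta b N n ≤ b ^ (1 : ℝ) := Real.rpow_le_rpow_of_exponent_le hb.le h.2.le
    _ = b := Real.rpow_one b

/-- The contribution of the points of all lattices, minus the same points with gap `0`, together
with all `N` points counted with gap `0`. -/
theorem tendsto_average_lattices {b : ℝ} (hb : 1 < b) {r : ℕ} (hr : 0 < r)
    (hrel : ∀ l : Fin r → ℤ, ∑ j, (l j : ℝ) * b ^ (j : ℕ) = 0 → l = 0)
    {H : ℝ × ℝ → ℝ} (hH : Continuous H) {C : ℝ} (hC : ∀ z, |H z| ≤ C) :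
    Tendsto (fun N : ℕ => (N : ℝ)⁻¹ * (∑ n ∈ Finset.Icc 1 N, H (b ^ eta b N n, 0) +
        ∑ i : Fin r, ∑ n ∈ latticeWindow b i N,
          (H (latticePoint b i N n, latticeGap b i N n) - H (latticePoint b i N n, 0)))) atTop
      (𝓝 ((b ^ r)⁻¹ / (b - 1) * (∫ y in (1 : ℝ)..b, H (y, 0)) +
        b⁻¹ * ∫ y in (1 : ℝ)..b, ∫ t, H (y, b * t) ∂(R b r))) := by
  have := isFiniteMeasure_R hb hr
  let H' : ℝ × ℝ → ℝ := fun p => H p - H (p.1, 0)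
  have hH' : Continuous H' := hH.sub (hH.comp (by fun_prop))
  have hC' : ∀ z, |H' z| ≤ C + C := fun z => (abs_sub _ _).trans (add_le_add (hC _) (hC _))
  have h1 := tendsto_average_rpow_eta hb (f := fun y => H (y, 0)) (hH.comp (by fun_prop))
    (fun y => hC _)
  have h2 := tendsto_finsetSum Finset.univ fun (i : Fin r) _ =>
    tendsto_average_latticeWindow hb hrel i hH' hC'
  rw [sum_integral_latticeGapLaw hb hr hH' hC'] at h2
  have hlim := h1.add h2
  have hval : (b - 1)⁻¹ * (∫ y in (1 : ℝ)..b, H (y, 0)) +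
      b⁻¹ * ∫ y in (1 : ℝ)..b, ∫ t, H' (y, b * t) ∂(R b r) =
      (b ^ r)⁻¹ / (b - 1) * (∫ y in (1 : ℝ)..b, H (y, 0)) +
        b⁻¹ * ∫ y in (1 : ℝ)..b, ∫ t, H (y, b * t) ∂(R b r) := by
    have hHb : Continuous fun p : ℝ × ℝ => H (p.1, b * p.2) := hH.comp (by fun_prop)
    have hHbC : ∀ z : ℝ × ℝ, |H (z.1, b * z.2)| ≤ C := fun z => hC _
    have e : ∀ y, ∫ t, H' (y, b * t) ∂(R b r) =
        (∫ t, H (y, b * t) ∂(R b r)) - (R b r).real univ * H (y, 0) := fun y => by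
      simp only [H']
      rw [integral_sub (integrable_section hHb hHbC y) (integrable_const _), integral_const,
        smul_eq_mul]
    simp_rw [e]
    rw [intervalIntegral.integral_sub (f := fun y => ∫ t, H (y, b * t) ∂(R b r))
      (g := fun y => (R b r).real univ * H (y, 0))
      ((continuous_integral_of_bounded hHb hHbC).intervalIntegrable _ _)
      (((hH.comp (by fun_prop : Continuous fun y : ℝ => (y, (0 : ℝ)))).const_mul
        _).intervalIntegrable _ _)]
    have e2 : ∫ y in (1 : ℝ)..b, (R b r).real univ * H (y, 0) =
      (R b r).real univ * ∫ y in (1 : ℝ)..b, H (y, 0) := intervalIntegral.integral_const_mul _ _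
    rw [e2, mul_sub, ← mul_assoc, R_univ_eq hb hr]
    field_simp
    ring
  rw [hval] at hlim
  refine hlim.congr fun N => ?_
  rw [mul_add, Finset.mul_sum (s := (Finset.univ : Finset (Fin r)))]

/-- The joint law of points and gaps, in the coordinate `y = b ^ eta`, tested against a convergent
sequence of functions. -/
theorem tendsto_average_ordered {b : ℝ} (hb : 1 < b) {m r : ℕ} (hr : 0 < r) (hbr : b ^ r = m)
    (hrel : ∀ l : Fin r → ℤ, ∑ j, (l j : ℝ) * b ^ (j : ℕ) = 0 → l = 0)
    {H : ℝ × ℝ → ℝ} (hH : Continuous H) {C : ℝ} (hC : ∀ z, |H z| ≤ C)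
    {HN : ℕ → ℝ × ℝ → ℝ} (hCN : ∀ N z, |HN N z| ≤ C)
    (hconv : ∀ ε > 0, ∀ᶠ N in atTop, ∀ y ∈ Icc 1 b, ∀ s ∈ Icc 0 b,
      |HN N (y, s) - H (y, s)| ≤ ε) :
    Tendsto (fun N : ℕ => (N : ℝ)⁻¹ * ∑ k ∈ Finset.range N,
        HN N (b ^ ordered (eta b N) N k,
          N * (b ^ ordered (eta b N) N (k + 1) - b ^ ordered (eta b N) N k))) atTop
      (𝓝 ((b ^ r)⁻¹ / (b - 1) * (∫ y in (1 : ℝ)..b, H (y, 0)) +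
        b⁻¹ * ∫ y in (1 : ℝ)..b, ∫ t, H (y, b * t) ∂(R b r))) := by
  have hb0 : 0 < b := by linarith
  have hC0 : 0 ≤ C := (abs_nonneg _).trans (hC 0)
  have hlim := tendsto_average_lattices hb hr hrel hH hC
  set ℓ := (b ^ r)⁻¹ / (b - 1) * (∫ y in (1 : ℝ)..b, H (y, 0)) +
        b⁻¹ * ∫ y in (1 : ℝ)..b, ∫ t, H (y, b * t) ∂(R b r) with hℓ
  have hdiff : ∀ ε > 0, ∀ᶠ N : ℕ in atTop,
      |((N : ℝ)⁻¹ * ∑ k ∈ Finset.range N,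
        HN N (b ^ ordered (eta b N) N k,
          N * (b ^ ordered (eta b N) N (k + 1) - b ^ ordered (eta b N) N k))) -
      (N : ℝ)⁻¹ * (∑ n ∈ Finset.Icc 1 N, H (b ^ eta b N n, 0) +
        ∑ i : Fin r, ∑ n ∈ latticeWindow b i N,
          (H (latticePoint b i N n, latticeGap b i N n) - H (latticePoint b i N n, 0)))| ≤
      (1 + 2 * r) * ε + (r + 1) * (2 * C) * (N : ℝ)⁻¹ := by
    intro ε hε
    filter_upwards [eventually_gt_atTop 0, hconv ε hε] with N hN hNε
    have hN' : (0 : ℝ) < N := by exact_mod_cast hN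
    have hsum := sum_ordered hN (eta_mem b N)
      fun w s => HN N (b ^ w, N * (b ^ (w + s) - b ^ w))
    simp only [add_sub_cancel, add_zero, sub_self, mul_zero] at hsum
    rw [hsum, ← mul_sub, abs_mul, abs_of_pos (inv_pos.2 hN')]
    set h : ℝ → ℝ := fun w =>
      HN N (b ^ w, N * (b ^ (w + circGap (eta b N) N w) - b ^ w)) - HN N (b ^ w, 0) with hh
    have e1 : |∑ n ∈ Finset.Icc 1 N, HN N (b ^ eta b N n, 0) -
        ∑ n ∈ Finset.Icc 1 N, H (b ^ eta b N n, 0)| ≤ N * ε := by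
      rw [← Finset.sum_sub_distrib]
      refine (Finset.abs_sum_le_sum_abs _ _).trans ?_
      refine (Finset.sum_le_card_nsmul _ _ ε fun n _ =>
        hNε _ (one_le_rpow_eta hb N n) 0 ⟨le_rfl, hb0.le⟩).trans ?_
      simp
    have h0 : |h 0| ≤ 2 * C := by
      have h1 := hCN N (b ^ (0 : ℝ), 0)
      have h2 := hCN N (b ^ (0 : ℝ), N * (b ^ ((0 : ℝ) + circGap (eta b N) N 0) - b ^ (0 : ℝ)))
      exact (abs_sub _ _).trans (by linarith)
    have e2 := abs_sum_image_eta_sub_le hb hr hbr hrel hN h h0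
    have e3 : ∀ i : Fin r, |∑ n ∈ latticeWindow b i N, h (Real.logb b (latticePoint b i N n)) -
        ∑ n ∈ latticeWindow b i N,
          (H (latticePoint b i N n, latticeGap b i N n) - H (latticePoint b i N n, 0))| ≤
        2 * N * ε + 2 * C := by
      intro i
      rw [← Finset.sum_sub_distrib]
      refine (Finset.abs_sum_le_sum_abs _ _).trans ?_
      have hterm : ∀ n ∈ latticeWindow b i N,
          |h (Real.logb b (latticePoint b i N n)) -
            (H (latticePoint b i N n, latticeGap b i N n) - H (latticePoint b i N n, 0))| ≤
          2 * ε + if N * (b - latticePoint b i N n) < b then 2 * C else 0 := by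
        intro n hn
        have hy := latticePoint_mem hn
        set y := latticePoint b i N n with hydef
        have hy0 : 0 < y := by linarith [hy.1]
        have hyI : y ∈ Icc 1 b := Ico_subset_Icc_self hy
        have hG0 := latticeGap_pos hb0 i N n
        have hGb := latticeGap_le hb0 i N n
        simp only [hh]
        rw [rpow_circGap hb hr hbr hn, Real.rpow_logb hb0 hb.ne' hy0]
        have hzero := hNε y hyI 0 ⟨le_rfl, hb0.le⟩
        set G := latticeGap b i N n with hGdef
        split_ifs with hnear
        · have hs : N * (min b (y + G / N) - y) ∈ Icc 0 b := by
            refine ⟨mul_nonneg hN'.le (sub_nonneg.2 (le_min hy.2.le ?_)), ?_⟩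
            · have : 0 < G / N := by positivity
              linarith
            · calc N * (min b (y + G / N) - y) ≤ N * (G / N) :=
                  mul_le_mul_of_nonneg_left (by linarith [min_le_right b (y + G / N)]) hN'.le
                _ = G := by field_simp
                _ ≤ b := hGb
          have a1 := hNε y hyI _ hs
          have a2 := hC (y, N * (min b (y + G / N) - y))
          have a3 := hC (y, G)
          rw [abs_le] at *
          constructor <;> linarith [hzero.1, hzero.2, a1.1, a1.2, a2.1, a2.2, a3.1, a3.2]
        · have hle : y + G / N ≤ b := by
            have h1 : G ≤ N * (b - y) := hGb.trans (not_lt.1 hnear)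
            have h2 : G / N ≤ b - y := (div_le_iff₀' hN').2 h1
            linarith
          have hs : N * (min b (y + G / N) - y) = G := by
            rw [min_eq_right hle]; field_simp; ring
          rw [hs]
          have a1 := hNε y hyI G ⟨hG0.le, hGb⟩
          rw [abs_le] at *
          constructor <;> linarith [hzero.1, hzero.2, a1.1, a1.2]
      refine (Finset.sum_le_sum hterm).trans ?_
      rw [Finset.sum_add_distrib, ← Finset.sum_filter, Finset.sum_const, Finset.sum_const,
        nsmul_eq_mul, nsmul_eq_mul]
      have c1 : ((latticeWindow b i N).card : ℝ) ≤ N := by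
        have : (latticeWindow b i N).card ≤ N :=
          (Finset.card_filter_le _ _).trans (by simp)
        exact_mod_cast this
      have c2 : (((latticeWindow b i N).filter
          fun n => N * (b - latticePoint b i N n) < b).card : ℝ) ≤ 1 := by
        exact_mod_cast card_latticeWindow_near_end hb i N
      nlinarith
    have e4 : |∑ i : Fin r, ∑ n ∈ latticeWindow b i N, h (Real.logb b (latticePoint b i N n)) -
        ∑ i : Fin r, ∑ n ∈ latticeWindow b i N,
          (H (latticePoint b i N n, latticeGap b i N n) - H (latticePoint b i N n, 0))| ≤
        r * (2 * N * ε + 2 * C) := by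
      rw [← Finset.sum_sub_distrib]
      refine (Finset.abs_sum_le_sum_abs _ _).trans ?_
      refine (Finset.sum_le_card_nsmul _ _ _ fun i _ => e3 i).trans ?_
      rw [Finset.card_univ, Fintype.card_fin, nsmul_eq_mul]
    rw [inv_mul_le_iff₀ hN']
    have e5 : (N : ℝ) * ((1 + 2 * r) * ε + (r + 1) * (2 * C) * (N : ℝ)⁻¹) =
        N * ε + 2 * C + r * (2 * N * ε + 2 * C) := by
      field_simp; ring
    rw [e5]
    rw [abs_le] at *
    constructor <;> linarith [e1.1, e1.2, e2.1, e2.2, e4.1, e4.2]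
  have hzero : Tendsto (fun N : ℕ => (r + 1) * (2 * C) * (N : ℝ)⁻¹) atTop (𝓝 0) := by
    simpa using (tendsto_inv_atTop_nhds_zero_nat (𝕜 := ℝ)).const_mul ((r + 1) * (2 * C))
  have hd0 := tendsto_order.2 ⟨fun a ha => Eventually.of_forall fun N : ℕ =>
      ha.trans_le (abs_nonneg (((N : ℝ)⁻¹ * ∑ k ∈ Finset.range N,
        HN N (b ^ ordered (eta b N) N k,
          N * (b ^ ordered (eta b N) N (k + 1) - b ^ ordered (eta b N) N k))) -
      (N : ℝ)⁻¹ * (∑ n ∈ Finset.Icc 1 N, H (b ^ eta b N n, 0) +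
        ∑ i : Fin r, ∑ n ∈ latticeWindow b i N,
          (H (latticePoint b i N n, latticeGap b i N n) - H (latticePoint b i N n, 0))))),
    fun a (ha : 0 < a) => by
      have hK : (0 : ℝ) < 1 + 2 * r := by positivity
      filter_upwards [hdiff (a / 2 / (1 + 2 * r)) (by positivity),
        (tendsto_order.1 hzero).2 (a / 2) (by positivity)] with N h1 h2
      rw [mul_div_cancel₀ _ hK.ne'] at h1
      linarith⟩
  have := hlim.add ((tendsto_zero_iff_abs_tendsto_zero _).2 hd0)
  rw [add_zero] at this
  exact this.congr fun N => by ring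

/-! ### Test functions and integrals against the limit laws -/

theorem integral_sum_smul_dirac {X : Type*} [MeasurableSpace X] [MeasurableSingletonClass X]
    (f : X → ℝ) (x : ℕ → X) (N : ℕ) :
    ∫ z, f z ∂(∑ i ∈ Finset.range N, (N : ℝ≥0∞)⁻¹ • Measure.dirac (x i)) =
      (N : ℝ)⁻¹ * ∑ i ∈ Finset.range N, f (x i) := by
  rcases Nat.eq_zero_or_pos N with rfl | hN
  · simp
  have hN' : (N : ℝ≥0∞)⁻¹ ≠ ∞ := by simp; omega
  rw [integral_finsetSum_measure fun i _ => (integrable_dirac (by simp)).smul_measure hN',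
    Finset.mul_sum]
  refine Finset.sum_congr rfl fun i _ => ?_
  rw [integral_smul_measure, integral_dirac, smul_eq_mul]
  simp

theorem ordered_eta_mem (b : ℝ) {N i : ℕ} (hi : i < N) : ordered (eta b N) N i ∈ Ico (0 : ℝ) 1 := by
  obtain ⟨n, -, hn⟩ := exists_ordered_eq (v := eta b N) hi
  rw [hn]
  exact eta_mem b N n

theorem ordered_eta_le_succ (b : ℝ) {N i : ℕ} (hi : i < N) :
    ordered (eta b N) N i ≤ ordered (eta b N) N (i + 1) :=
  ordered_mono (eta_mem b N) (Nat.le_succ i) hi (by omega)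

/-- The extension of `f` from `[0, 1] × [0, ∞)` to the plane by the nearest-point projection. -/
def clampFun (f : ℝ × ℝ → ℝ) (p : ℝ × ℝ) : ℝ := f (max 0 (min p.1 1), max p.2 0)

theorem clampFun_eq (f : ℝ × ℝ → ℝ) {x s : ℝ} (hx : x ∈ Icc (0 : ℝ) 1) (hs : 0 ≤ s) :
    clampFun f (x, s) = f (x, s) := by
  simp only [clampFun, min_eq_left hx.2, max_eq_right hx.1, max_eq_left hs]

theorem clamp_mem (p : ℝ × ℝ) : (max 0 (min p.1 1), max p.2 0) ∈ Icc (0 : ℝ) 1 ×ˢ Ici (0 : ℝ) :=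
  ⟨⟨le_max_left _ _, max_le zero_le_one (min_le_right _ _)⟩, le_max_right p.2 0⟩

theorem continuous_clampFun {f : ℝ × ℝ → ℝ} (hf : ContinuousOn f (Icc 0 1 ×ˢ Ici 0)) :
    Continuous (clampFun f) :=
  hf.comp_continuous (f := fun p : ℝ × ℝ => (max 0 (min p.1 1), max p.2 0)) (by fun_prop) clamp_mem

/-- The form shared by the limit laws: an atom at zero and a dilate of `R`. -/
theorem integral_dirac_add_dilate_R {b : ℝ} (hb : 1 < b) {r : ℕ} (hr : 0 < r) {c₁ c₂ c : ℝ}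
    (h₁ : 0 ≤ c₁) (h₂ : 0 ≤ c₂) (hc : 0 < c) {f g : ℝ → ℝ} (hg : Continuous g) {C : ℝ}
    (hC : ∀ s, |g s| ≤ C) (hfg : ∀ s, 0 ≤ s → f s = g s) :
    ∫ s, f s ∂(ENNReal.ofReal c₁ • Measure.dirac 0 + ENNReal.ofReal c₂ • dilate c (R b r)) =
      c₁ * g 0 + c₂ * c⁻¹ * ∫ t, g (t / c) ∂(R b r) := by
  have := isFiniteMeasure_R hb hr
  have hm : Measurable fun a : ℝ => a / c := measurable_id.div_const c
  have hae1 : ∀ᵐ s ∂(R b r).map (fun a => a / c), (0 : ℝ) ≤ s := by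
    rw [ae_map_iff hm.aemeasurable measurableSet_Ici]
    filter_upwards [ae_mem_R hb hr] with t ht
    exact div_nonneg ht.1 hc.le
  have hae : ∀ᵐ s ∂(ENNReal.ofReal c₁ • Measure.dirac 0 +
      ENNReal.ofReal c₂ • dilate c (R b r)), (0 : ℝ) ≤ s := by
    rw [ae_add_measure_iff]
    refine ⟨Measure.ae_smul_measure ?_ _, Measure.ae_smul_measure
      (Measure.ae_smul_measure hae1 _) _⟩
    rw [ae_dirac_eq]
    exact le_refl (0 : ℝ)
  rw [integral_congr_ae (hae.mono fun s hs => hfg s hs), dilate, integral_add_measure,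
    integral_smul_measure, integral_smul_measure, integral_smul_measure, integral_dirac,
    integral_map hm.aemeasurable hg.aestronglyMeasurable, ENNReal.toReal_ofReal h₁,
    ENNReal.toReal_ofReal h₂, ENNReal.toReal_ofReal (inv_nonneg.2 hc.le)]
  · simp only [smul_eq_mul]; ring
  · exact (integrable_dirac (by simp)).smul_measure ENNReal.ofReal_ne_top
  · exact ((Integrable.of_bound hg.aestronglyMeasurable C
      (.of_forall hC)).smul_measure ENNReal.ofReal_ne_top).smul_measure ENNReal.ofReal_ne_top

/-! ### The rescaled points -/

theorem tendsto_PNtilde {b : ℝ} (hb : 1 < b) {m r : ℕ} (hr : 0 < r) (hbr : b ^ r = m)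
    (hrel : ∀ l : Fin r → ℤ, ∑ j, (l j : ℝ) * b ^ (j : ℕ) = 0 → l = 0)
    {f : ℝ × ℝ → ℝ} (hf : ContinuousOn f (Icc 0 1 ×ˢ Ici 0)) {C : ℝ}
    (hC : ∀ z ∈ Icc (0 : ℝ) 1 ×ˢ Ici (0 : ℝ), |f z| ≤ C) :
    Tendsto (fun N : ℕ => ∫ z, f z ∂(PNtilde b N)) atTop
      (𝓝 (∫ x in (0 : ℝ)..1, ∫ s, f (x, s) ∂(rescaledGapLaw b r))) := by
  have hb0 : 0 < b := by linarith
  have hb1 : 0 < b - 1 := by linarith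
  have := isFiniteMeasure_R hb hr
  have hF := continuous_clampFun hf
  have hFC : ∀ p, |clampFun f p| ≤ C := fun p => hC _ (clamp_mem p)
  let H : ℝ × ℝ → ℝ := fun p => clampFun f ((p.1 - 1) / (b - 1), p.2 / (b - 1))
  have hH : Continuous H := hF.comp (by fun_prop)
  have hHC : ∀ z, |H z| ≤ C := fun z => hFC _
  have h := tendsto_average_ordered hb hr hbr hrel hH hHC (HN := fun _ => H) (fun _ => hHC)
    (fun ε hε => .of_forall fun N y _ s _ => by simpa using hε.le)
  have hlimit : (b ^ r)⁻¹ / (b - 1) * (∫ y in (1 : ℝ)..b, H (y, 0)) +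
        b⁻¹ * (∫ y in (1 : ℝ)..b, ∫ t, H (y, b * t) ∂(R b r)) =
      ∫ x in (0 : ℝ)..1, ∫ s, f (x, s) ∂(rescaledGapLaw b r) := by
    have hq : 0 < 1 - b⁻¹ := sub_pos.2 (inv_lt_one_of_one_lt₀ hb)
    have hlaw : ∀ x ∈ uIcc (0 : ℝ) 1, ∫ s, f (x, s) ∂(rescaledGapLaw b r) =
        (b ^ r)⁻¹ * H (1 + (b - 1) * x, 0) +
          (1 - b⁻¹) * ∫ t, H (1 + (b - 1) * x, b * t) ∂(R b r) := by
      intro x hx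
      rw [uIcc_of_le zero_le_one] at hx
      rw [rescaledGapLaw, integral_dirac_add_dilate_R hb hr (Real.rpow_nonneg hb0.le _)
        (sq_nonneg _) hq (g := fun s => clampFun f (x, s)) (hF.comp (by fun_prop))
        (fun s => hFC _) (fun s hs => (clampFun_eq f hx hs).symm)]
      have e1 : (1 + (b - 1) * x - 1) / (b - 1) = x := by field_simp; ring
      have e2 : ∀ t : ℝ, b * t / (b - 1) = t / (1 - b⁻¹) := fun t => by
        have : 1 - b⁻¹ = (b - 1) / b := by field_simp
        rw [this]; field_simp
      simp only [H, e1, e2, zero_div, Real.rpow_neg hb0.le, Real.rpow_natCast]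
      congr 2
      field_simp
    rw [intervalIntegral.integral_congr hlaw]
    have hc1 : Continuous fun y : ℝ => H (y, 0) := hH.comp (by fun_prop)
    have hHb : Continuous fun p : ℝ × ℝ => H (p.1, b * p.2) := hH.comp (by fun_prop)
    have hc2 : Continuous fun y : ℝ => ∫ t, H (y, b * t) ∂(R b r) :=
      continuous_integral_of_bounded hHb fun z => hHC _
    have hlin : Continuous fun x : ℝ => 1 + (b - 1) * x := by fun_prop
    have hd1 : Continuous fun x : ℝ => (b ^ r)⁻¹ * H (1 + (b - 1) * x, 0) :=
      (hc1.comp hlin).const_mul _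
    have hd2 : Continuous fun x : ℝ => (1 - b⁻¹) * ∫ t, H (1 + (b - 1) * x, b * t) ∂(R b r) :=
      (hc2.comp hlin).const_mul _
    rw [intervalIntegral.integral_add (hd1.intervalIntegrable _ _) (hd2.intervalIntegrable _ _),
      intervalIntegral.integral_const_mul, intervalIntegral.integral_const_mul,
      intervalIntegral.integral_comp_add_mul (fun y => H (y, 0)) hb1.ne',
      intervalIntegral.integral_comp_add_mul (fun y => ∫ t, H (y, b * t) ∂(R b r)) hb1.ne',
      smul_eq_mul, smul_eq_mul, mul_zero, add_zero, mul_one, add_sub_cancel]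
    field_simp
  rw [hlimit] at h
  refine h.congr fun N => ?_
  rw [PNtilde, jointGapMeasure, integral_sum_smul_dirac]
  congr 1
  refine Finset.sum_congr rfl fun i hi => ?_
  have hi' := Finset.mem_range.1 hi
  have hu := ordered_eta_mem b hi'
  have hy1 : 1 ≤ b ^ ordered (eta b N) N i := Real.one_le_rpow hb.le hu.1
  have hyb : b ^ ordered (eta b N) N i ≤ b :=
    (Real.rpow_le_rpow_of_exponent_le hb.le hu.2.le).trans_eq (Real.rpow_one b)
  have hyy : b ^ ordered (eta b N) N i ≤ b ^ ordered (eta b N) N (i + 1) :=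
    Real.rpow_le_rpow_of_exponent_le hb.le (ordered_eta_le_succ b hi')
  have e : (N : ℝ) * (unif b (ordered (eta b N) N (i + 1)) - unif b (ordered (eta b N) N i)) =
      N * (b ^ ordered (eta b N) N (i + 1) - b ^ ordered (eta b N) N i) / (b - 1) := by
    rw [unif, unif]; field_simp; ring
  rw [e]
  refine clampFun_eq f ⟨div_nonneg (by linarith) hb1.le, (div_le_one hb1).2 (by linarith)⟩ ?_
  have : 0 ≤ (N : ℝ) * (b ^ ordered (eta b N) N (i + 1) - b ^ ordered (eta b N) N i) :=
    mul_nonneg (Nat.cast_nonneg N) (by linarith)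
  positivity

/-! ### The points on the logarithmic scale -/

/-- The test function `f (η, s)` in the coordinate `y = b ^ η`, after linearizing the logarithm:
a gap `s` in `y` becomes the gap `s / (y log b)` in `η`. Only `y ≥ 1` matters. -/
def logTest (b : ℝ) (f : ℝ × ℝ → ℝ) (p : ℝ × ℝ) : ℝ :=
  f (Real.logb b (max 1 p.1), p.2 / (max 1 p.1 * Real.log b))

theorem continuous_logTest {b : ℝ} (hb : 1 < b) {f : ℝ × ℝ → ℝ} (hf : Continuous f) :
    Continuous (logTest b f) := by
  have hL : 0 < Real.log b := Real.log_pos hb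
  have hpos : ∀ p : ℝ × ℝ, 0 < max 1 p.1 := fun p => zero_lt_one.trans_le (le_max_left _ _)
  have hmax : Continuous fun p : ℝ × ℝ => max 1 p.1 := by fun_prop
  refine hf.comp (Continuous.prodMk ?_ ?_)
  · exact (hmax.log fun p => (hpos p).ne').div_const _
  · exact continuous_snd.div₀ (hmax.mul continuous_const)
      fun p => (mul_pos (hpos p) hL).ne'

theorem mul_logb_one_add_div_bounds {b : ℝ} (hb : 1 < b) {N : ℕ} (hN : 0 < N) {z : ℝ}
    (hz : 0 ≤ z) :
    0 ≤ N * Real.logb b (1 + z / N) ∧ N * Real.logb b (1 + z / N) ≤ z / Real.log b ∧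
      z / Real.log b - z ^ 2 / Real.log b * (N : ℝ)⁻¹ ≤ N * Real.logb b (1 + z / N) := by
  have hL : 0 < Real.log b := Real.log_pos hb
  have hN' : (0 : ℝ) < N := by exact_mod_cast hN
  have hx : 0 ≤ z / N := by positivity
  have h1 : Real.log (1 + z / N) ≤ z / N := by
    have := Real.log_le_sub_one_of_pos (show 0 < 1 + z / N by linarith)
    linarith
  have h2 : z / N - (z / N) ^ 2 ≤ Real.log (1 + z / N) := by
    refine le_trans ?_ (Real.one_sub_inv_le_log_of_pos (show 0 < 1 + z / N by linarith))
    have h3 : 0 < 1 + z / N := by linarith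
    have h4 : 1 - (1 + z / N)⁻¹ = z / N / (1 + z / N) := by
      rw [eq_div_iff h3.ne', sub_mul, inv_mul_cancel₀ h3.ne']; ring
    rw [h4, le_div_iff₀ h3]
    nlinarith [mul_nonneg hx (sq_nonneg (z / N))]
  refine ⟨mul_nonneg hN'.le (Real.logb_nonneg hb (by linarith)), ?_, ?_⟩
  · rw [Real.logb, ← mul_div_assoc]
    gcongr
    calc N * Real.log (1 + z / N) ≤ N * (z / N) := by gcongr
      _ = z := by field_simp
  · rw [Real.logb, ← mul_div_assoc, div_mul_eq_mul_div, ← sub_div]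
    gcongr
    calc z - z ^ 2 * (N : ℝ)⁻¹ = N * (z / N - (z / N) ^ 2) := by field_simp
      _ ≤ N * Real.log (1 + z / N) := by gcongr

/-- The limit theorem for points and gaps on the logarithmic scale, before the limit is rewritten in
terms of the limit laws of the statement. -/
theorem tendsto_average_log {b : ℝ} (hb : 1 < b) {m r : ℕ} (hr : 0 < r) (hbr : b ^ r = m)
    (hrel : ∀ l : Fin r → ℤ, ∑ j, (l j : ℝ) * b ^ (j : ℕ) = 0 → l = 0)
    {f : ℝ × ℝ → ℝ} (hf : Continuous f) {C : ℝ} (hC : ∀ z, |f z| ≤ C) :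
    Tendsto (fun N : ℕ => (N : ℝ)⁻¹ * ∑ i ∈ Finset.range N, f (ordered (eta b N) N i,
        N * (ordered (eta b N) N (i + 1) - ordered (eta b N) N i))) atTop
      (𝓝 ((b ^ r)⁻¹ / (b - 1) * (∫ y in (1 : ℝ)..b, logTest b f (y, 0)) +
        b⁻¹ * ∫ y in (1 : ℝ)..b, ∫ t, logTest b f (y, b * t) ∂(R b r))) := by
  have hb0 : 0 < b := by linarith
  have hL : 0 < Real.log b := Real.log_pos hb
  let HN : ℕ → ℝ × ℝ → ℝ := fun N p =>
    f (Real.logb b p.1, N * Real.logb b (1 + p.2 / p.1 / N))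
  have hconv : ∀ ε > 0, ∀ᶠ N in atTop, ∀ y ∈ Icc 1 b, ∀ s ∈ Icc 0 b,
      |HN N (y, s) - logTest b f (y, s)| ≤ ε := by
    intro ε hε
    have hK : IsCompact (Icc (0 : ℝ) 1 ×ˢ Icc (0 : ℝ) (b / Real.log b)) :=
      isCompact_Icc.prod isCompact_Icc
    obtain ⟨δ, hδ, hu⟩ := Metric.uniformContinuousOn_iff.1
      (hK.uniformContinuousOn_of_continuous hf.continuousOn) ε hε
    have hz : Tendsto (fun N : ℕ => b ^ 2 / Real.log b * (N : ℝ)⁻¹) atTop (𝓝 0) := by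
      simpa using (tendsto_inv_atTop_nhds_zero_nat (𝕜 := ℝ)).const_mul (b ^ 2 / Real.log b)
    filter_upwards [eventually_gt_atTop 0, (tendsto_order.1 hz).2 δ hδ] with N hN hNδ y hy s hs
    have hy0 : 0 < y := by linarith [hy.1]
    have hsy0 : 0 ≤ s / y := div_nonneg hs.1 hy0.le
    have hsyb : s / y ≤ b := (div_le_self hs.1 hy.1).trans hs.2
    obtain ⟨b1, b2, b3⟩ := mul_logb_one_add_div_bounds hb hN hsy0
    have hle : s / y / Real.log b ≤ b / Real.log b := by gcongr
    have hx : Real.logb b y ∈ Icc (0 : ℝ) 1 := by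
      refine ⟨Real.logb_nonneg hb hy.1, ?_⟩
      rw [Real.logb_le_iff_le_rpow hb hy0, Real.rpow_one]; exact hy.2
    have hd : dist (Real.logb b y, (N : ℝ) * Real.logb b (1 + s / y / N))
        (Real.logb b y, s / y / Real.log b) < δ := by
      rw [Prod.dist_eq, dist_self, max_eq_right dist_nonneg, Real.dist_eq, abs_sub_comm,
        abs_of_nonneg (by linarith)]
      have h4 : (s / y) ^ 2 / Real.log b * (N : ℝ)⁻¹ ≤ b ^ 2 / Real.log b * (N : ℝ)⁻¹ := by gcongr
      linarith
    have := hu _ ⟨hx, b1, b2.trans hle⟩ _ ⟨hx, div_nonneg hsy0 hL.le, hle⟩ hd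
    rw [Real.dist_eq] at this
    simp only [HN, logTest, max_eq_right hy.1]
    rw [← div_div]
    exact this.le
  have h := tendsto_average_ordered hb hr hbr hrel (continuous_logTest hb hf) (fun z => hC _)
    (HN := HN) (fun N z => hC _) hconv
  refine h.congr' ?_
  filter_upwards [eventually_gt_atTop 0] with N hN
  congr 1
  refine Finset.sum_congr rfl fun i _ => ?_
  have hy0 : 0 < b ^ ordered (eta b N) N i := Real.rpow_pos_of_pos hb0 _
  have e : 1 + N * (b ^ ordered (eta b N) N (i + 1) - b ^ ordered (eta b N) N i) /
      b ^ ordered (eta b N) N i / N =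
      b ^ (ordered (eta b N) N (i + 1) - ordered (eta b N) N i) := by
    rw [Real.rpow_sub hb0]
    field_simp
    ring
  simp only [HN, e, Real.logb_rpow hb0 hb.ne']

theorem tendsto_PNjoint {b : ℝ} (hb : 1 < b) {m r : ℕ} (hr : 0 < r) (hbr : b ^ r = m)
    (hrel : ∀ l : Fin r → ℤ, ∑ j, (l j : ℝ) * b ^ (j : ℕ) = 0 → l = 0)
    {f : ℝ × ℝ → ℝ} (hf : ContinuousOn f (Icc 0 1 ×ˢ Ici 0)) {C : ℝ}
    (hC : ∀ z ∈ Icc (0 : ℝ) 1 ×ˢ Ici (0 : ℝ), |f z| ≤ C) :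
    Tendsto (fun N : ℕ => ∫ z, f z ∂(PNjoint b N)) atTop
      (𝓝 (∫ x in (0 : ℝ)..1, ∫ s, f (x, s) ∂(jointGapLaw b r x))) := by
  have hb0 : 0 < b := by linarith
  have hL : 0 < Real.log b := Real.log_pos hb
  have := isFiniteMeasure_R hb hr
  have hF := continuous_clampFun hf
  have hFC : ∀ p, |clampFun f p| ≤ C := fun p => hC _ (clamp_mem p)
  have h := tendsto_average_log hb hr hbr hrel hF hFC
  set H := logTest b (clampFun f) with hHdef
  have hH : Continuous H := continuous_logTest hb hF
  have hHC : ∀ z, |H z| ≤ C := fun z => hFC _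
  have hHb : Continuous fun p : ℝ × ℝ => H (p.1, b * p.2) := hH.comp (by fun_prop)
  let g : ℝ → ℝ := fun y => (b ^ r)⁻¹ / (b - 1) * H (y, 0) + b⁻¹ * ∫ t, H (y, b * t) ∂(R b r)
  have hc1 : Continuous fun y : ℝ => (b ^ r)⁻¹ / (b - 1) * H (y, 0) :=
    (hH.comp (by fun_prop : Continuous fun y : ℝ => (y, (0 : ℝ)))).const_mul _
  have hc2 : Continuous fun y : ℝ => b⁻¹ * ∫ t, H (y, b * t) ∂(R b r) :=
    (continuous_integral_of_bounded hHb fun z => hHC _).const_mul _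
  have hlimit : (b ^ r)⁻¹ / (b - 1) * (∫ y in (1 : ℝ)..b, H (y, 0)) +
        b⁻¹ * (∫ y in (1 : ℝ)..b, ∫ t, H (y, b * t) ∂(R b r)) =
      ∫ x in (0 : ℝ)..1, ∫ s, f (x, s) ∂(jointGapLaw b r x) := by
    have hsub := intervalIntegral.integral_comp_mul_deriv (a := 0) (b := 1)
      (f := fun x : ℝ => b ^ x) (f' := fun x => b ^ x * Real.log b) (g := g)
      (fun x _ => (Real.hasStrictDerivAt_const_rpow hb0 x).hasDerivAt)
      (((Real.continuous_const_rpow hb0.ne').mul continuous_const).continuousOn) (hc1.add hc2)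
    rw [Real.rpow_zero, Real.rpow_one] at hsub
    rw [← intervalIntegral.integral_const_mul, ← intervalIntegral.integral_const_mul,
      ← intervalIntegral.integral_add (hc1.intervalIntegrable _ _) (hc2.intervalIntegrable _ _)]
    refine hsub.symm.trans (intervalIntegral.integral_congr fun x hx => ?_)
    rw [uIcc_of_le zero_le_one] at hx
    have hpx1 : 1 ≤ b ^ x := Real.one_le_rpow hb.le hx.1
    have hp1 : b ^ (x - 1) = b ^ x / b := by rw [Real.rpow_sub hb0, Real.rpow_one]
    have hpr : b ^ (x - (r : ℝ)) = b ^ x / b ^ r := by rw [Real.rpow_sub hb0, Real.rpow_natCast]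
    dsimp only [Function.comp]
    rw [jointGapLaw, integral_dirac_add_dilate_R hb hr (by positivity)
        (sq_nonneg _) (by positivity) (g := fun s => clampFun f (x, s)) (hF.comp (by fun_prop))
        (fun s => hFC _) (fun s hs => (clampFun_eq f hx hs).symm)]
    have e2 : ∀ t : ℝ, b * t / (b ^ x * Real.log b) = t / (b ^ (x - 1) * Real.log b) := fun t => by
      rw [hp1]; field_simp
    simp only [g, hHdef, logTest, max_eq_right hpx1, Real.logb_rpow hb0 hb.ne', zero_div, e2, hpr,
      hp1]
    field_simp
  rw [hlimit] at h
  refine h.congr fun N => ?_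
  rw [PNjoint, jointGapMeasure, integral_sum_smul_dirac]
  congr 1
  refine Finset.sum_congr rfl fun i hi => ?_
  have hi' := Finset.mem_range.1 hi
  exact clampFun_eq f (Ico_subset_Icc_self (ordered_eta_mem b hi'))
    (mul_nonneg (Nat.cast_nonneg N) (sub_nonneg.2 (ordered_eta_le_succ b hi')))

theorem integral_gapLaw {b : ℝ} (hb : 1 < b) {r : ℕ} (hr : 0 < r) {f g : ℝ → ℝ}
    (hg : Continuous g) {C : ℝ} (hC : ∀ s, |g s| ≤ C) (hfg : ∀ s, 0 ≤ s → f s = g s) :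
    ∫ s, f s ∂(gapLaw b r) = (b ^ r)⁻¹ * g 0 +
      b⁻¹ * ∫ y in (1 : ℝ)..b, ∫ t, g (b * t / (y * Real.log b)) ∂(R b r) := by
  have hb0 : 0 < b := by linarith
  have := isFiniteMeasure_R hb hr
  have hm : Measurable fun p : ℝ × ℝ => b * p.2 / (p.1 * Real.log b) := by fun_prop
  have hae : ∀ᵐ s ∂(gapLaw b r), (0 : ℝ) ≤ s := by
    rw [gapLaw, ae_add_measure_iff]
    refine ⟨Measure.ae_smul_measure ?_ _, ?_⟩
    · rw [ae_dirac_eq]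
      exact le_refl (0 : ℝ)
    · refine (withDensity_absolutelyContinuous _ _).ae_le ?_
      filter_upwards [ae_restrict_mem measurableSet_Ioi] with s hs
      exact le_of_lt hs
  rw [integral_congr_ae (hae.mono fun s hs => hfg s hs), gapLaw, gapDensity_eq_map hb hr,
    integral_add_measure, integral_smul_measure, integral_smul_measure, integral_dirac,
    integral_map hm.aemeasurable hg.aestronglyMeasurable,
    integral_prod (fun p : ℝ × ℝ => g (b * p.2 / (p.1 * Real.log b)))
      (Integrable.of_bound (hg.measurable.comp hm).aestronglyMeasurable C
        (.of_forall fun _ => hC _)), ENNReal.toReal_ofReal (Real.rpow_nonneg hb0.le _),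
    ENNReal.toReal_ofReal (inv_nonneg.2 hb0.le), intervalIntegral.integral_of_le hb.le,
    integral_Ioc_eq_integral_Ioo, Real.rpow_neg hb0.le, Real.rpow_natCast]
  · rfl
  · exact (integrable_dirac (by simp)).smul_measure ENNReal.ofReal_ne_top
  · exact (Integrable.of_bound hg.aestronglyMeasurable C
      (.of_forall hC)).smul_measure ENNReal.ofReal_ne_top

theorem tendsto_PN {b : ℝ} (hb : 1 < b) {m r : ℕ} (hr : 0 < r) (hbr : b ^ r = m)
    (hrel : ∀ l : Fin r → ℤ, ∑ j, (l j : ℝ) * b ^ (j : ℕ) = 0 → l = 0)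
    {f : ℝ → ℝ} (hf : ContinuousOn f (Ici 0)) {C : ℝ} (hC : ∀ s ∈ Ici (0 : ℝ), |f s| ≤ C) :
    Tendsto (fun N : ℕ => ∫ s, f s ∂(PN b N)) atTop (𝓝 (∫ s, f s ∂(gapLaw b r))) := by
  have hb1 : 0 < b - 1 := by linarith
  let g : ℝ → ℝ := fun s => f (max s 0)
  have hg : Continuous g := hf.comp_continuous (by fun_prop) fun s => le_max_right s 0
  have hgC : ∀ s, |g s| ≤ C := fun s => hC _ (le_max_right s 0)
  have hfg : ∀ s, 0 ≤ s → f s = g s := fun s hs => by simp only [g, max_eq_left hs]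
  have h := tendsto_average_log hb hr hbr hrel (f := fun p => g p.2) (hg.comp continuous_snd)
    (fun z => hgC _)
  have hlimit : (b ^ r)⁻¹ / (b - 1) *
        (∫ y in (1 : ℝ)..b, logTest b (fun p => g p.2) (y, 0)) +
        b⁻¹ * (∫ y in (1 : ℝ)..b, ∫ t, logTest b (fun p => g p.2) (y, b * t) ∂(R b r)) =
      ∫ s, f s ∂(gapLaw b r) := by
    rw [integral_gapLaw hb hr hg hgC hfg]
    congr 1
    · simp only [logTest, zero_div, intervalIntegral.integral_const, smul_eq_mul]
      field_simp
    · congr 1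
      refine intervalIntegral.integral_congr fun y hy => ?_
      rw [uIcc_of_le hb.le] at hy
      simp only [logTest, max_eq_right hy.1]
  rw [hlimit] at h
  refine h.congr' ?_
  filter_upwards [eventually_gt_atTop 0] with N hN
  have hN' : (0 : ℝ) < N := by exact_mod_cast hN
  rw [PN, gapMeasure, integral_sum_smul_dirac]
  congr 1
  -- the points `eta` arise from the points `xi` by a rotation of the circle
  rw [sum_ordered_rotate hN (xi_mem b) (v' := eta b N) (Real.logb b N) (fun n hn => ?_)
    (eta_mem b N) fun s => f (N * s)]
  · refine Finset.sum_congr rfl fun i hi => ?_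
    exact (hfg _ (mul_nonneg hN'.le
      (sub_nonneg.2 (ordered_eta_le_succ b (Finset.mem_range.1 hi))))).symm
  · have hn0 : (n : ℝ) ≠ 0 := by
      have := (Finset.mem_Icc.1 hn).1
      exact_mod_cast (by omega : n ≠ 0)
    rw [eta, xi, Real.logb_div hn0 hN'.ne', Int.fract_eq_fract]
    exact ⟨⌊Real.logb b n⌋, by rw [Int.fract]; ring⟩

end LogGaps

end

theorem mainTheorem6 (m r : ℕ) (hm : 1 < m) (hr : 0 < r)
    (hroot : ∀ p : ℕ, p.Prime → p ∣ r → ¬ ∃ k : ℤ, (m : ℝ) ^ ((1 : ℝ) / p) = k)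
    (b : ℝ) (hb : b = (m : ℝ) ^ ((1 : ℝ) / r)) :
    -- the gap distribution
    (∀ f : ℝ → ℝ, ContinuousOn f (Ici 0) → (∃ C, ∀ s ∈ Ici (0 : ℝ), |f s| ≤ C) →
      Tendsto (fun N : ℕ => ∫ s, f s ∂(LogGaps.PN b N)) atTop
        (𝓝 (∫ s, f s ∂(LogGaps.gapLaw b r)))) ∧
    -- the joint distribution of points and gaps
    (∀ f : ℝ × ℝ → ℝ, ContinuousOn f (Icc 0 1 ×ˢ Ici 0) →
      (∃ C, ∀ z ∈ Icc (0 : ℝ) 1 ×ˢ Ici (0 : ℝ), |f z| ≤ C) →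
      Tendsto (fun N : ℕ => ∫ z, f z ∂(LogGaps.PNjoint b N)) atTop
        (𝓝 (∫ x in (0 : ℝ)..1, ∫ s, f (x, s) ∂(LogGaps.jointGapLaw b r x)))) ∧
    -- the joint distribution of rescaled points and gaps
    (∀ f : ℝ × ℝ → ℝ, ContinuousOn f (Icc 0 1 ×ˢ Ici 0) →
      (∃ C, ∀ z ∈ Icc (0 : ℝ) 1 ×ˢ Ici (0 : ℝ), |f z| ≤ C) →
      Tendsto (fun N : ℕ => ∫ z, f z ∂(LogGaps.PNtilde b N)) atTop
        (𝓝 (∫ x in (0 : ℝ)..1, ∫ s, f (x, s) ∂(LogGaps.rescaledGapLaw b r)))) := by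
  have hm' : (1 : ℝ) < m := by exact_mod_cast hm
  have hb1 : 1 < b := by rw [hb]; exact Real.one_lt_rpow hm' (by positivity)
  have hbr : b ^ r = m := by
    rw [hb, one_div]; exact Real.rpow_inv_natCast_pow (by positivity) hr.ne'
  have hrel := LogGaps.int_relation_eq_zero (by linarith) hr hbr hroot
  exact ⟨fun f hf ⟨_, hC⟩ => LogGaps.tendsto_PN hb1 hr hbr hrel hf hC,
    fun f hf ⟨_, hC⟩ => LogGaps.tendsto_PNjoint hb1 hr hbr hrel hf hC,
    fun f hf ⟨_, hC⟩ => LogGaps.tendsto_PNtilde hb1 hr hbr hrel hf hC⟩
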